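/- Let $\mathbf k$ be a field of characteristic zero. Operads are symmetric coloured operads in $\mathbb Z$-graded chain complexes over $\mathbf k$ (differential of degree $-1$). An operad $\mathcal R$ is called cofibrant if $\mathcal R=(\Gamma(E),\partial)$, where $\Gamma(E)$ is the free graded operad on a collection $E=\bigoplus_{n\ge 0}E_n$ and $\partial(E_n)\subset\Gamma(E)_{<n}:=\Gamma(\bigoplus_{j<n}E_j)$. More generally, a map $\mathcal S\to\mathcal Q$ is a cofibration if $\mathcal Q=\mathcal S*\Gamma(E)$ as a graded operad, with $E=\bigoplus_{n\ge0} E_n$ and $\partial(E_n)\subset \mathcal S*\Gamma(E)_{<n}$. A cofibrant resolution of an operad $\mathcal P$ is a morphism $\mathcal R\to\mathcal P$ from a cofibrant operad that is a homology isomorphism. Let $\mathcal P$ be an ordinary (one-coloured) operad with trivial differential, $\mathcal P(0)=0$ and $\mathcal P(1)\cong\mathbf k$, and let $$\mathcal P_{\bullet\to\bullet}=\frac{\mathcal P_{\bullet_1}*\mathcal P_{\bullet_2}*\Gamma(f)}{(f p_{\bullet_1}=p_{\bullet_2}f^{\otimes n},\ p\in\mathcal P(n))}$$ be the two-coloured operad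 whose algebras are the homomorphisms of $\mathcal P$-algebras, $f$ being an arrow of degree $0$ from the first colour to the second. Let $\alpha:\mathcal R_{\bullet\to\bullet}\to\mathcal P_{\bullet\to\bullet}$ be a cofibrant resolution and let $\#:\Gamma(u)\to\mathcal R_{\bullet\to\bullet}$ be a morphism from the free operad on an arrow $u$ of degree $0$ with $\partial u=0$, such that $\alpha(\#(u))=f$. For chain complexes $V,W$ and a morphism $A:\mathcal R_{\bullet\to\bullet}\to\mathcal End_{V,W}$ into the coloured endomorphism operad (a strongly homotopy $\mathcal P$-homomorphism), the chain map $A(\#(u)):V\to W$ is the underlying map of $A$. (1) If $A:\mathcal R_{\bullet\to\bullet}\to\mathcal End_{V,W}$ is a strongly homotopy $\mathcal P$-homomorphism with underlying map $f_\#:V\to W$, and $g:V\to W$ is a chain map that is chain homotopic to $f_\#$, then there is a strongly homotopy $\mathcal P$-homomorphism $B:\mathcal R_{\bullet\to\bullet}\to\mathcal End_{V,W}$ whose underlying map is $g$. (2) Source and target can be kept fixed. Let $\alpha_\bullet:\mathcal R_\bullet\to\mathcal P$ be a cofibrant resolution, so that strongly homotopy $\mathcal P$-algebras are $\mathcal R_\bullet$-algebras,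 and let $i_1,i_2$ be morphisms from $\mathcal R_\bullet$ to the parts of $\mathcal R_{\bullet\to\bullet}$ of the first and of the second colour, lifting (along $\alpha_\bullet$ and $\alpha$) the two canonical maps from $\mathcal P$ to $\mathcal P_{\bullet\to\bullet}$, such that the induced map $\mathcal R_{\bullet_1}*\mathcal R_{\bullet_2}*\Gamma(u)\to\mathcal R_{\bullet\to\bullet}$ given by $i_1,i_2,\#$ is a cofibration. Let $\mathbf V$ and $\mathbf W$ be strongly homotopy $\mathcal P$-algebras on $V$ and $W$, and let $\mathbf f:\mathbf V\to\mathbf W$ be a strongly homotopy $\mathcal P$-morphism, that is, a morphism $A:\mathcal R_{\bullet\to\bullet}\to\mathcal End_{V,W}$ with $A\circ i_1=\mathbf V$ and $A\circ i_2=\mathbf W$. Then for every chain map $g:V\to W$ that is chain homotopic to the underlying map of $\mathbf f$ there is a strongly homotopy $\mathcal P$-morphism $\mathbf g:\mathbf V\to\mathbf W$ whose underlying map is $g$. -/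

import Mathlib

open CategoryTheory

universe u

/-- Grafting data for the partial composition `x ∘ᵢ y` of coloured operads: `x` has input colours
`c`, `y` has input colours `c'` and output colour `b = c i`, and the bijection `e` labels the inputs
of the composite (the inputs of `x` other than `i`, and all inputs of `y`) by `Fin r`, compatibly
with the colours `c''`. The labelling is arbitrary; `Graft.IsPlanar` singles out the usual one. -/
structure Graft {C : Type} {m n r : ℕ} (c : Fin m → C) (i : Fin m) (c' : Fin n → C) (b : C)
    (c'' : Fin r → C) where
  /-- labels of the inputs of the composite -/
  e : {j : Fin m // j ≠ i} ⊕ Fin n ≃ Fin r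
  root : c i = b
  outer : ∀ j, c'' (e (Sum.inl j)) = c j.1
  inner : ∀ l, c'' (e (Sum.inr l)) = c' l

namespace Graft

variable {C D : Type} {m n r : ℕ} {c : Fin m → C} {i : Fin m} {c' : Fin n → C} {b : C}
  {c'' : Fin r → C}

/-- Change of colours. -/
def recolor (f : C → D) (g : Graft c i c' b c'') :
    Graft (fun j => f (c j)) i (fun j => f (c' j)) (f b) (fun j => f (c'' j)) where
  e := g.e
  root := congrArg f g.root
  outer j := congrArg f (g.outer j)
  inner l := congrArg f (g.inner l)

/-- The inputs of the composite are labelled in the usual order: the inputs of `y` are inserted, in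
their order, at the place of the input `i` of `x`. -/
def IsPlanar (g : Graft c i c' b c'') : Prop :=
  (∀ j j', g.e (Sum.inl j) < g.e (Sum.inl j') ↔ j.1 < j'.1) ∧
  (∀ l l', g.e (Sum.inr l) < g.e (Sum.inr l') ↔ l < l') ∧
  (∀ j l, g.e (Sum.inl j) < g.e (Sum.inr l) ↔ j.1 < i)

end Graft

/-- A (symmetric, unital) `C`-coloured operad in `ℤ`-graded `k`-vector spaces, in terms of partial
compositions. `X n c o p` is the space of operations of degree `p` with inputs of colours
`c 0, …, c (n-1)` and output of colour `o`. The map `map σ` renames the input `j` to `σ j`; it is the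
action of the symmetric groups. Degrees and colours of results are passed as arguments together with
the equations they satisfy. -/
structure GradedOperad (k : Type u) [Field k] (C : Type) where
  X : (n : ℕ) → (Fin n → C) → C → ℤ → Type u
  [addCommGroup : ∀ n c o p, AddCommGroup (X n c o p)]
  [module : ∀ n c o p, Module k (X n c o p)]
  /-- symmetric group action -/
  map : ∀ {n n' : ℕ} {c : Fin n → C} {c' : Fin n' → C} {o : C} {p : ℤ} (σ : Fin n ≃ Fin n'),
    (∀ j, c' (σ j) = c j) → (X n c o p →ₗ[k] X n' c' o p)
  /-- operadic units -/
  one : ∀ o : C, X 1 (fun _ => o) o 0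
  /-- partial composition `x ∘ᵢ y` -/
  comp : ∀ {m n r : ℕ} {c : Fin m → C} {i : Fin m} {c' : Fin n → C} {b : C} {c'' : Fin r → C}
    {o : C} {p q t : ℤ}, Graft c i c' b c'' → p + q = t →
    (X m c o p →ₗ[k] X n c' b q →ₗ[k] X r c'' o t)
  map_refl : ∀ {n : ℕ} {c : Fin n → C} {o : C} {p : ℤ} (x : X n c o p),
    map (Equiv.refl _) (fun _ => rfl) x = x
  map_map : ∀ {n n' n'' : ℕ} {c : Fin n → C} {c' : Fin n' → C} {c'' : Fin n'' → C} {o : C} {p : ℤ}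
    (σ : Fin n ≃ Fin n') (hσ : ∀ j, c' (σ j) = c j) (τ : Fin n' ≃ Fin n'')
    (hτ : ∀ j, c'' (τ j) = c' j) (x : X n c o p),
    map τ hτ (map σ hσ x) = map (σ.trans τ) (fun j => (hτ (σ j)).trans (hσ j)) x
  /-- equivariance of the compositions -/
  comp_map : ∀ {m n r m₁ n₁ r₁ : ℕ} {c : Fin m → C} {i : Fin m} {c' : Fin n → C} {b : C}
    {c'' : Fin r → C} {c₁ : Fin m₁ → C} {c₁' : Fin n₁ → C} {c₁'' : Fin r₁ → C}
    {o : C} {p q t : ℤ} (h : p + q = t)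
    (σ : Fin m ≃ Fin m₁) (hσ : ∀ j, c₁ (σ j) = c j) (τ : Fin n ≃ Fin n₁) (hτ : ∀ j, c₁' (τ j) = c' j)
    (ρ : Fin r ≃ Fin r₁) (hρ : ∀ j, c₁'' (ρ j) = c'' j)
    (g : Graft c i c' b c'') (g₁ : Graft c₁ (σ i) c₁' b c₁'')
    (_ : ∀ j : {j // j ≠ i},
      g₁.e (Sum.inl ⟨σ j.1, fun w => j.2 (σ.injective w)⟩) = ρ (g.e (Sum.inl j)))
    (_ : ∀ l, g₁.e (Sum.inr (τ l)) = ρ (g.e (Sum.inr l)))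
    (x : X m c o p) (y : X n c' b q),
    comp g₁ h (map σ hσ x) (map τ hτ y) = map ρ hρ (comp g h x y)
  one_comp : ∀ {n r : ℕ} {c' : Fin n → C} {b : C} {c'' : Fin r → C} {q : ℤ}
    (g : Graft (fun _ : Fin 1 => b) 0 c' b c'') (σ : Fin n ≃ Fin r) (hσ : ∀ j, c'' (σ j) = c' j)
    (_ : ∀ l, σ l = g.e (Sum.inr l)) (y : X n c' b q),
    comp g (zero_add q) (one b) y = map σ hσ y
  comp_one : ∀ {m r : ℕ} {c : Fin m → C} {i : Fin m} {b : C} {c'' : Fin r → C} {o : C} {p : ℤ}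
    (g : Graft c i (fun _ : Fin 1 => b) b c'') (σ : Fin m ≃ Fin r) (hσ : ∀ j, c'' (σ j) = c j)
    (_ : ∀ j : {j // j ≠ i}, σ j.1 = g.e (Sum.inl j)) (_ : σ i = g.e (Sum.inr 0)) (x : X m c o p),
    comp g (add_zero p) x (one b) = map σ hσ x
  /-- `(x ∘ᵢ y) ∘ⱼ z = x ∘ᵢ (y ∘ⱼ z)` -/
  comp_assoc : ∀ {m n r n₁ n₂ n₃ : ℕ} {c : Fin m → C} {i : Fin m} {c' : Fin n → C} {b : C}
    {j : Fin n} {a : Fin r → C} {b' : C} {c₁ : Fin n₁ → C} {c₂ : Fin n₂ → C} {c₃ : Fin n₃ → C}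
    {o : C} {p q s pq qs t : ℤ} (h₁ : p + q = pq) (h₂ : pq + s = t) (h₃ : q + s = qs)
    (h₄ : p + qs = t)
    (g₁ : Graft c i c' b c₁) (g₂ : Graft c₁ (g₁.e (Sum.inr j)) a b' c₂)
    (g₃ : Graft c' j a b' c₃) (g₄ : Graft c i c₃ b c₂)
    (_ : ∀ (l : {l // l ≠ i}) w, g₂.e (Sum.inl ⟨g₁.e (Sum.inl l), w⟩) = g₄.e (Sum.inl l))
    (_ : ∀ (l : {l // l ≠ j}) w,
      g₂.e (Sum.inl ⟨g₁.e (Sum.inr l.1), w⟩) = g₄.e (Sum.inr (g₃.e (Sum.inl l))))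
    (_ : ∀ l, g₂.e (Sum.inr l) = g₄.e (Sum.inr (g₃.e (Sum.inr l))))
    (x : X m c o p) (y : X n c' b q) (z : X r a b' s),
    comp g₂ h₂ (comp g₁ h₁ x y) z = comp g₄ h₄ x (comp g₃ h₃ y z)
  /-- `(x ∘ᵢ y) ∘ⱼ z = (-1)^(|y||z|) (x ∘ⱼ z) ∘ᵢ y` for two inputs `i ≠ j` of `x` -/
  comp_comm : ∀ {m n r n₁ n₂ n₃ : ℕ} {c : Fin m → C} {i j : Fin m} (hij : i ≠ j) {c' : Fin n → C}
    {b : C} {a : Fin r → C} {b' : C} {c₁ : Fin n₁ → C} {c₂ : Fin n₂ → C} {c₃ : Fin n₃ → C}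
    {o : C} {p q s pq ps t : ℤ} (h₁ : p + q = pq) (h₂ : pq + s = t) (h₃ : p + s = ps)
    (h₄ : ps + q = t)
    (g₁ : Graft c i c' b c₁) (g₂ : Graft c₁ (g₁.e (Sum.inl ⟨j, hij.symm⟩)) a b' c₂)
    (g₃ : Graft c j a b' c₃) (g₄ : Graft c₃ (g₃.e (Sum.inl ⟨i, hij⟩)) c' b c₂)
    (_ : ∀ (l : Fin m) (hi : l ≠ i) (hj : l ≠ j) w w',
      g₂.e (Sum.inl ⟨g₁.e (Sum.inl ⟨l, hi⟩), w⟩) = g₄.e (Sum.inl ⟨g₃.e (Sum.inl ⟨l, hj⟩), w'⟩))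
    (_ : ∀ l w, g₂.e (Sum.inl ⟨g₁.e (Sum.inr l), w⟩) = g₄.e (Sum.inr l))
    (_ : ∀ l w, g₂.e (Sum.inr l) = g₄.e (Sum.inl ⟨g₃.e (Sum.inr l), w⟩))
    (x : X m c o p) (y : X n c' b q) (z : X r a b' s),
    comp g₂ h₂ (comp g₁ h₁ x y) z = (q * s).negOnePow • comp g₄ h₄ (comp g₃ h₃ x z) y

attribute [instance] GradedOperad.addCommGroup GradedOperad.module

namespace GradedOperad

variable {k : Type u} [Field k] {C D : Type}

/-- The `C`-coloured operad obtained from a `D`-coloured operad along `f : C → D`. For `C` a point,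
this is the ordinary operad of the operations all of whose inputs and output have colour `f ()`. -/
def pull (f : C → D) (Q : GradedOperad k D) : GradedOperad k C where
  X n c o p := Q.X n (fun j => f (c j)) (f o) p
  map σ hσ := Q.map σ (fun j => congrArg f (hσ j))
  one o := Q.one (f o)
  comp g h := Q.comp (g.recolor f) h
  map_refl x := Q.map_refl x
  map_map σ _ τ _ x := Q.map_map σ _ τ _ x
  comp_map h σ _ τ _ ρ _ g g₁ h₁ h₂ x y :=
    Q.comp_map h σ _ τ _ ρ _ (g.recolor f) (g₁.recolor f) h₁ h₂ x y
  one_comp g σ _ h y := Q.one_comp (g.recolor f) σ _ h y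
  comp_one g σ _ h h' x := Q.comp_one (g.recolor f) σ _ h h' x
  comp_assoc h₁ h₂ h₃ h₄ g₁ g₂ g₃ g₄ e₁ e₂ e₃ x y z :=
    Q.comp_assoc h₁ h₂ h₃ h₄ (g₁.recolor f) (g₂.recolor f) (g₃.recolor f) (g₄.recolor f)
      e₁ e₂ e₃ x y z
  comp_comm hij _ _ _ _ _ _ _ _ _ _ _ _ _ _ h₁ h₂ h₃ h₄ g₁ g₂ g₃ g₄ e₁ e₂ e₃ x y z :=
    Q.comp_comm hij h₁ h₂ h₃ h₄ (g₁.recolor f) (g₂.recolor f) (g₃.recolor f) (g₄.recolor f)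
      e₁ e₂ e₃ x y z

/-- Morphisms of graded coloured operads (with the same colours). -/
@[ext]
structure Hom (P Q : GradedOperad k C) where
  app : ∀ {n : ℕ} {c : Fin n → C} {o : C} {p : ℤ}, P.X n c o p →ₗ[k] Q.X n c o p
  app_map : ∀ {n n' : ℕ} {c : Fin n → C} {c' : Fin n' → C} {o : C} {p : ℤ} (σ : Fin n ≃ Fin n')
    (hσ : ∀ j, c' (σ j) = c j) (x : P.X n c o p), app (P.map σ hσ x) = Q.map σ hσ (app x)
  app_one : ∀ o : C, app (P.one o) = Q.one o
  app_comp : ∀ {m n r : ℕ} {c : Fin m → C} {i : Fin m} {c' : Fin n → C} {b : C} {c'' : Fin r → C}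
    {o : C} {p q t : ℤ} (g : Graft c i c' b c'') (h : p + q = t) (x : P.X m c o p)
    (y : P.X n c' b q), app (P.comp g h x y) = Q.comp g h (app x) (app y)

/-- A subcollection: subspaces stable under the symmetric groups. -/
structure SubCollection (Q : GradedOperad k C) where
  carrier : ∀ (n : ℕ) (c : Fin n → C) (o : C) (p : ℤ), Submodule k (Q.X n c o p)
  map_mem : ∀ {n n' : ℕ} {c : Fin n → C} {c' : Fin n' → C} {o : C} {p : ℤ} (σ : Fin n ≃ Fin n')
    (hσ : ∀ j, c' (σ j) = c j) {x : Q.X n c o p}, x ∈ carrier n c o p →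
    Q.map σ hσ x ∈ carrier n' c' o p

/-- Morphisms (of degree `0`) from a subcollection to the collection underlying an operad. -/
structure SubCollection.Hom {Q : GradedOperad k C} (E : SubCollection Q) (T : GradedOperad k C) where
  app : ∀ {n : ℕ} {c : Fin n → C} {o : C} {p : ℤ}, E.carrier n c o p →ₗ[k] T.X n c o p
  app_map : ∀ {n n' : ℕ} {c : Fin n → C} {c' : Fin n' → C} {o : C} {p : ℤ} (σ : Fin n ≃ Fin n')
    (hσ : ∀ j, c' (σ j) = c j) (x : E.carrier n c o p),
    app ⟨Q.map σ hσ x.1, E.map_mem σ hσ x.2⟩ = T.map σ hσ (app x)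

/-- A suboperad. -/
structure Suboperad (Q : GradedOperad k C) extends SubCollection Q where
  one_mem : ∀ o : C, Q.one o ∈ carrier 1 (fun _ => o) o 0
  comp_mem : ∀ {m n r : ℕ} {c : Fin m → C} {i : Fin m} {c' : Fin n → C} {b : C} {c'' : Fin r → C}
    {o : C} {p q t : ℤ} (g : Graft c i c' b c'') (h : p + q = t) {x : Q.X m c o p}
    {y : Q.X n c' b q}, x ∈ carrier m c o p → y ∈ carrier n c' b q →
    Q.comp g h x y ∈ carrier r c'' o t

/-- `P(0) = 0` and `P(1) ≅ k`, for an ordinary (one-coloured) operad `P`. -/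
def IsConnected (P : GradedOperad k Unit) : Prop :=
  (∀ c o p (x : P.X 0 c o p), x = 0) ∧
  (∀ c o p (x : P.X 1 c o p), p ≠ 0 → x = 0) ∧
  (∀ x : P.X 1 (fun _ => ()) () 0, ∃ a : k, x = a • P.one ()) ∧
  P.one () ≠ 0

/-- The operations of `homOperad`: `P(n)` if every input colour is `≤` the output colour (where
`false ≤ true`), and `0` otherwise. -/
def homSub (P : GradedOperad k Unit) (n : ℕ) (c : Fin n → Bool) (o : Bool) (p : ℤ) :
    Submodule k (P.X n (fun _ => ()) () p) where
  carrier := {x | (∀ j, c j ≤ o) ∨ x = 0}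
  add_mem' := by
    rintro a b (ha | ha) (hb | hb)
    · exact Or.inl ha
    · exact Or.inl ha
    · exact Or.inl hb
    · exact Or.inr (by rw [ha, hb, add_zero])
  zero_mem' := Or.inr rfl
  smul_mem' := by
    rintro a b (hb | hb)
    · exact Or.inl hb
    · exact Or.inr (by rw [hb, smul_zero])

theorem map_mem_homSub (P : GradedOperad k Unit) {n n' : ℕ} {c : Fin n → Bool} {c' : Fin n' → Bool}
    {o : Bool} {p : ℤ} (σ : Fin n ≃ Fin n') (hσ : ∀ j, c' (σ j) = c j) (x : P.homSub n c o p) :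
    P.map σ (fun _ => rfl) x.1 ∈ P.homSub n' c' o p := by
  obtain ⟨x, hx⟩ := x
  change (∀ j, c j ≤ o) ∨ x = 0 at hx
  rcases hx with hx | hx
  · refine Or.inl fun j => ?_
    have := hσ (σ.symm j)
    rw [Equiv.apply_symm_apply] at this
    rw [this]; exact hx _
  · exact Or.inr (by simp [hx])

theorem comp_mem_homSub (P : GradedOperad k Unit) {m n r : ℕ} {c : Fin m → Bool} {i : Fin m}
    {c' : Fin n → Bool} {b : Bool} {c'' : Fin r → Bool} {o : Bool} {p q t : ℤ}
    (g : Graft c i c' b c'') (h : p + q = t) (x : P.homSub m c o p) (y : P.homSub n c' b q) :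
    P.comp (g.recolor fun _ => ()) h x.1 y.1 ∈ P.homSub r c'' o t := by
  obtain ⟨x, hx⟩ := x
  obtain ⟨y, hy⟩ := y
  change (∀ j, c j ≤ o) ∨ x = 0 at hx
  change (∀ j, c' j ≤ b) ∨ y = 0 at hy
  rcases hx with hx | hx
  · rcases hy with hy | hy
    · refine Or.inl fun j => ?_
      obtain ⟨s, rfl⟩ := g.e.surjective j
      rcases s with s | s
      · rw [g.outer]; exact hx _
      · rw [g.inner]; exact (hy s).trans (g.root ▸ hx i)
    · exact Or.inr (by simp [hy])
  · exact Or.inr (by simp [hx])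

/-- The two-coloured operad `P_{• → •}` whose algebras are the homomorphisms `f : V → W` of
`P`-algebras; `false` is the colour of `V` and `true` that of `W`. It is the quotient of
`P_{•₁} * P_{•₂} * Γ(f)` by the relations `f p_{•₁} = p_{•₂} f^{⊗ n}`. These move all copies of `f`
to the inputs, so an operation with output `W` is some `p ∈ P(n)` acting on `W` with `f` applied to
all inputs from `V`, and an operation with output `V` is some `p ∈ P(n)` with all inputs from `V`.
Thus the space of operations is `P(n)` if every input colour is `≤` the output colour, and `0`
otherwise, and all structure is that of `P`. -/
def homOperad (P : GradedOperad k Unit) : GradedOperad k Bool where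
  X n c o p := P.homSub n c o p
  addCommGroup _ _ _ _ := inferInstance
  module _ _ _ _ := inferInstance
  map σ hσ :=
    { toFun := fun x => ⟨P.map σ (fun _ => rfl) x.1, P.map_mem_homSub σ hσ x⟩
      map_add' := fun _ _ => Subtype.ext (by simp)
      map_smul' := fun _ _ => Subtype.ext (by simp) }
  one o := ⟨P.one (), Or.inl fun _ => le_rfl⟩
  comp g h :=
    LinearMap.mk₂ k
      (fun x y => ⟨P.comp (g.recolor fun _ => ()) h x.1 y.1, P.comp_mem_homSub g h x y⟩)
      (fun _ _ _ => Subtype.ext (by simp)) (fun _ _ _ => Subtype.ext (by simp))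
      (fun _ _ _ => Subtype.ext (by simp)) (fun _ _ _ => Subtype.ext (by simp))
  map_refl x := Subtype.ext (P.map_refl x.1)
  map_map σ _ τ _ x :=
    Subtype.ext (P.map_map (c := fun _ => ()) (c' := fun _ => ()) σ (fun _ => rfl) τ
      (fun _ => rfl) x.1)
  comp_map h σ _ τ _ ρ _ g g₁ h₁ h₂ x y :=
    Subtype.ext (P.comp_map (c := fun _ => ()) (c' := fun _ => ()) (c'' := fun _ => ()) h σ
      (fun _ => rfl) τ (fun _ => rfl) ρ (fun _ => rfl)
      (g.recolor fun _ => ()) (g₁.recolor fun _ => ()) h₁ h₂ x.1 y.1)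
  one_comp g σ _ h y :=
    Subtype.ext (P.one_comp (g.recolor fun _ => ()) σ (fun _ => rfl) h y.1)
  comp_one g σ _ h h' x :=
    Subtype.ext (P.comp_one (g.recolor fun _ => ()) σ (fun _ => rfl) h h' x.1)
  comp_assoc h₁ h₂ h₃ h₄ g₁ g₂ g₃ g₄ e₁ e₂ e₃ x y z :=
    Subtype.ext (P.comp_assoc h₁ h₂ h₃ h₄ (g₁.recolor fun _ => ()) (g₂.recolor fun _ => ())
      (g₃.recolor fun _ => ()) (g₄.recolor fun _ => ()) e₁ e₂ e₃ x.1 y.1 z.1)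
  comp_comm hij _ _ _ _ _ _ _ _ _ _ _ _ _ _ h₁ h₂ h₃ h₄ g₁ g₂ g₃ g₄ e₁ e₂ e₃ x y z := by
    refine Subtype.ext ((P.comp_comm hij h₁ h₂ h₃ h₄ (g₁.recolor fun _ => ())
      (g₂.recolor fun _ => ()) (g₃.recolor fun _ => ()) (g₄.recolor fun _ => ())
      e₁ e₂ e₃ x.1 y.1 z.1).trans ?_)
    simp only [Units.smul_def]
    rfl

/-- The generator `f` of `P_{• → •}`. -/
def arrow (P : GradedOperad k Unit) : P.homOperad.X 1 (fun _ => false) true 0 :=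
  (⟨P.one (), Or.inl fun _ => Bool.false_le true⟩ : P.homSub 1 (fun _ => false) true 0)

end GradedOperad

/-- A `C`-coloured differential graded operad; the differential has degree `-1`. -/
structure DGOperad (k : Type u) [Field k] (C : Type) extends GradedOperad k C where
  diff : ∀ {n : ℕ} {c : Fin n → C} {o : C} {p p' : ℤ}, p' + 1 = p → (X n c o p →ₗ[k] X n c o p')
  diff_diff : ∀ {n : ℕ} {c : Fin n → C} {o : C} {p p' p'' : ℤ} (h : p' + 1 = p) (h' : p'' + 1 = p')
    (x : X n c o p), diff h' (diff h x) = 0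
  diff_map : ∀ {n n' : ℕ} {c : Fin n → C} {c' : Fin n' → C} {o : C} {p p' : ℤ} (σ : Fin n ≃ Fin n')
    (hσ : ∀ j, c' (σ j) = c j) (h : p' + 1 = p) (x : X n c o p),
    diff h (map σ hσ x) = map σ hσ (diff h x)
  diff_comp : ∀ {m n r : ℕ} {c : Fin m → C} {i : Fin m} {c' : Fin n → C} {b : C} {c'' : Fin r → C}
    {o : C} {p q t p' q' t' : ℤ} (g : Graft c i c' b c'') (h : p + q = t) (ht : t' + 1 = t)
    (hp : p' + 1 = p) (hq : q' + 1 = q) (h₁ : p' + q = t') (h₂ : p + q' = t')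
    (x : X m c o p) (y : X n c' b q),
    diff ht (comp g h x y) =
      comp g h₁ (diff hp x) y + p.negOnePow • comp g h₂ x (diff hq y)

namespace DGOperad

variable {k : Type u} [Field k] {C D : Type}

/-- A graded operad with the trivial differential. -/
def ofGraded (P : GradedOperad k C) : DGOperad k C where
  toGradedOperad := P
  diff _ := 0
  diff_diff _ _ _ := rfl
  diff_map _ _ _ _ := by simp
  diff_comp _ _ _ _ _ _ _ _ _ := by simp

/-- The `C`-coloured dg operad obtained from a `D`-coloured one along `f : C → D`. -/
def pull (f : C → D) (Q : DGOperad k D) : DGOperad k C where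
  toGradedOperad := Q.toGradedOperad.pull f
  diff h := Q.diff h
  diff_diff h h' x := Q.diff_diff h h' x
  diff_map σ _ h x := Q.diff_map σ _ h x
  diff_comp g h ht hp hq h₁ h₂ x y := Q.diff_comp (g.recolor f) h ht hp hq h₁ h₂ x y

/-- Morphisms of dg operads. -/
structure Hom (P Q : DGOperad k C) extends
    GradedOperad.Hom P.toGradedOperad Q.toGradedOperad where
  app_diff : ∀ {n : ℕ} {c : Fin n → C} {o : C} {p p' : ℤ} (h : p' + 1 = p) (x : P.X n c o p),
    app (P.diff h x) = Q.diff h (app x)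

/-- The copies of `P` in `P_{• → •}` at the source (`b = false`) and the target (`b = true`). -/
def homIncl (P : GradedOperad k Unit) (b : Bool) :
    Hom (ofGraded P) ((ofGraded P.homOperad).pull fun _ => b) where
  app {n _ _ p} :=
    { toFun := fun x => (⟨x, Or.inl fun _ => le_rfl⟩ : P.homSub n (fun _ => b) b p)
      map_add' := fun _ _ => rfl
      map_smul' := fun _ _ => rfl }
  app_map _ _ _ := rfl
  app_one _ := rfl
  app_comp _ _ _ _ := rfl
  app_diff _ _ := LinearMap.map_zero _

/-- `α` induces an isomorphism in homology. -/
def IsHomologyIso {P Q : DGOperad k C} (α : Hom P Q) : Prop :=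
  ∀ (n : ℕ) (c : Fin n → C) (o : C) (p p₁ p' : ℤ) (h : p + 1 = p₁) (h' : p' + 1 = p),
    (∀ x : P.X n c o p, P.diff h' x = 0 → (∃ y, Q.diff h y = α.app x) → ∃ z, P.diff h z = x) ∧
    (∀ y : Q.X n c o p, Q.diff h' y = 0 →
      ∃ x : P.X n c o p, P.diff h' x = 0 ∧ ∃ z, Q.diff h z = y - α.app x)

/-- `R` is (elementally) cofibrant: `R = (Γ(E), ∂)` is free, as a graded operad, on a collection
`E = ⨁ₙ Eₙ` such that `∂ Eₙ` lies in the suboperad generated by the `Eⱼ`, `j < n`. -/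
def IsCofibrant (R : DGOperad k C) : Prop :=
  ∃ E : ℕ → R.toGradedOperad.SubCollection,
    (∀ (T : GradedOperad.{u} k C) (ψ : ∀ N, (E N).Hom T),
      ∃! Φ : GradedOperad.Hom R.toGradedOperad T,
        ∀ (N n : ℕ) (c : Fin n → C) (o : C) (p : ℤ) (x : (E N).carrier n c o p),
          Φ.app x.1 = (ψ N).app x) ∧
    (∀ (N : ℕ) (K : R.toGradedOperad.Suboperad),
      (∀ N' < N, ∀ n c o p, (E N').carrier n c o p ≤ K.carrier n c o p) →
      ∀ (n : ℕ) (c : Fin n → C) (o : C) (p p' : ℤ) (h : p' + 1 = p),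
        ∀ x ∈ (E N).carrier n c o p, R.diff h x ∈ K.carrier n c o p')

/-- A cofibrant resolution (cofibrant model) of an operad with trivial differential. -/
def IsCofibrantResolution {R : DGOperad k C} {P : GradedOperad k C} (α : Hom R (ofGraded P)) :
    Prop :=
  R.IsCofibrant ∧ IsHomologyIso α

/-- For maps `i₀`, `i₁` from a dg operad `R₀` to the `false`- and the `true`-coloured parts of the
two-coloured dg operad `R`, and a cycle `s` of `R(false; true)` of degree `0`: the map
`S := R₀_{•₁} * R₀_{•₂} * Γ(u) → R` given by `i₀`, `i₁` and `u ↦ s` is an (elemental) cofibration.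
That is, as a graded operad `R = S * Γ(E)` for a collection `E = ⨁ₙ Eₙ` such that `∂ Eₙ` lies in the
suboperad generated by `S` and the `Eⱼ`, `j < n`. -/
def IsEndpointCofibration {R₀ : DGOperad k Unit} {R : DGOperad k Bool}
    (i₀ : Hom R₀ (R.pull fun _ => false)) (i₁ : Hom R₀ (R.pull fun _ => true))
    (s : R.X 1 (fun _ => false) true 0) : Prop :=
  ∃ E : ℕ → R.toGradedOperad.SubCollection,
    (∀ (T : GradedOperad.{u} k Bool)
      (φ₀ : GradedOperad.Hom R₀.toGradedOperad (T.pull fun _ => false))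
      (φ₁ : GradedOperad.Hom R₀.toGradedOperad (T.pull fun _ => true))
      (t : T.X 1 (fun _ => false) true 0) (ψ : ∀ N, (E N).Hom T),
      ∃! Φ : GradedOperad.Hom R.toGradedOperad T,
        (∀ (n : ℕ) (c : Fin n → Unit) (o : Unit) (p : ℤ) (x : R₀.X n c o p),
          Φ.app (i₀.app x) = φ₀.app x ∧ Φ.app (i₁.app x) = φ₁.app x) ∧
        Φ.app s = t ∧
        ∀ (N n : ℕ) (c : Fin n → Bool) (o : Bool) (p : ℤ) (x : (E N).carrier n c o p),
          Φ.app x.1 = (ψ N).app x) ∧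
    (∀ (N : ℕ) (K : R.toGradedOperad.Suboperad),
      (∀ (n : ℕ) (c : Fin n → Unit) (o : Unit) (p : ℤ) (x : R₀.X n c o p),
        i₀.app x ∈ K.carrier n (fun _ => false) false p ∧
        i₁.app x ∈ K.carrier n (fun _ => true) true p) →
      s ∈ K.carrier 1 (fun _ => false) true 0 →
      (∀ N' < N, ∀ n c o p, (E N').carrier n c o p ≤ K.carrier n c o p) →
      ∀ (n : ℕ) (c : Fin n → Bool) (o : Bool) (p p' : ℤ) (h : p' + 1 = p),
        ∀ x ∈ (E N).carrier n c o p, R.diff h x ∈ K.carrier n c o p')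

end DGOperad

section Algebras

variable {k : Type u} [Field k] {C : Type}

/-- The direct sum of all components of a chain complex. -/
abbrev Tot (V : ChainComplex (ModuleCat.{u} k) ℤ) : Type u :=
  DirectSum ℤ fun i => V.X i

/-- The differential on the direct sum of all components. -/
noncomputable def totD (V : ChainComplex (ModuleCat.{u} k) ℤ) : Tot V →ₗ[k] Tot V :=
  DirectSum.toModule k ℤ (Tot V) fun i =>
    (DirectSum.lof k ℤ (fun i => V.X i) (i - 1)).comp (V.d i (i - 1)).hom

/-- `a` is homogeneous of degree `i`. -/
def IsHomog {V : ChainComplex (ModuleCat.{u} k) ℤ} (i : ℤ) (a : Tot V) : Prop :=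
  ∃ v : V.X i, a = DirectSum.lof k ℤ (fun i => V.X i) i v

/-- Transport along an equality of colours. -/
def tcast (U : C → ChainComplex (ModuleCat.{u} k) ℤ) {c c' : C} (h : c = c') (a : Tot (U c)) :
    Tot (U c') :=
  h ▸ a

/-- The exponent of the Koszul sign of `a₀ ⊗ a₁ ⊗ ⋯ ↦ a_{σ 0} ⊗ a_{σ 1} ⊗ ⋯`, for `a j` of degree
`s j`. -/
def koszulExp {n n' : ℕ} (σ : Fin n ≃ Fin n') (s : Fin n' → ℤ) : ℤ :=
  ∑ j : Fin n, ∑ l : Fin n, if j < l ∧ σ l < σ j then s (σ j) * s (σ l) else 0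

/-- An algebra over the `C`-coloured dg operad `R` on the coloured chain complex `U = (U c)_{c : C}`,
that is, a morphism from `R` to the coloured endomorphism operad
`End_U(c₁, …, cₙ; o) = Hom(U c₁ ⊗ ⋯ ⊗ U cₙ, U o)` of `U`, with the Koszul sign rule. -/
structure OperadAlgebra (R : DGOperad k C) (U : C → ChainComplex (ModuleCat.{u} k) ℤ) where
  act : ∀ {n : ℕ} {c : Fin n → C} {o : C} {p : ℤ},
    R.X n c o p →ₗ[k] MultilinearMap k (fun j => Tot (U (c j))) (Tot (U o))
  /-- an operation of degree `p` acts as a map of degree `p` -/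
  act_homog : ∀ {n : ℕ} {c : Fin n → C} {o : C} {p : ℤ} (x : R.X n c o p) (s : Fin n → ℤ)
    (a : ∀ j, Tot (U (c j))), (∀ j, IsHomog (s j) (a j)) → IsHomog (p + ∑ j, s j) (act x a)
  act_map : ∀ {n n' : ℕ} {c : Fin n → C} {c' : Fin n' → C} {o : C} {p : ℤ} (σ : Fin n ≃ Fin n')
    (hσ : ∀ j, c' (σ j) = c j) (x : R.X n c o p) (s : Fin n' → ℤ) (a : ∀ j, Tot (U (c' j))),
    (∀ j, IsHomog (s j) (a j)) →
    act (R.map σ hσ x) a =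
      (koszulExp σ s).negOnePow • act x (fun j => tcast U (hσ j) (a (σ j)))
  act_one : ∀ (o : C) (a : Fin 1 → Tot (U o)), act (R.one o) a = a 0
  act_comp : ∀ {m n r : ℕ} {c : Fin m → C} {i : Fin m} {c' : Fin n → C} {b : C} {c'' : Fin r → C}
    {o : C} {p q t : ℤ} (g : Graft c i c' b c'') (_ : g.IsPlanar) (h : p + q = t)
    (x : R.X m c o p) (y : R.X n c' b q) (s : Fin r → ℤ) (a : ∀ j, Tot (U (c'' j))),
    (∀ j, IsHomog (s j) (a j)) →
    act (R.comp g h x y) a =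
      (q * ∑ j : {j // j ≠ i}, if j.1 < i then s (g.e (Sum.inl j)) else 0).negOnePow •
        act x (fun j =>
          if hj : j = i then
            tcast U (g.root.symm.trans (congrArg c hj.symm))
              (act y fun l => tcast U (g.inner l) (a (g.e (Sum.inr l))))
          else tcast U (g.outer ⟨j, hj⟩) (a (g.e (Sum.inl ⟨j, hj⟩))))
  /-- compatibility with the differentials: `∂x` acts as `d ∘ x - (-1)^|x| x ∘ d` -/
  act_diff : ∀ {n : ℕ} {c : Fin n → C} {o : C} {p p' : ℤ} (h : p' + 1 = p) (x : R.X n c o p)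
    (s : Fin n → ℤ) (a : ∀ j, Tot (U (c j))), (∀ j, IsHomog (s j) (a j)) →
    act (R.diff h x) a =
      totD (U o) (act x a) - p.negOnePow • ∑ j : Fin n,
        (∑ l : Fin n, if l < j then s l else 0).negOnePow •
          act x (Function.update a j (totD (U (c j)) (a j)))

namespace OperadAlgebra

/-- The operation `s` with one input acts as the chain map `f`. -/
def ActsAs {R : DGOperad k Bool} {U : Bool → ChainComplex (ModuleCat.{u} k) ℤ}
    (A : OperadAlgebra R U) (s : R.X 1 (fun _ => false) true 0) (f : U false ⟶ U true) : Prop :=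
  ∀ (i : ℤ) (v : (U false).X i),
    A.act s (fun _ => DirectSum.lof k ℤ (fun i => (U false).X i) i v) =
      DirectSum.lof k ℤ (fun i => (U true).X i) i ((f.f i).hom v)

/-- The algebra `A` over the two-coloured operad `R` restricts, along a morphism `φ` from `R₀` to the
`b`-coloured part of `R`, to the `R₀`-algebra `V`. -/
def RestrictsTo {R₀ : DGOperad k Unit} {R : DGOperad k Bool} {b : Bool}
    {U : Bool → ChainComplex (ModuleCat.{u} k) ℤ} (A : OperadAlgebra R U)
    (φ : DGOperad.Hom R₀ (R.pull fun _ => b)) (V : OperadAlgebra R₀ fun _ => U b) : Prop :=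
  ∀ (n : ℕ) (c : Fin n → Unit) (o : Unit) (p : ℤ) (x : R₀.X n c o p),
    A.act (φ.app x) = V.act x

end OperadAlgebra

end Algebras

/-! Let `T` be the dg endomorphism operad of `(V, W)` and `T ⊗ k[t, dt]` its path object. In
characteristic zero polynomials can be integrated, so evaluation at `t = 0` is a surjective homology
isomorphism. This is used in the form `Hom.LiftsBoundaries`: a cycle `z` upstairs and a chain `w`
downstairs with `∂w = π z` come from one `x` with `∂x = z` and `π x = w`
(`pathEval_liftsBoundaries`). A chain homotopy `h` from `f` to `g` is the same kind of datum as a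
path: `f (1 - t) + g t + h dt` is a cycle `z` of degree `0` with ends `f` and `g`
(`exists_path_of_homotopy`). It therefore suffices to find a morphism from the resolution `R` to the
path object that sends the arrow `s` to `z`; its evaluation at `t = 1` is the required structure.

Such morphisms come from a lifting property (`Hom.LiftsBoundaries.exists_lift`). On a generator `x`
the value `y` must satisfy `∂y = Φ(∂x)` and `π y = α x`. The right-hand sides only involve earlier
generators, and the pair can be solved because `π` lifts boundaries. The solution must be linear and
equivariant, so a linear section of `y ↦ (∂y, π y)` is averaged over the symmetric group, again
using characteristic zero.

For (2), the endpoint map is a cofibration, so one may prescribe constant paths on the two copies of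
`R₀` and the path `z` on the arrow, and lift the given structure along evaluation at `0`. Evaluation
at `1` leaves source and target unchanged.

For (1), nothing says that `Γ(u) → R` is a cofibration, so the value on `s` cannot be prescribed
directly. Instead take the fibre product of `R` and the path object over `T`, and inside it the
suboperad `K` spanned by the units, the element `t = (s, z)` and everything with at least two
inputs. The map from `K` to `P_{• → •}` lifts boundaries: in arities `0` and `1` it is an
isomorphism of complexes with zero differential, because `P(0) = 0` and `P(1) = k`; in higher
arities it combines the resolution `α` with evaluation at `0`. Since `R` is cofibrant, `α` lifts to
`K`. The lift of `s` has the same image as `t`, and the map is injective in arity `1`, so the lift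
sends `s` to `t`; projecting to the path object gives a morphism with `s ↦ z`. Only the arrow is
controlled: at `t = 0` this morphism need not be the original structure.

The remaining work identifies `OperadAlgebra` structures with morphisms to an endomorphism operad
whose Koszul signs satisfy the operad axioms. The signs are read off from products in a central
extension, where sign identities become consequences of associativity. -/

instance : IsEmpty {j : Fin 1 // j ≠ 0} := ⟨fun j => j.2 (Subsingleton.elim _ _)⟩

/-! ### Elementary grafts, and morphisms, suboperads and products of graded operads -/

namespace Graft

variable {C : Type} {n : ℕ}

/-- The graft which composes an operation after an operation with inputs of colours `c`, keeping all
labels. -/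
def post (c : Fin n → C) (o : C) : Graft (fun _ : Fin 1 => o) 0 c o c where
  e := Equiv.emptySum _ _
  root := rfl
  outer j := isEmptyElim j
  inner _ := rfl

/-- The graft which composes an operation with one input into the input `i`, keeping all labels. -/
def unary (c : Fin n → C) (i : Fin n) : Graft c i (fun _ : Fin 1 => c i) (c i) c where
  e :=
    { toFun := Sum.elim Subtype.val fun _ => i
      invFun := fun j => if h : j = i then Sum.inr 0 else Sum.inl ⟨j, h⟩
      left_inv := by
        rintro (j | j)
        · simp [j.2]
        · simp [Subsingleton.elim j 0]
      right_inv := fun j => by by_cases h : j = i <;> simp [h] }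
  root := rfl
  outer _ := rfl
  inner _ := rfl

end Graft

namespace GradedOperad

variable {k : Type u} [Field k] {C D : Type} {P Q S : GradedOperad.{u} k C}

namespace Hom

/-- The identity morphism. -/
def id (P : GradedOperad.{u} k C) : Hom P P where
  app := LinearMap.id
  app_map _ _ _ := rfl
  app_one _ := rfl
  app_comp _ _ _ _ := rfl

/-- Composition of morphisms. -/
def comp (Ψ : Hom Q S) (Φ : Hom P Q) : Hom P S where
  app := Ψ.app.comp Φ.app
  app_map σ hσ x := by simp [Φ.app_map, Ψ.app_map]
  app_one o := by simp [Φ.app_one, Ψ.app_one]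
  app_comp g h x y := by simp [Φ.app_comp, Ψ.app_comp]

/-- Change of colours of a morphism. -/
def pull (f : D → C) (Φ : Hom P Q) : Hom (P.pull f) (Q.pull f) where
  app := Φ.app
  app_map σ _ x := Φ.app_map σ _ x
  app_one o := Φ.app_one (f o)
  app_comp g h x y := Φ.app_comp (g.recolor f) h x y

/-- The restriction of a morphism to a subcollection. -/
def restrict (Φ : Hom P Q) (E : P.SubCollection) : E.Hom Q where
  app := Φ.app.comp (Submodule.subtype _)
  app_map σ hσ x := Φ.app_map σ hσ x.1

/-- The suboperad on which two morphisms agree. -/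
def eqLocus (Φ Ψ : Hom P Q) : Suboperad P where
  carrier _ _ _ _ := LinearMap.eqLocus Φ.app Ψ.app
  map_mem σ hσ x hx := by
    rw [LinearMap.mem_eqLocus] at hx ⊢
    rw [Φ.app_map, Ψ.app_map, hx]
  one_mem o := by rw [LinearMap.mem_eqLocus, Φ.app_one, Ψ.app_one]
  comp_mem g h x y hx hy := by
    rw [LinearMap.mem_eqLocus] at hx hy ⊢
    rw [Φ.app_comp, Ψ.app_comp, hx, hy]

end Hom

namespace Suboperad

/-- A suboperad as an operad. -/
def toOperad (K : Suboperad Q) : GradedOperad.{u} k C where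
  X n c o p := K.carrier n c o p
  addCommGroup _ _ _ _ := inferInstance
  module _ _ _ _ := inferInstance
  map σ hσ :=
    { toFun := fun x => ⟨Q.map σ hσ x.1, K.map_mem σ hσ x.2⟩
      map_add' := fun _ _ => Subtype.ext (by simp)
      map_smul' := fun _ _ => Subtype.ext (by simp) }
  one o := ⟨Q.one o, K.one_mem o⟩
  comp g h :=
    LinearMap.mk₂ k (fun x y => ⟨Q.comp g h x.1 y.1, K.comp_mem g h x.2 y.2⟩)
      (fun _ _ _ => Subtype.ext (by simp)) (fun _ _ _ => Subtype.ext (by simp))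
      (fun _ _ _ => Subtype.ext (by simp)) (fun _ _ _ => Subtype.ext (by simp))
  map_refl x := Subtype.ext (Q.map_refl x.1)
  map_map σ hσ τ hτ x := Subtype.ext (Q.map_map σ hσ τ hτ x.1)
  comp_map h σ hσ τ hτ ρ hρ g g₁ h₁ h₂ x y :=
    Subtype.ext (Q.comp_map h σ hσ τ hτ ρ hρ g g₁ h₁ h₂ x.1 y.1)
  one_comp g σ hσ h y := Subtype.ext (Q.one_comp g σ hσ h y.1)
  comp_one g σ hσ h h' x := Subtype.ext (Q.comp_one g σ hσ h h' x.1)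
  comp_assoc h₁ h₂ h₃ h₄ g₁ g₂ g₃ g₄ e₁ e₂ e₃ x y z :=
    Subtype.ext (Q.comp_assoc h₁ h₂ h₃ h₄ g₁ g₂ g₃ g₄ e₁ e₂ e₃ x.1 y.1 z.1)
  comp_comm hij _ _ _ _ _ _ _ _ _ _ _ _ _ _ h₁ h₂ h₃ h₄ g₁ g₂ g₃ g₄ e₁ e₂ e₃ x y z := by
    refine Subtype.ext ((Q.comp_comm hij h₁ h₂ h₃ h₄ g₁ g₂ g₃ g₄ e₁ e₂ e₃ x.1 y.1 z.1).trans ?_)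
    simp only [Units.smul_def]
    rfl

/-- The inclusion of a suboperad. -/
def incl (K : Suboperad Q) : Hom K.toOperad Q where
  app := Submodule.subtype _
  app_map _ _ _ := rfl
  app_one _ := rfl
  app_comp _ _ _ _ := rfl

/-- The inclusion of a subcollection into a suboperad. -/
def inclusion (K : Suboperad Q) (E : Q.SubCollection)
    (h : ∀ (n : ℕ) (c : Fin n → C) (o : C) (p : ℤ), E.carrier n c o p ≤ K.carrier n c o p) :
    E.Hom K.toOperad where
  app {n c o p} := Submodule.inclusion (h n c o p)
  app_map _ _ _ := rfl

/-- The intersection of two suboperads. -/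
def inter (K L : Suboperad Q) : Suboperad Q where
  carrier n c o p := K.carrier n c o p ⊓ L.carrier n c o p
  map_mem σ hσ _ hx := ⟨K.map_mem σ hσ hx.1, L.map_mem σ hσ hx.2⟩
  one_mem o := ⟨K.one_mem o, L.one_mem o⟩
  comp_mem g h _ _ hx hy := ⟨K.comp_mem g h hx.1 hy.1, L.comp_mem g h hx.2 hy.2⟩

end Suboperad

/-- The product of two operads. -/
def prod (P Q : GradedOperad.{u} k C) : GradedOperad.{u} k C where
  X n c o p := P.X n c o p × Q.X n c o p
  addCommGroup _ _ _ _ := inferInstance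
  module _ _ _ _ := inferInstance
  map σ hσ := (P.map σ hσ).prodMap (Q.map σ hσ)
  one o := (P.one o, Q.one o)
  comp g h := LinearMap.mk₂ k (fun x y => (P.comp g h x.1 y.1, Q.comp g h x.2 y.2))
    (fun _ _ _ => by simp) (fun _ _ _ => by simp) (fun _ _ _ => by simp) (fun _ _ _ => by simp)
  map_refl x := Prod.ext (P.map_refl x.1) (Q.map_refl x.2)
  map_map σ hσ τ hτ x := Prod.ext (P.map_map σ hσ τ hτ x.1) (Q.map_map σ hσ τ hτ x.2)
  comp_map h σ hσ τ hτ ρ hρ g g₁ h₁ h₂ x y :=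
    Prod.ext (P.comp_map h σ hσ τ hτ ρ hρ g g₁ h₁ h₂ x.1 y.1)
      (Q.comp_map h σ hσ τ hτ ρ hρ g g₁ h₁ h₂ x.2 y.2)
  one_comp g σ hσ h y := Prod.ext (P.one_comp g σ hσ h y.1) (Q.one_comp g σ hσ h y.2)
  comp_one g σ hσ h h' x := Prod.ext (P.comp_one g σ hσ h h' x.1) (Q.comp_one g σ hσ h h' x.2)
  comp_assoc h₁ h₂ h₃ h₄ g₁ g₂ g₃ g₄ e₁ e₂ e₃ x y z :=
    Prod.ext (P.comp_assoc h₁ h₂ h₃ h₄ g₁ g₂ g₃ g₄ e₁ e₂ e₃ x.1 y.1 z.1)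
      (Q.comp_assoc h₁ h₂ h₃ h₄ g₁ g₂ g₃ g₄ e₁ e₂ e₃ x.2 y.2 z.2)
  comp_comm hij _ _ _ _ _ _ _ _ _ _ _ _ _ _ h₁ h₂ h₃ h₄ g₁ g₂ g₃ g₄ e₁ e₂ e₃ x y z :=
    Prod.ext (P.comp_comm hij h₁ h₂ h₃ h₄ g₁ g₂ g₃ g₄ e₁ e₂ e₃ x.1 y.1 z.1)
      (Q.comp_comm hij h₁ h₂ h₃ h₄ g₁ g₂ g₃ g₄ e₁ e₂ e₃ x.2 y.2 z.2)

end GradedOperad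

/-! ### Products and stable suboperads of dg operads -/

namespace DGOperad

variable {k : Type u} [Field k] {C : Type} {P Q S : DGOperad.{u} k C}

/-- Composition of morphisms. -/
def Hom.comp (Ψ : Hom Q S) (Φ : Hom P Q) : Hom P S where
  toHom := Ψ.toHom.comp Φ.toHom
  app_diff h x := (congrArg Ψ.app (Φ.app_diff h x)).trans (Ψ.app_diff h _)

/-- The product of two dg operads. -/
def prod (P Q : DGOperad.{u} k C) : DGOperad.{u} k C where
  toGradedOperad := P.toGradedOperad.prod Q.toGradedOperad
  diff h := (P.diff h).prodMap (Q.diff h)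
  diff_diff h h' x := Prod.ext (P.diff_diff h h' x.1) (Q.diff_diff h h' x.2)
  diff_map σ hσ h x := Prod.ext (P.diff_map σ hσ h x.1) (Q.diff_map σ hσ h x.2)
  diff_comp g h ht hp hq h₁ h₂ x y :=
    Prod.ext (P.diff_comp g h ht hp hq h₁ h₂ x.1 y.1) (Q.diff_comp g h ht hp hq h₁ h₂ x.2 y.2)

/-- The first projection. -/
def fst (P Q : DGOperad.{u} k C) : Hom (P.prod Q) P where
  app := LinearMap.fst k _ _
  app_map _ _ _ := rfl
  app_one _ := rfl
  app_comp _ _ _ _ := rfl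
  app_diff _ _ := rfl

/-- The second projection. -/
def snd (P Q : DGOperad.{u} k C) : Hom (P.prod Q) Q where
  app := LinearMap.snd k _ _
  app_map _ _ _ := rfl
  app_one _ := rfl
  app_comp _ _ _ _ := rfl
  app_diff _ _ := rfl

/-- A suboperad is stable under the differential. -/
def IsStable (Q : DGOperad.{u} k C) (K : Q.toGradedOperad.Suboperad) : Prop :=
  ∀ {n : ℕ} {c : Fin n → C} {o : C} {p p' : ℤ} (h : p' + 1 = p) (x : Q.X n c o p),
    x ∈ K.carrier n c o p → Q.diff h x ∈ K.carrier n c o p'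

/-- A stable suboperad as a dg operad. -/
def sub (Q : DGOperad.{u} k C) (K : Q.toGradedOperad.Suboperad) (hK : Q.IsStable K) :
    DGOperad.{u} k C where
  toGradedOperad := K.toOperad
  diff h := LinearMap.restrict (Q.diff h) (fun x hx => hK h x hx)
  diff_diff h h' x := Subtype.ext (Q.diff_diff h h' x.1)
  diff_map σ hσ h x := Subtype.ext (Q.diff_map σ hσ h x.1)
  diff_comp g h ht hp hq h₁ h₂ x y := by
    refine Subtype.ext ((Q.diff_comp g h ht hp hq h₁ h₂ x.1 y.1).trans ?_)
    simp only [Units.smul_def]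
    rfl

/-- The inclusion of a stable suboperad. -/
def subIncl (Q : DGOperad.{u} k C) (K : Q.toGradedOperad.Suboperad) (hK : Q.IsStable K) :
    Hom (Q.sub K hK) Q where
  toHom := K.incl
  app_diff _ _ := rfl

/-- The Leibniz rule for `1 ∘ 1 = 1` reads `∂1 = ∂1 + ∂1`. -/
theorem diff_one (R : DGOperad.{u} k C) (o : C) {p : ℤ} (hp : p + 1 = 0) :
    R.diff hp (R.one o) = 0 := by
  let g := Graft.post (fun _ : Fin 1 => o) o
  have hg : ∀ {q : ℤ} (y : R.X 1 (fun _ : Fin 1 => o) o q),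
      R.comp g (zero_add q) (R.one o) y = y := fun y =>
    (R.one_comp g (Equiv.refl _) (fun _ => rfl) (fun _ => rfl) y).trans (R.map_refl y)
  have hg' : ∀ {q : ℤ} (y : R.X 1 (fun _ : Fin 1 => o) o q),
      R.comp g (add_zero q) y (R.one o) = y := fun y =>
    (R.comp_one g (Equiv.refl _) (fun _ => rfl)
      (fun j => isEmptyElim j) rfl y).trans (R.map_refl y)
  have h := R.diff_comp g (zero_add 0) hp hp hp (add_zero _) (zero_add _) (R.one o) (R.one o)
  rw [hg, hg, hg', Int.negOnePow_zero, one_smul] at h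
  simpa using h

/-- For a morphism of graded operads, the suboperad of all operations `x` at which it commutes with
the differential. -/
def commLocus (Φ : GradedOperad.Hom P.toGradedOperad Q.toGradedOperad) :
    P.toGradedOperad.Suboperad where
  carrier n c o p := LinearMap.eqLocus
    (Φ.app.comp (P.diff (n := n) (c := c) (o := o) (sub_add_cancel p 1)))
    ((Q.diff (sub_add_cancel p 1)).comp Φ.app)
  map_mem σ hσ x hx := by
    simp only [LinearMap.mem_eqLocus, LinearMap.comp_apply] at hx ⊢
    rw [P.diff_map, Φ.app_map, Φ.app_map, Q.diff_map, hx]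
  one_mem o := by
    simp only [LinearMap.mem_eqLocus, LinearMap.comp_apply]
    rw [Φ.app_one, diff_one, diff_one, map_zero]
  comp_mem {m n r c i c' b c'' o p q t} g h x y hx hy := by
    simp only [LinearMap.mem_eqLocus, LinearMap.comp_apply] at hx hy ⊢
    have h₁ : p - 1 + q = t - 1 := by omega
    have h₂ : p + (q - 1) = t - 1 := by omega
    rw [P.diff_comp g h _ (sub_add_cancel p 1) (sub_add_cancel q 1) h₁ h₂, Φ.app_comp,
      Q.diff_comp g h _ (sub_add_cancel p 1) (sub_add_cancel q 1) h₁ h₂, map_add, Units.smul_def,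
      Units.smul_def, map_zsmul, Φ.app_comp, Φ.app_comp, hx, hy]

/-- `commLocus` tests the differential only with target degree written as `p - 1`; every other name
`p'` of that degree follows by substitution. -/
theorem app_diff_of_commLocus {Φ : GradedOperad.Hom P.toGradedOperad Q.toGradedOperad}
    (hΦ : ∀ (n : ℕ) (c : Fin n → C) (o : C) (p : ℤ) (x : P.X n c o p),
      x ∈ (commLocus Φ).carrier n c o p) {n : ℕ} {c : Fin n → C} {o : C} {p p' : ℤ}
    (h : p' + 1 = p) (x : P.X n c o p) : Φ.app (P.diff h x) = Q.diff h (Φ.app x) := by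
  obtain rfl : p' = p - 1 := by omega
  exact hΦ n c o p x

end DGOperad

/-! ### Koszul signs as exponents in a central extension -/

section Signs

/-- Monomials in odd and even variables `ι`, up to sign: a central extension of `ι → ZMod 2`, with
the commutation relations of a free graded commutative algebra for elements of disjoint support. -/
@[ext]
structure SignMonoid (ι : Type) where
  /-- exponent of the sign -/
  sign : ZMod 2
  /-- parities of the variables -/
  vec : ι → ZMod 2

namespace SignMonoid

variable {ι : Type} [Fintype ι] [LinearOrder ι]

/-- The bilinear form that defines the extension. -/
def form (f h : ι → ZMod 2) : ZMod 2 := ∑ a, ∑ b, if b < a then f a * h b else 0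

theorem form_add_left (f f' h : ι → ZMod 2) : form (f + f') h = form f h + form f' h := by
  simp only [form, ← Finset.sum_add_distrib]
  refine Finset.sum_congr rfl fun a _ => Finset.sum_congr rfl fun b _ => ?_
  split_ifs <;> simp [add_mul]

theorem form_add_right (f h h' : ι → ZMod 2) : form f (h + h') = form f h + form f h' := by
  simp only [form, ← Finset.sum_add_distrib]
  refine Finset.sum_congr rfl fun a _ => Finset.sum_congr rfl fun b _ => ?_
  split_ifs <;> simp [mul_add]

@[simp] theorem form_zero_left (h : ι → ZMod 2) : form 0 h = 0 := by simp [form]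

@[simp] theorem form_zero_right (h : ι → ZMod 2) : form h 0 = 0 := by simp [form]

theorem form_single (a b : ι) (x y : ZMod 2) :
    form (Pi.single a x) (Pi.single b y) = if b < a then x * y else 0 := by
  rw [form, Finset.sum_eq_single a, Finset.sum_eq_single b]
  · simp
  · intro c _ hc; simp [Pi.single_eq_of_ne hc]
  · simp
  · intro c _ hc; simp [Pi.single_eq_of_ne hc]
  · simp

/-- Associativity is the cocycle identity for `form`, which holds because `form` is biadditive. -/
instance : Monoid (SignMonoid ι) where
  mul x y := ⟨x.sign + y.sign + form x.vec y.vec, x.vec + y.vec⟩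
  one := ⟨0, 0⟩
  mul_assoc x y z := by
    refine SignMonoid.ext ?_ (add_assoc _ _ _)
    change x.sign + y.sign + form x.vec y.vec + z.sign + form (x.vec + y.vec) z.vec =
      x.sign + (y.sign + z.sign + form y.vec z.vec) + form x.vec (y.vec + z.vec)
    rw [form_add_left, form_add_right]; ring
  one_mul x := by
    refine SignMonoid.ext ?_ (zero_add _)
    change 0 + x.sign + form 0 x.vec = x.sign
    simp
  mul_one x := by
    refine SignMonoid.ext ?_ (add_zero _)
    change x.sign + 0 + form x.vec 0 = x.sign
    simp

theorem mul_sign (x y : SignMonoid ι) : (x * y).sign = x.sign + y.sign + form x.vec y.vec := rfl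

theorem mul_vec (x y : SignMonoid ι) : (x * y).vec = x.vec + y.vec := rfl

@[simp] theorem one_vec : (1 : SignMonoid ι).vec = 0 := rfl

/-- The central element `(-1)^a`. -/
def sg (a : ZMod 2) : SignMonoid ι := ⟨a, 0⟩

theorem sg_mul (a : ZMod 2) (x : SignMonoid ι) : sg a * x = ⟨a + x.sign, x.vec⟩ := by
  ext <;> simp [mul_sign, mul_vec, sg]

theorem mul_sg (a : ZMod 2) (x : SignMonoid ι) : x * sg a = sg a * x := by
  ext <;> simp [mul_sign, mul_vec, sg, add_comm]

theorem mul_sg_mul (a : ZMod 2) (x y : SignMonoid ι) : x * (sg a * y) = sg a * (x * y) := by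
  rw [← mul_assoc, mul_sg, mul_assoc]

theorem sg_sg (a b : ZMod 2) (x : SignMonoid ι) : sg a * (sg b * x) = sg (a + b) * x := by
  simp [sg_mul, add_assoc]

@[simp] theorem sg_zero : (sg 0 : SignMonoid ι) = 1 := rfl

/-- Sign identities are proved with this cancellation: one product is rewritten in two ways to the
same monomial, and the exponents must agree. -/
theorem sg_inj {a b : ZMod 2} {x : SignMonoid ι} (h : sg a * x = sg b * x) : a = b := by
  rw [sg_mul, sg_mul] at h
  simpa using congrArg sign h

/-- The parity of a monomial. -/
def deg (x : SignMonoid ι) : ZMod 2 := ∑ a, x.vec a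

@[simp] theorem deg_mul (x y : SignMonoid ι) : (x * y).deg = x.deg + y.deg := by
  simp [deg, mul_vec, Finset.sum_add_distrib]

@[simp] theorem deg_one : (1 : SignMonoid ι).deg = 0 := by simp [deg]

set_option linter.unusedSectionVars false in
@[simp] theorem deg_sg (a : ZMod 2) : (sg a : SignMonoid ι).deg = 0 := by simp [deg, sg]

/-- A variable of parity `x`. -/
def gen (a : ι) (x : ZMod 2) : SignMonoid ι := ⟨0, Pi.single a x⟩

@[simp] theorem deg_gen (a : ι) (x : ZMod 2) : (gen a x).deg = x := by simp [deg, gen]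

/-- The Koszul commutation relation. -/
def SC (x y : SignMonoid ι) : Prop := x * y = sg (x.deg * y.deg) * (y * x)

theorem SC.symm {x y : SignMonoid ι} (h : SC x y) : SC y x := by
  unfold SC at *
  rw [h, sg_sg, mul_comm y.deg, CharTwo.add_self_eq_zero, sg_zero, one_mul]

theorem SC.mul_left {x y z : SignMonoid ι} (hx : SC x z) (hy : SC y z) : SC (x * y) z := by
  unfold SC at *
  rw [mul_assoc, hy, mul_sg_mul, ← mul_assoc x z y, hx, mul_assoc, mul_assoc, sg_sg, deg_mul, add_mul, add_comm]

theorem SC.one_left (z : SignMonoid ι) : SC 1 z := by simp [SC]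

theorem SC.prod_left {S : Type} {z : SignMonoid ι} (ev : S → SignMonoid ι) (l : List S)
    (h : ∀ a ∈ l, SC (ev a) z) : SC (l.map ev).prod z := by
  induction l with
  | nil => exact SC.one_left z
  | cons a l ih =>
    rw [List.map_cons, List.prod_cons]
    exact (h a (by simp)).mul_left (ih fun b hb => h b (by simp [hb]))

/-- For distinct indices `form` contributes `x * y` to exactly one of the two products, the one in
decreasing order, and this is the Koszul exponent. -/
theorem SC.gen {a b : ι} (h : a ≠ b) (x y : ZMod 2) : SC (gen a x) (gen b y) := by
  unfold SC
  rw [deg_gen, deg_gen, sg_mul]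
  refine SignMonoid.ext ?_ (add_comm _ _)
  simp only [mul_sign, SignMonoid.gen, form_single]
  rcases lt_or_gt_of_ne h with h | h
  · simp [h, h.not_gt, mul_comm, CharTwo.add_self_eq_zero]
  · simp [h, h.not_gt]

theorem deg_prod {S : Type} (ev : S → SignMonoid ι) (l : List S) :
    (l.map ev).prod.deg = (l.map fun a => (ev a).deg).sum := by
  induction l with
  | nil => simp
  | cons a l ih => simp [ih]

/-- The ordered product of a family. -/
def fprod {n : ℕ} (e : Fin n → SignMonoid ι) : SignMonoid ι := ((List.finRange n).map e).prod

theorem fprod_zero (e : Fin 0 → SignMonoid ι) : fprod e = 1 := rfl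

theorem fprod_succ {n : ℕ} (e : Fin (n + 1) → SignMonoid ι) :
    fprod e = e 0 * fprod fun j => e j.succ := by
  simp [fprod, List.finRange_succ, Function.comp_def]

theorem deg_fprod {n : ℕ} (e : Fin n → SignMonoid ι) : (fprod e).deg = ∑ j, (e j).deg := by
  rw [fprod, deg_prod, ← List.ofFn_eq_map, List.sum_ofFn]

theorem SC.fprod_left {n : ℕ} {z : SignMonoid ι} {e : Fin n → SignMonoid ι}
    (h : ∀ j, SC (e j) z) : SC (fprod e) z :=
  SC.prod_left e _ fun j _ => h j

theorem fprod_vec {n : ℕ} (e : Fin n → SignMonoid ι) : (fprod e).vec = ∑ j, (e j).vec := by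
  induction n with
  | zero => rfl
  | succ n ih => rw [fprod_succ, mul_vec, ih, Fin.sum_univ_succ]

theorem form_sum_right {n : ℕ} (f : ι → ZMod 2) (h : Fin n → ι → ZMod 2) :
    form f (∑ j, h j) = ∑ j, form f (h j) := by
  induction n with
  | zero => simp
  | succ n ih => rw [Fin.sum_univ_succ, form_add_right, ih, Fin.sum_univ_succ]

theorem fprod_sign {n : ℕ} (e : Fin n → SignMonoid ι) (he : ∀ j, (e j).sign = 0) :
    (fprod e).sign = ∑ j, ∑ l, if j < l then form (e j).vec (e l).vec else 0 := by
  induction n with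
  | zero => rfl
  | succ n ih =>
    rw [fprod_succ, mul_sign, he, ih _ fun j => he _, fprod_vec, form_sum_right, zero_add,
      Fin.sum_univ_succ, Fin.sum_univ_succ, add_comm]
    simp only [lt_self_iff_false, if_false, zero_add, Fin.succ_pos, if_true]
    congr 1
    refine Finset.sum_congr rfl fun j _ => ?_
    rw [Fin.sum_univ_succ]
    simp

/-- Moving an element to the `i`-th factor of an ordered product. -/
theorem mul_fprod {m : ℕ} (η : SignMonoid ι) (G : Fin m → SignMonoid ι) (i : Fin m)
    (hη : ∀ j, j ≠ i → SC η (G j)) :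
    η * fprod G = sg (η.deg * ∑ j, if j < i then (G j).deg else 0) *
      fprod (Function.update G i (η * G i)) := by
  induction m with
  | zero => exact i.elim0
  | succ m ih =>
    obtain rfl | ⟨i, rfl⟩ := i.eq_zero_or_eq_succ
    · simp only [Fin.not_lt_zero, if_false, Finset.sum_const_zero, mul_zero, sg_zero, one_mul]
      rw [fprod_succ, fprod_succ, Function.update_self, mul_assoc]
      congr 2
    · rw [fprod_succ, fprod_succ, ← mul_assoc, hη 0 (Fin.succ_ne_zero i).symm, mul_assoc, mul_assoc,
        ih (fun j => G j.succ) i (fun j hj => hη _ fun w => hj (Fin.succ_injective _ w)),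
        mul_sg_mul, sg_sg, Fin.sum_univ_succ, Function.update_of_ne (Fin.succ_ne_zero i).symm]
      have hu : (fun j : Fin m => Function.update G i.succ (η * G i.succ) j.succ) =
          Function.update (fun j => G j.succ) i (η * G i.succ) := by
        funext j
        by_cases hj : j = i
        · subst hj; simp
        · rw [Function.update_of_ne hj, Function.update_of_ne fun w => hj (Fin.succ_injective _ w)]
      rw [hu]
      simp only [Fin.succ_pos, if_true, Fin.succ_lt_succ_iff, mul_add]

end SignMonoid

open SignMonoid

/-- The exponent is chosen before the monoid and the evaluation of the letters, so it depends on
parities alone. A permutation is built from adjacent swaps, and `Nodup` makes the swapped letters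
distinct, hence supercommuting. -/
theorem exists_wordSign {S : Type} (d : S → ZMod 2) {l₁ l₂ : List S} (h : l₁.Perm l₂)
    (hn : l₁.Nodup) : ∃ θ : ZMod 2, ∀ (ι : Type) [Fintype ι] [LinearOrder ι]
      (ev : S → SignMonoid ι), (∀ a, (ev a).deg = d a) → (∀ a b, a ≠ b → SC (ev a) (ev b)) →
      (l₁.map ev).prod = sg θ * (l₂.map ev).prod := by
  induction h with
  | nil => exact ⟨0, fun _ => by simp⟩
  | cons a _ ih =>
    obtain ⟨θ, hθ⟩ := ih (List.nodup_cons.1 hn).2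
    refine ⟨θ, fun ι _ _ ev h₁ h₂ => ?_⟩
    simp only [List.map_cons, List.prod_cons]
    rw [hθ ι ev h₁ h₂, mul_sg_mul]
  | swap a b l =>
    refine ⟨d b * d a, fun ι _ _ ev h₁ h₂ => ?_⟩
    have hab : b ≠ a := fun w => (List.nodup_cons.1 hn).1 (by simp [w])
    simp only [List.map_cons, List.prod_cons]
    rw [← mul_assoc, h₂ b a hab, h₁, h₁, mul_assoc, mul_assoc]
  | trans h _ ih₁ ih₂ =>
    obtain ⟨θ₁, hθ₁⟩ := ih₁ hn
    obtain ⟨θ₂, hθ₂⟩ := ih₂ (h.nodup_iff.1 hn)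
    refine ⟨θ₁ + θ₂, fun ι _ _ ev h₁ h₂ => ?_⟩
    rw [hθ₁ ι ev h₁ h₂, hθ₂ ι ev h₁ h₂, sg_sg]

open Classical in
/-- The exponent of the sign by which two orderings of a product of symbols of parities `d` differ. -/
noncomputable def wordSign {S : Type} (d : S → ZMod 2) (l₁ l₂ : List S) : ZMod 2 :=
  -- The value `0` outside this case is a default that carries no meaning.
  if h : l₁.Perm l₂ ∧ l₁.Nodup then (exists_wordSign d h.1 h.2).choose else 0

theorem wordSign_spec {S : Type} {d : S → ZMod 2} {l₁ l₂ : List S} (h : l₁.Perm l₂)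
    (hn : l₁.Nodup) {ι : Type} [Fintype ι] [LinearOrder ι] (ev : S → SignMonoid ι)
    (h₁ : ∀ a, (ev a).deg = d a) (h₂ : ∀ a b, a ≠ b → SC (ev a) (ev b)) :
    (l₁.map ev).prod = sg (wordSign d l₁ l₂) * (l₂.map ev).prod := by
  rw [wordSign, dif_pos ⟨h, hn⟩]
  exact (exists_wordSign d h hn).choose_spec ι ev h₁ h₂

/-- The Koszul sign of a permutation. -/
noncomputable def permSign {n n' : ℕ} (σ : Fin n ≃ Fin n') (d : Fin n' → ZMod 2) : ZMod 2 :=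
  wordSign d (List.finRange n') ((List.finRange n).map σ)

theorem perm_finRange_map {n n' : ℕ} (σ : Fin n ≃ Fin n') :
    (List.finRange n').Perm ((List.finRange n).map σ) := by
  rw [List.perm_ext_iff_of_nodup (List.nodup_finRange n')
    ((List.nodup_finRange n).map σ.injective)]
  intro a
  simpa using ⟨σ.symm a, by simp⟩

theorem permSign_spec {n n' : ℕ} (σ : Fin n ≃ Fin n') {d : Fin n' → ZMod 2} {ι : Type} [Fintype ι]
    [LinearOrder ι] (ev : Fin n' → SignMonoid ι) (h₁ : ∀ a, (ev a).deg = d a)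
    (h₂ : ∀ a b, a ≠ b → SC (ev a) (ev b)) :
    fprod ev = sg (permSign σ d) * fprod fun j => ev (σ j) := by
  have := wordSign_spec (perm_finRange_map σ) (List.nodup_finRange n') ev h₁ h₂
  rw [List.map_map] at this
  exact this

/-- The exponent can be computed in any model, so take the generators `gen a (d a)`. Their
increasing product has sign `0`, and the sign of the permuted product counts the inversions between
odd letters. -/
theorem permSign_eq {n n' : ℕ} (σ : Fin n ≃ Fin n') (d : Fin n' → ZMod 2) :
    permSign σ d = ∑ j : Fin n, ∑ l : Fin n,
      if j < l ∧ σ l < σ j then d (σ j) * d (σ l) else 0 := by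
  have h := permSign_spec σ (d := d) (fun a => gen a (d a)) (fun a => deg_gen a _)
    (fun a b hab => SC.gen hab _ _)
  have h' := congrArg sign h
  rw [sg_mul, fprod_sign _ fun _ => rfl, fprod_sign _ fun _ => rfl] at h'
  simp only [gen, form_single] at h'
  rw [Finset.sum_eq_zero] at h'
  · rw [eq_comm, ← CharTwo.add_eq_zero (R := ZMod 2)]
    simp only [ite_and]
    rw [add_comm]
    exact h'.symm
  · intro j _
    refine Finset.sum_eq_zero fun l _ => ?_
    split_ifs with h₁ h₂
    · exact absurd h₁ h₂.not_gt
    · rfl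
    · rfl

theorem permSign_koszulExp {n n' : ℕ} (σ : Fin n ≃ Fin n') (s : Fin n' → ℤ) :
    permSign σ (fun j => (s j : ZMod 2)) = (koszulExp σ s : ZMod 2) := by
  rw [permSign_eq, koszulExp]
  push_cast
  rfl

/-- The word of the composite of two operations, in terms of its second operation and its inputs. -/
def graftWord {m n r : ℕ} {i : Fin m} (e : {j : Fin m // j ≠ i} ⊕ Fin n ≃ Fin r) :
    List (Option (Fin r)) :=
  (List.finRange m).flatMap fun j =>
    if h : j = i then none :: (List.finRange n).map fun l => some (e (Sum.inr l))
    else [some (e (Sum.inl ⟨j, h⟩))]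

theorem nodup_graftWord {m n r : ℕ} {i : Fin m} (e : {j : Fin m // j ≠ i} ⊕ Fin n ≃ Fin r) :
    (graftWord e).Nodup := by
  rw [graftWord, List.nodup_flatMap]
  constructor
  · intro j _
    split_ifs with h
    · rw [List.nodup_cons]
      refine ⟨by simp, (List.nodup_finRange n).map ?_⟩
      intro a b hab
      simpa using hab
    · simp
  · refine (List.nodup_finRange m).imp ?_
    intro j j' hj
    rw [Function.onFun, List.disjoint_left]
    intro a ha ha'
    by_cases h : j = i
    · subst h
      rw [dif_neg hj.symm] at ha'
      rw [dif_pos rfl] at ha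
      simp at ha ha'
      simp [ha'] at ha
    · rw [dif_neg h] at ha
      by_cases h' : j' = i
      · subst h'
        rw [dif_pos rfl] at ha'
        simp at ha ha'
        simp [ha] at ha'
      · rw [dif_neg h'] at ha'
        simp at ha ha'
        rw [ha] at ha'
        simp at ha'
        exact hj ha'

theorem mem_graftWord {m n r : ℕ} {i : Fin m} (e : {j : Fin m // j ≠ i} ⊕ Fin n ≃ Fin r)
    (a : Option (Fin r)) : a ∈ graftWord e := by
  rw [graftWord, List.mem_flatMap]
  cases a with
  | none => exact ⟨i, by simp, by simp⟩
  | some a =>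
    obtain ⟨a, rfl⟩ := e.surjective a
    rcases a with j | l
    · exact ⟨j.1, by simp, by simp [j.2]⟩
    · exact ⟨i, by simp, by simp⟩

theorem perm_graftWord {m n r : ℕ} {i : Fin m} (e : {j : Fin m // j ≠ i} ⊕ Fin n ≃ Fin r) :
    (none :: (List.finRange r).map some).Perm (graftWord e) := by
  rw [List.perm_ext_iff_of_nodup _ (nodup_graftWord e)]
  · intro a
    simp only [mem_graftWord, iff_true]
    cases a <;> simp
  · rw [List.nodup_cons]
    exact ⟨by simp, (List.nodup_finRange r).map (Option.some_injective _)⟩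

/-- The Koszul sign of the composition of an operation and an operation of parity `q`, in terms of
the parities `d` of the arguments. -/
noncomputable def graftSign {m n r : ℕ} {i : Fin m} (e : {j : Fin m // j ≠ i} ⊕ Fin n ≃ Fin r)
    (q : ZMod 2) (d : Fin r → ZMod 2) : ZMod 2 :=
  wordSign (fun a => Option.elim a q d) (none :: (List.finRange r).map some) (graftWord e)

/-- In the word of the composite the letter `none` of the second operation stands directly before
its own inputs. Evaluating it at `η` and flattening turns this block into the single factor at the
input `i`. -/
theorem graftSign_spec {m n r : ℕ} {i : Fin m} (e : {j : Fin m // j ≠ i} ⊕ Fin n ≃ Fin r)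
    {q : ZMod 2} {d : Fin r → ZMod 2} {ι : Type} [Fintype ι] [LinearOrder ι] (η : SignMonoid ι)
    (ev : Fin r → SignMonoid ι) (hη : η.deg = q) (h₁ : ∀ a, (ev a).deg = d a)
    (h₂ : ∀ a b, a ≠ b → SC (ev a) (ev b)) (h₃ : ∀ a, SC η (ev a)) :
    η * fprod ev = sg (graftSign e q d) * fprod fun j =>
      if h : j = i then η * fprod fun l => ev (e (Sum.inr l)) else ev (e (Sum.inl ⟨j, h⟩)) := by
  have h := wordSign_spec (d := fun a => Option.elim a q d) (perm_graftWord e)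
    (by
      rw [List.nodup_cons]
      exact ⟨by simp, (List.nodup_finRange r).map (Option.some_injective _)⟩)
    (fun a => Option.elim a η ev)
    (by rintro (_ | a); exacts [hη, h₁ a])
    (by
      rintro (_ | a) (_ | b) hab
      · exact absurd rfl hab
      · exact h₃ b
      · exact (h₃ a).symm
      · exact h₂ a b fun w => hab (by rw [w]))
  rw [List.map_cons, List.prod_cons, List.map_map] at h
  refine Eq.trans h ?_
  congr 1
  rw [graftWord, List.map_flatMap, List.flatMap, List.prod_flatten, List.map_map, fprod]
  congr 1
  refine List.map_congr_left fun j _ => ?_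
  by_cases hj : j = i
  · simp [hj, fprod, Function.comp_def]
  · simp [hj]

/-- There are supercommuting variables of given parities. -/
theorem exists_variables {r : ℕ} (d : Fin r → ZMod 2) (q s : ZMod 2) :
    ∃ (η ζ : SignMonoid (Fin (r + 2))) (ev : Fin r → SignMonoid (Fin (r + 2))),
      η.deg = q ∧ ζ.deg = s ∧ (∀ a, (ev a).deg = d a) ∧ (∀ a b, a ≠ b → SC (ev a) (ev b)) ∧
      (∀ a, SC η (ev a)) ∧ (∀ a, SC ζ (ev a)) ∧ SC η ζ := by
  -- The last two of the `r + 2` indices are reserved for `η` and `ζ`, so all the variables are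
  -- distinct and supercommute.
  refine ⟨gen (Fin.natAdd r 0) q, gen (Fin.natAdd r 1) s, fun a => gen (Fin.castAdd 2 a) (d a),
    deg_gen _ _, deg_gen _ _, fun a => deg_gen _ _, fun a b hab => SC.gen (by simpa using hab) _ _,
    fun a => SC.gen ?_ _ _, fun a => SC.gen ?_ _ _, SC.gen (by simp) _ _⟩
  · intro h
    have := congrArg Fin.val h
    simp at this; omega
  · intro h
    have := congrArg Fin.val h
    simp at this; omega

/-- Planarity says that the right-hand list is strictly increasing. It has the same elements as
`List.finRange r`, and a sorted list is determined by its elements. -/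
theorem finRange_eq_flatMap {m n r : ℕ} {i : Fin m} (e : {j : Fin m // j ≠ i} ⊕ Fin n ≃ Fin r)
    (h₁ : ∀ j j', e (Sum.inl j) < e (Sum.inl j') ↔ j.1 < j'.1)
    (h₂ : ∀ l l', e (Sum.inr l) < e (Sum.inr l') ↔ l < l')
    (h₃ : ∀ j l, e (Sum.inl j) < e (Sum.inr l) ↔ j.1 < i) :
    List.finRange r = (List.finRange m).flatMap fun j =>
      if h : j = i then (List.finRange n).map fun l => e (Sum.inr l)
      else [e (Sum.inl ⟨j, h⟩)] := by
  have hs : ((List.finRange m).flatMap fun j =>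
      if h : j = i then (List.finRange n).map fun l => e (Sum.inr l)
      else [e (Sum.inl ⟨j, h⟩)]).Pairwise (· < ·) := by
    rw [List.pairwise_flatMap]
    constructor
    · intro j _
      split_ifs with h
      · rw [List.pairwise_map]
        exact (List.pairwise_lt_finRange n).imp fun {a b} hab => (h₂ a b).2 hab
      · simp
    · refine (List.pairwise_lt_finRange m).imp ?_
      intro j j' hj a ha b hb
      by_cases h : j = i
      · subst h
        rw [dif_neg hj.ne'] at hb
        rw [dif_pos rfl] at ha
        obtain ⟨l, -, rfl⟩ := List.mem_map.1 ha
        rw [List.mem_singleton.1 hb]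
        refine lt_of_le_of_ne (not_lt.1 fun w => hj.not_gt ((h₃ _ _).1 w)) ?_
        simp
      · rw [dif_neg h] at ha
        rw [List.mem_singleton.1 ha]
        by_cases h' : j' = i
        · subst h'
          rw [dif_pos rfl] at hb
          obtain ⟨l, -, rfl⟩ := List.mem_map.1 hb
          exact (h₃ _ _).2 hj
        · rw [dif_neg h'] at hb
          rw [List.mem_singleton.1 hb]
          exact (h₁ _ _).2 hj
  refine List.Perm.eq_of_pairwise (le := (· < ·)) (fun a b _ _ hab hba => absurd hab hba.not_gt)
    (List.pairwise_lt_finRange r) hs ?_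
  rw [List.perm_ext_iff_of_nodup (List.nodup_finRange r) (hs.imp fun {a b} h => h.ne)]
  intro a
  simp only [List.mem_finRange, true_iff, List.mem_flatMap, true_and]
  obtain ⟨a, rfl⟩ := e.surjective a
  rcases a with j | l
  · exact ⟨j.1, by simp [j.2]⟩
  · exact ⟨i, by simp⟩

/-- For a planar labelling the arguments keep their order; only the second operation moves, past the
arguments to the left of the input `i`. -/
theorem graftSign_of_planar {m n r : ℕ} {i : Fin m} (e : {j : Fin m // j ≠ i} ⊕ Fin n ≃ Fin r)
    (h₁ : ∀ j j', e (Sum.inl j) < e (Sum.inl j') ↔ j.1 < j'.1)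
    (h₂ : ∀ l l', e (Sum.inr l) < e (Sum.inr l') ↔ l < l')
    (h₃ : ∀ j l, e (Sum.inl j) < e (Sum.inr l) ↔ j.1 < i) (q : ZMod 2) (d : Fin r → ZMod 2) :
    graftSign e q d = q * ∑ j : {j // j ≠ i}, if j.1 < i then d (e (Sum.inl j)) else 0 := by
  obtain ⟨η, -, ev, hη, -, hd, hev, hηev, -⟩ := exists_variables d q 0
  have h := graftSign_spec e η ev hη hd hev hηev
  have h' : fprod ev = fprod fun j : Fin m =>
      if h : j = i then fprod fun l => ev (e (Sum.inr l)) else ev (e (Sum.inl ⟨j, h⟩)) := by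
    rw [fprod, finRange_eq_flatMap e h₁ h₂ h₃, List.map_flatMap, List.flatMap, List.prod_flatten,
      List.map_map, fprod]
    congr 1
    refine List.map_congr_left fun j _ => ?_
    by_cases hj : j = i
    · simp [hj, fprod, Function.comp_def]
    · simp [hj]
  rw [h', mul_fprod η _ i] at h
  · rw [eq_comm]
    have hu : Function.update (fun j : Fin m => if h : j = i then fprod fun l => ev (e (Sum.inr l))
        else ev (e (Sum.inl ⟨j, h⟩))) i (η * if h : i = i then fprod fun l => ev (e (Sum.inr l))
        else ev (e (Sum.inl ⟨i, h⟩))) = fun j => if h : j = i then η * fprod fun l =>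
          ev (e (Sum.inr l)) else ev (e (Sum.inl ⟨j, h⟩)) := by
      funext j
      by_cases hj : j = i
      · subst hj; simp
      · simp [hj]
    rw [hu] at h
    have h := sg_inj h
    rw [← h, hη]
    congr 1
    rw [Finset.sum_ite, Finset.sum_const_zero, add_zero, Finset.sum_ite, Finset.sum_const_zero,
      add_zero]
    refine Finset.sum_bij' (fun a _ => a.1) (fun a ha => ⟨a, ?_⟩) ?_ ?_ ?_ ?_ ?_
    · simp at ha
      exact ha.ne
    · intro a ha; simpa using ha
    · intro a ha; simpa using ha
    · intro a ha; rfl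
    · intro a ha; rfl
    · intro a ha
      rw [dif_neg a.2, hd]
  · intro j hj
    simp only [dif_neg hj]
    exact hηev _

end Signs

/-! ### Sign identities behind the operad axioms -/

section InsertArg

open SignMonoid

/-- The arguments of the first operation of a composite: `b` at the input `i`, and the arguments `a`
of the composite at the other inputs. -/
def insertArg {β : Type*} {m n r : ℕ} {i : Fin m} (e : {j : Fin m // j ≠ i} ⊕ Fin n ≃ Fin r) (b : β)
    (a : Fin r → β) (j : Fin m) : β :=
  if h : j = i then b else a (e (Sum.inl ⟨j, h⟩))

section insertArg

variable {β γ : Type*} {m n r : ℕ} {i : Fin m} (e : {j : Fin m // j ≠ i} ⊕ Fin n ≃ Fin r)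

@[simp] theorem insertArg_self (b : β) (a : Fin r → β) : insertArg e b a i = b := by
  simp [insertArg]

theorem insertArg_of_ne (b : β) (a : Fin r → β) {j : Fin m} (h : j ≠ i) :
    insertArg e b a j = a (e (Sum.inl ⟨j, h⟩)) := by
  simp [insertArg, h]

theorem insertArg_comp (f : β → γ) (b : β) (a : Fin r → β) :
    (fun j => f (insertArg e b a j)) = insertArg e (f b) fun j => f (a j) := by
  funext j
  by_cases h : j = i
  · subst h; simp
  · simp [insertArg_of_ne _ _ _ h]

theorem insertArg_eq_update (b b' : β) (a : Fin r → β) :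
    insertArg e b a = Function.update (insertArg e b' a) i b := by
  funext j
  by_cases h : j = i
  · subst h; simp
  · simp [insertArg_of_ne _ _ _ h, h]

theorem sum_insertArg {A : Type*} [AddCommGroup A] (b : A) (a : Fin r → A) :
    ∑ j, insertArg e b a j = b + ∑ j : {j // j ≠ i}, a (e (Sum.inl j)) := by
  rw [← Finset.add_sum_erase _ _ (Finset.mem_univ i), insertArg_self]
  congr 1
  rw [← Finset.sum_subtype_of_mem (p := fun j => j ≠ i)]
  · refine (Finset.sum_congr ?_ fun j _ => ?_)
    · ext j; simp [j.2]
    · exact insertArg_of_ne _ _ _ j.2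
  · intro j hj; simpa using hj

theorem sum_insertArg_add {A : Type*} [AddCommGroup A] (b : A) (a : Fin r → A) :
    ∑ j, insertArg e (b + ∑ l, a (e (Sum.inr l))) a j = b + ∑ j, a j := by
  rw [sum_insertArg, ← e.sum_comp a, Fintype.sum_sum_type]
  abel

theorem insertArg_map {m₁ n₁ r₁ : ℕ} (σ : Fin m ≃ Fin m₁) (ρ : Fin r ≃ Fin r₁)
    (e₁ : {j : Fin m₁ // j ≠ σ i} ⊕ Fin n₁ ≃ Fin r₁)
    (h : ∀ j : {j // j ≠ i},
      e₁ (Sum.inl ⟨σ j.1, fun w => j.2 (σ.injective w)⟩) = ρ (e (Sum.inl j)))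
    (b : β) (a : Fin r₁ → β) :
    (fun j => insertArg e₁ b a (σ j)) = insertArg e b fun j => a (ρ j) := by
  funext j
  by_cases hj : j = i
  · subst hj; simp
  · rw [insertArg_of_ne _ _ _ hj, insertArg_of_ne _ _ _ (fun w => hj (σ.injective w)), h ⟨j, hj⟩]

section Assoc

variable {r' n₁ n₂ n₃ : ℕ} {j : Fin n}
  {e₁ : {l : Fin m // l ≠ i} ⊕ Fin n ≃ Fin n₁}
  {e₂ : {l : Fin n₁ // l ≠ e₁ (Sum.inr j)} ⊕ Fin r' ≃ Fin n₂}
  {e₃ : {l : Fin n // l ≠ j} ⊕ Fin r' ≃ Fin n₃}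
  {e₄ : {l : Fin m // l ≠ i} ⊕ Fin n₃ ≃ Fin n₂}

theorem insertArg_assoc_inr
    (h₂ : ∀ (l : {l // l ≠ j}) w,
      e₂ (Sum.inl ⟨e₁ (Sum.inr l.1), w⟩) = e₄ (Sum.inr (e₃ (Sum.inl l))))
    (b : β) (a : Fin n₂ → β) :
    (fun l => insertArg e₂ b a (e₁ (Sum.inr l))) = insertArg e₃ b fun l => a (e₄ (Sum.inr l)) := by
  funext l
  by_cases hl : l = j
  · subst hl; simp
  · rw [insertArg_of_ne _ _ _ hl, insertArg_of_ne _ _ _ (by simpa using hl), h₂ ⟨l, hl⟩]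

theorem insertArg_assoc
    (h₁ : ∀ (l : {l // l ≠ i}) w, e₂ (Sum.inl ⟨e₁ (Sum.inl l), w⟩) = e₄ (Sum.inl l))
    (b b' : β) (a : Fin n₂ → β) :
    insertArg e₁ b' (insertArg e₂ b a) = insertArg e₄ b' a := by
  funext l
  by_cases hl : l = i
  · subst hl; simp
  · rw [insertArg_of_ne _ _ _ hl, insertArg_of_ne _ _ _ hl, insertArg_of_ne _ _ _ (by simp),
      h₁ ⟨l, hl⟩]

end Assoc

section Comm

variable {r' n₁ n₂ n₃ : ℕ} {j : Fin m} {hij : i ≠ j}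
  {e₁ : {l : Fin m // l ≠ i} ⊕ Fin n ≃ Fin n₁}
  {e₂ : {l : Fin n₁ // l ≠ e₁ (Sum.inl ⟨j, hij.symm⟩)} ⊕ Fin r' ≃ Fin n₂}
  {e₃ : {l : Fin m // l ≠ j} ⊕ Fin r' ≃ Fin n₃}
  {e₄ : {l : Fin n₃ // l ≠ e₃ (Sum.inl ⟨i, hij⟩)} ⊕ Fin n ≃ Fin n₂}

theorem insertArg_comm_inr
    (h₂ : ∀ l w, e₂ (Sum.inl ⟨e₁ (Sum.inr l), w⟩) = e₄ (Sum.inr l)) (b : β) (a : Fin n₂ → β) :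
    (fun l => insertArg e₂ b a (e₁ (Sum.inr l))) = fun l => a (e₄ (Sum.inr l)) := by
  funext l
  rw [insertArg_of_ne _ _ _ (by simp), h₂]

theorem insertArg_comm
    (h₁ : ∀ (l : Fin m) (hi : l ≠ i) (hj : l ≠ j) w w',
      e₂ (Sum.inl ⟨e₁ (Sum.inl ⟨l, hi⟩), w⟩) = e₄ (Sum.inl ⟨e₃ (Sum.inl ⟨l, hj⟩), w'⟩))
    (b b' : β) (a : Fin n₂ → β) :
    insertArg e₁ b' (insertArg e₂ b a) = insertArg e₃ b (insertArg e₄ b' a) := by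
  funext l
  by_cases hi : l = i
  · subst hi
    rw [insertArg_self, insertArg_of_ne _ _ _ hij, insertArg_self]
  · rw [insertArg_of_ne _ _ _ hi]
    by_cases hj : l = j
    · subst hj
      simp
    · rw [insertArg_of_ne _ _ _ hj, insertArg_of_ne _ _ _ (by simpa using hj),
        insertArg_of_ne _ _ _ (by simpa using hi), h₁]

end Comm

section Sign

variable {ι : Type} [Fintype ι] [LinearOrder ι]

theorem graftSign_spec' {q : ZMod 2} {d : Fin r → ZMod 2} (η : SignMonoid ι)
    (ev : Fin r → SignMonoid ι) (hη : η.deg = q) (h₁ : ∀ a, (ev a).deg = d a)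
    (h₂ : ∀ a b, a ≠ b → SC (ev a) (ev b)) (h₃ : ∀ a, SC η (ev a)) :
    η * fprod ev = sg (graftSign e q d) *
      fprod (insertArg e (η * fprod fun l => ev (e (Sum.inr l))) ev) :=
  graftSign_spec e η ev hη h₁ h₂ h₃

/-- Distinct factors involve disjoint sets of letters, so the factors of a composite can themselves
be treated as supercommuting letters, which allows nested composites. -/
theorem sc_insertArg {η : SignMonoid ι} {ev : Fin r → SignMonoid ι}
    (h₂ : ∀ a b, a ≠ b → SC (ev a) (ev b)) (h₃ : ∀ a, SC η (ev a)) (j j' : Fin m) (hj : j ≠ j') :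
    SC (insertArg e (η * fprod fun l => ev (e (Sum.inr l))) ev j)
      (insertArg e (η * fprod fun l => ev (e (Sum.inr l))) ev j') := by
  have key : ∀ j (h : j ≠ i), SC (η * fprod fun l => ev (e (Sum.inr l))) (ev (e (Sum.inl ⟨j, h⟩))) :=
    fun j h => (h₃ _).mul_left (SC.fprod_left fun l => h₂ _ _ (by simp))
  by_cases h : j = i
  · subst h
    rw [insertArg_self, insertArg_of_ne _ _ _ hj.symm]
    exact key _ _
  · by_cases h' : j' = i
    · subst h'
      rw [insertArg_self, insertArg_of_ne _ _ _ hj]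
      exact (key _ _).symm
    · rw [insertArg_of_ne _ _ _ h, insertArg_of_ne _ _ _ h']
      exact h₂ _ _ (by simpa using hj)

theorem sc_insertArg_right {η ζ : SignMonoid ι} {ev : Fin r → SignMonoid ι}
    (h : ∀ a, SC ζ (ev a)) (hη : SC ζ η) (j : Fin m) :
    SC ζ (insertArg e (η * fprod fun l => ev (e (Sum.inr l))) ev j) := by
  by_cases hj : j = i
  · subst hj
    rw [insertArg_self]
    exact (hη.symm.mul_left (SC.fprod_left fun l => (h _).symm)).symm
  · rw [insertArg_of_ne _ _ _ hj]
    exact h _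

theorem deg_insertArg {q : ZMod 2} {d : Fin r → ZMod 2} {η : SignMonoid ι}
    {ev : Fin r → SignMonoid ι} (hη : η.deg = q) (h₁ : ∀ a, (ev a).deg = d a) (j : Fin m) :
    (insertArg e (η * fprod fun l => ev (e (Sum.inr l))) ev j).deg =
      insertArg e (q + ∑ l, d (e (Sum.inr l))) d j := by
  have := congrFun (insertArg_comp e deg (η * fprod fun l => ev (e (Sum.inr l))) ev) j
  rw [this, deg_mul, deg_fprod, hη]
  simp only [h₁]

theorem fprod_insertArg_sg (θ : ZMod 2) (x : SignMonoid ι) (ev : Fin r → SignMonoid ι) :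
    fprod (insertArg e (sg θ * x) ev) = sg θ * fprod (insertArg e x ev) := by
  have h := mul_fprod (sg θ) (insertArg e x ev) i fun j _ => by
    rw [SC, mul_sg, deg_sg, zero_mul, sg_zero, one_mul]
  rw [h, deg_sg, zero_mul, sg_zero, one_mul, insertArg_self, ← insertArg_eq_update]

end Sign

/-- Both sides are the exponent that turns `η * ζ * fprod ev` into one nested product. The left side
inserts `ζ` and then `η`; the right side inserts the block `η * ζ` and then moves `ζ` into place
within it. -/
theorem graftSign_assoc {r' n₁ n₂ n₃ : ℕ} {j : Fin n}
    {e₁ : {l : Fin m // l ≠ i} ⊕ Fin n ≃ Fin n₁}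
    {e₂ : {l : Fin n₁ // l ≠ e₁ (Sum.inr j)} ⊕ Fin r' ≃ Fin n₂}
    {e₃ : {l : Fin n // l ≠ j} ⊕ Fin r' ≃ Fin n₃}
    {e₄ : {l : Fin m // l ≠ i} ⊕ Fin n₃ ≃ Fin n₂}
    (h₁ : ∀ (l : {l // l ≠ i}) w, e₂ (Sum.inl ⟨e₁ (Sum.inl l), w⟩) = e₄ (Sum.inl l))
    (h₂ : ∀ (l : {l // l ≠ j}) w,
      e₂ (Sum.inl ⟨e₁ (Sum.inr l.1), w⟩) = e₄ (Sum.inr (e₃ (Sum.inl l))))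
    (h₃ : ∀ l, e₂ (Sum.inr l) = e₄ (Sum.inr (e₃ (Sum.inr l))))
    (q s : ZMod 2) (d : Fin n₂ → ZMod 2) :
    graftSign e₂ s d + graftSign e₁ q (insertArg e₂ (s + ∑ l, d (e₂ (Sum.inr l))) d) =
      graftSign e₄ (q + s) d + graftSign e₃ s (fun l => d (e₄ (Sum.inr l))) := by
  obtain ⟨η, ζ, ev, hη, hζ, hd, hev, hηev, hζev, hηζ⟩ := exists_variables d q s
  have s₂ := graftSign_spec' e₂ ζ ev hζ hd hev hζev
  have s₁ := graftSign_spec' e₁ η _ hη (deg_insertArg e₂ hζ hd) (sc_insertArg e₂ hev hζev)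
    (sc_insertArg_right e₂ hηev hηζ)
  have s₄ := graftSign_spec' e₄ (η * ζ) ev (by rw [deg_mul, hη, hζ]) hd hev
    fun a => (hηev a).mul_left (hζev a)
  have s₃ := graftSign_spec' e₃ ζ (fun l => ev (e₄ (Sum.inr l))) hζ (fun a => hd _)
    (fun a b hab => hev _ _ (by simpa using hab)) (fun a => hζev _)
  rw [insertArg_assoc h₁, insertArg_assoc_inr h₂] at s₁
  simp only [h₃] at s₁ s₂
  rw [mul_assoc, s₂, mul_sg_mul, mul_assoc, s₃, mul_sg_mul, fprod_insertArg_sg, sg_sg] at s₄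
  simp only [h₃]
  rw [s₁, sg_sg] at s₄
  exact sg_inj s₄

/-- The two insertions lead to the same nested product in either order; the extra term `q * s` comes
from exchanging `η` and `ζ` at the start. -/
theorem graftSign_comm {r' n₁ n₂ n₃ : ℕ} {j : Fin m} {hij : i ≠ j}
    {e₁ : {l : Fin m // l ≠ i} ⊕ Fin n ≃ Fin n₁}
    {e₂ : {l : Fin n₁ // l ≠ e₁ (Sum.inl ⟨j, hij.symm⟩)} ⊕ Fin r' ≃ Fin n₂}
    {e₃ : {l : Fin m // l ≠ j} ⊕ Fin r' ≃ Fin n₃}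
    {e₄ : {l : Fin n₃ // l ≠ e₃ (Sum.inl ⟨i, hij⟩)} ⊕ Fin n ≃ Fin n₂}
    (h₁ : ∀ (l : Fin m) (hi : l ≠ i) (hj : l ≠ j) w w',
      e₂ (Sum.inl ⟨e₁ (Sum.inl ⟨l, hi⟩), w⟩) = e₄ (Sum.inl ⟨e₃ (Sum.inl ⟨l, hj⟩), w'⟩))
    (h₂ : ∀ l w, e₂ (Sum.inl ⟨e₁ (Sum.inr l), w⟩) = e₄ (Sum.inr l))
    (h₃ : ∀ l w, e₂ (Sum.inr l) = e₄ (Sum.inl ⟨e₃ (Sum.inr l), w⟩))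
    (q s : ZMod 2) (d : Fin n₂ → ZMod 2) :
    graftSign e₂ s d + graftSign e₁ q (insertArg e₂ (s + ∑ l, d (e₂ (Sum.inr l))) d) =
      q * s + (graftSign e₄ q d +
        graftSign e₃ s (insertArg e₄ (q + ∑ l, d (e₄ (Sum.inr l))) d)) := by
  obtain ⟨η, ζ, ev, hη, hζ, hd, hev, hηev, hζev, hηζ⟩ := exists_variables d q s
  have s₂ := graftSign_spec' e₂ ζ ev hζ hd hev hζev
  have s₁ := graftSign_spec' e₁ η _ hη (deg_insertArg e₂ hζ hd) (sc_insertArg e₂ hev hζev)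
    (sc_insertArg_right e₂ hηev hηζ)
  have s₄ := graftSign_spec' e₄ η ev hη hd hev hηev
  have s₃ := graftSign_spec' e₃ ζ _ hζ (deg_insertArg e₄ hη hd) (sc_insertArg e₄ hev hηev)
    (sc_insertArg_right e₄ hζev hηζ.symm)
  have h₃' : ∀ l w, e₄ (Sum.inl ⟨e₃ (Sum.inr l), w⟩) = e₂ (Sum.inr l) := fun l w => (h₃ l w).symm
  rw [insertArg_comm h₁, insertArg_comm_inr h₂] at s₁
  rw [insertArg_comm_inr h₃'] at s₃
  have key : η * (ζ * fprod ev) = sg (q * s) * (ζ * (η * fprod ev)) := by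
    rw [← mul_assoc, hηζ, hη, hζ, mul_assoc, mul_assoc]
  rw [s₂, s₄, mul_sg_mul, mul_sg_mul, s₁, s₃, sg_sg, sg_sg, sg_sg, add_assoc] at key
  exact sg_inj key

/-- From `η * fprod ev` one reaches the same product by inserting and then permuting the outer and
inner factors, or by permuting with `ρ` and then inserting. -/
theorem graftSign_map {m₁ n₁ r₁ : ℕ} (σ : Fin m ≃ Fin m₁) (τ : Fin n ≃ Fin n₁) (ρ : Fin r ≃ Fin r₁)
    (e₁ : {j : Fin m₁ // j ≠ σ i} ⊕ Fin n₁ ≃ Fin r₁)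
    (h : ∀ j : {j // j ≠ i},
      e₁ (Sum.inl ⟨σ j.1, fun w => j.2 (σ.injective w)⟩) = ρ (e (Sum.inl j)))
    (h' : ∀ l, e₁ (Sum.inr (τ l)) = ρ (e (Sum.inr l))) (q : ZMod 2) (d : Fin r₁ → ZMod 2) :
    graftSign e₁ q d + (permSign σ (insertArg e₁ (q + ∑ l, d (e₁ (Sum.inr l))) d) +
      permSign τ fun l => d (e₁ (Sum.inr l))) = permSign ρ d + graftSign e q fun j => d (ρ j) := by
  obtain ⟨η, -, ev, hη, -, hd, hev, hηev, -⟩ := exists_variables d q 0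
  have s₁ := graftSign_spec' e₁ η ev hη hd hev hηev
  have sσ := permSign_spec σ _ (deg_insertArg e₁ hη hd) (sc_insertArg e₁ hev hηev)
  have sτ := permSign_spec τ (fun l => ev (e₁ (Sum.inr l))) (fun l => hd _)
    (fun a b hab => hev _ _ (by simpa using hab))
  have sρ := permSign_spec ρ ev hd hev
  have s := graftSign_spec' e η (fun j => ev (ρ j)) hη (fun a => hd _)
    (fun a b hab => hev _ _ (by simpa using hab)) (fun a => hηev _)
  have hX : fprod (insertArg e (η * fprod fun l => ev (e₁ (Sum.inr l))) fun j => ev (ρ j)) =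
      sg (permSign τ fun l => d (e₁ (Sum.inr l))) *
        fprod (insertArg e (η * fprod fun l => ev (ρ (e (Sum.inr l)))) fun j => ev (ρ j)) := by
    simp only [sτ, mul_sg_mul, fprod_insertArg_sg, h']
  rw [insertArg_map e σ ρ e₁ h, hX, sg_sg] at sσ
  rw [sσ, sg_sg, sρ, mul_sg_mul, s, sg_sg] at s₁
  exact (sg_inj s₁).symm

theorem graftSign_one_comp (e : {j : Fin 1 // j ≠ 0} ⊕ Fin n ≃ Fin r) (σ : Fin n ≃ Fin r)
    (h : ∀ l, σ l = e (Sum.inr l)) (q : ZMod 2) (d : Fin r → ZMod 2) :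
    graftSign e q d = permSign σ d := by
  obtain ⟨η, -, ev, hη, -, hd, hev, hηev, -⟩ := exists_variables d q 0
  have s := graftSign_spec' e η ev hη hd hev hηev
  rw [permSign_spec σ ev hd hev, mul_sg_mul, fprod_succ, fprod_zero, mul_one, insertArg_self] at s
  simp only [h] at s
  exact (sg_inj s).symm

theorem graftSign_comp_one (e : {j : Fin m // j ≠ i} ⊕ Fin 1 ≃ Fin r) (σ : Fin m ≃ Fin r)
    (h : ∀ j : {j // j ≠ i}, σ j.1 = e (Sum.inl j)) (h' : σ i = e (Sum.inr 0))
    (d : Fin r → ZMod 2) : graftSign e 0 d = permSign σ d := by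
  obtain ⟨-, -, ev, -, -, hd, hev, -⟩ := exists_variables d 0 0
  -- An operadic unit is even, so the neutral monomial can represent it.
  have s := graftSign_spec' e 1 ev deg_one hd hev (fun a => SC.one_left _)
  rw [permSign_spec σ ev hd hev, one_mul, one_mul, fprod_succ, fprod_zero, mul_one, ← h'] at s
  have : insertArg e (ev (σ i)) ev = fun j => ev (σ j) := by
    funext j
    by_cases hj : j = i
    · subst hj; simp
    · rw [insertArg_of_ne _ _ _ hj, h ⟨j, hj⟩]
  rw [this] at s
  exact (sg_inj s).symm

end insertArg

theorem permSign_refl {n : ℕ} (d : Fin n → ZMod 2) : permSign (Equiv.refl _) d = 0 := by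
  obtain ⟨-, -, ev, -, -, hd, hev, -⟩ := exists_variables d 0 0
  have s := permSign_spec (Equiv.refl _) ev hd hev
  refine (sg_inj (x := fprod ev) ?_).symm
  rw [sg_zero, one_mul]
  exact s

theorem permSign_trans {n n' n'' : ℕ} (σ : Fin n ≃ Fin n') (τ : Fin n' ≃ Fin n'')
    (d : Fin n'' → ZMod 2) :
    permSign τ d + permSign σ (fun j => d (τ j)) = permSign (σ.trans τ) d := by
  obtain ⟨-, -, ev, -, -, hd, hev, -⟩ := exists_variables d 0 0
  have s := permSign_spec (σ.trans τ) ev hd hev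
  rw [permSign_spec τ ev hd hev, permSign_spec σ (fun j => ev (τ j)) (fun a => hd _)
    (fun a b hab => hev _ _ (by simpa using hab)), sg_sg] at s
  exact sg_inj s

end InsertArg

/-! ### The graded coloured endomorphism operad -/

section EndOperad

/-- The sign `(-1)^a`. -/
def sgn (a : ZMod 2) : ℤˣ := if a = 0 then 1 else -1

theorem sgn_add (a b : ZMod 2) : sgn (a + b) = sgn a * sgn b := by
  revert a b; decide

theorem sgn_intCast (n : ℤ) : sgn (n : ZMod 2) = n.negOnePow := by
  rcases Int.even_or_odd n with h | h
  · rw [Int.negOnePow_even n h, sgn, if_pos ((ZMod.intCast_eq_zero_iff_even).2 h)]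
  · rw [Int.negOnePow_odd n h, sgn, if_neg]
    rw [ZMod.intCast_eq_zero_iff_even]
    exact Int.not_even_iff_odd.2 h

@[simp] theorem sgn_zero : sgn 0 = 1 := rfl

set_option linter.unusedSectionVars false

section Multi

variable (k : Type u) [Field k] {C : Type} [DecidableEq C] (M : C × ℤ → Type u)
  [∀ x, AddCommGroup (M x)] [∀ x, Module k (M x)]

/-- The direct sum of all components, of all colours. -/
abbrev ColTot : Type u := DirectSum (C × ℤ) M

/-- The component of a given colour and degree. -/
def component (x : C × ℤ) : Submodule k (ColTot M) := LinearMap.range (DirectSum.lof k (C × ℤ) M x)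

variable {M} in
/-- The linear endomorphism that is the identity on the components that satisfy `P`, and zero on the
others. -/
def proj (P : C × ℤ → Prop) [DecidablePred P] : ColTot M →ₗ[k] ColTot M :=
  DirectSum.toModule k _ _ fun x => if P x then DirectSum.lof k (C × ℤ) M x else 0

variable {k M}

theorem proj_apply {P : C × ℤ → Prop} [DecidablePred P] {x : C × ℤ} {a : ColTot M}
    (ha : a ∈ component k M x) : proj k P a = if P x then a else 0 := by
  obtain ⟨v, rfl⟩ := ha
  rw [proj, DirectSum.toModule_lof]
  split_ifs <;> rfl

variable (k M) in
/-- Multilinear operations. -/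
abbrev Multi (n : ℕ) : Type u := MultilinearMap k (fun _ : Fin n => ColTot M) (ColTot M)

/-- Reduces equations between operations to arguments of definite colour and degree, where all signs
are explicit. -/
theorem Multi.ext_component {n : ℕ} {φ ψ : Multi k M n}
    (h : ∀ (x : Fin n → C × ℤ) (a : Fin n → ColTot M), (∀ j, a j ∈ component k M (x j)) →
      φ a = ψ a) : φ = ψ := by
  refine MultilinearMap.dfinsupp_ext (κ := fun _ => C × ℤ) fun x => ?_
  refine MultilinearMap.ext fun v => ?_
  refine h x _ fun j => ⟨v j, rfl⟩

/-- Multiplication by a sign that depends on the parities of the arguments. -/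
def twist {n : ℕ} (θ : (Fin n → ZMod 2) → ZMod 2) : Multi k M n →ₗ[k] Multi k M n :=
  -- On arguments of definite parities only the summand with those parities survives. Writing the
  -- sign through projections makes the result multilinear on arbitrary arguments.
  ∑ d : Fin n → ZMod 2, ((sgn (θ d) : ℤ) : k) •
    MultilinearMap.compLinearMapₗ fun j => proj k fun x : C × ℤ => (x.2 : ZMod 2) = d j

theorem twist_apply {n : ℕ} (θ : (Fin n → ZMod 2) → ZMod 2) (φ : Multi k M n) {x : Fin n → C × ℤ}
    {a : Fin n → ColTot M} (ha : ∀ j, a j ∈ component k M (x j)) :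
    twist θ φ a = sgn (θ fun j => ((x j).2 : ZMod 2)) • φ a := by
  rw [twist, LinearMap.sum_apply, _root_.sum_apply,
    Finset.sum_eq_single fun j => ((x j).2 : ZMod 2)]
  · rw [LinearMap.smul_apply, _root_.smul_apply, MultilinearMap.compLinearMapₗ_apply,
      MultilinearMap.compLinearMap_apply, Units.smul_def, Int.cast_smul_eq_zsmul]
    congr 2
    funext j
    rw [proj_apply (ha j), if_pos rfl]
  · intro d _ hd
    obtain ⟨j, hj⟩ := Function.ne_iff.1 hd
    rw [LinearMap.smul_apply, _root_.smul_apply, MultilinearMap.compLinearMapₗ_apply,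
      MultilinearMap.compLinearMap_apply, MultilinearMap.map_coord_zero _ j, smul_zero]
    rw [proj_apply (ha j), if_neg hj.symm]
  · simp

theorem insertArg_update_inl {β : Type*} {m n r : ℕ} {i : Fin m}
    (e : {j : Fin m // j ≠ i} ⊕ Fin n ≃ Fin r) (b s : β) (a : Fin r → β) (j : {j // j ≠ i}) :
    insertArg e b (Function.update a (e (Sum.inl j)) s) =
      Function.update (insertArg e b a) j.1 s := by
  funext l
  by_cases hl : l = i
  · subst hl
    rw [Function.update_of_ne j.2.symm, insertArg_self, insertArg_self]
  · rw [insertArg_of_ne _ _ _ hl]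
    by_cases hj : l = j.1
    · subst hj; simp
    · rw [Function.update_of_ne hj, insertArg_of_ne _ _ _ hl, Function.update_of_ne]
      simpa [Subtype.ext_iff] using hj

theorem insertArg_update_inr {β : Type*} {m n r : ℕ} {i : Fin m}
    (e : {j : Fin m // j ≠ i} ⊕ Fin n ≃ Fin r) (b s : β) (a : Fin r → β) (l : Fin n) :
    insertArg e b (Function.update a (e (Sum.inr l)) s) = insertArg e b a := by
  funext j
  by_cases hj : j = i
  · subst hj; simp
  · rw [insertArg_of_ne _ _ _ hj, insertArg_of_ne _ _ _ hj, Function.update_of_ne]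
    simp

theorem update_inr_comp {β : Type*} {m n r : ℕ} {i : Fin m}
    (e : {j : Fin m // j ≠ i} ⊕ Fin n ≃ Fin r) (s : β) (a : Fin r → β) (l : Fin n) :
    (fun l' => Function.update a (e (Sum.inr l)) s (e (Sum.inr l'))) =
      Function.update (fun l' => a (e (Sum.inr l'))) l s := by
  funext l'
  by_cases hl : l' = l
  · subst hl; simp
  · rw [Function.update_of_ne hl, Function.update_of_ne]
    simpa using hl

theorem update_inl_comp {β : Type*} {m n r : ℕ} {i : Fin m}
    (e : {j : Fin m // j ≠ i} ⊕ Fin n ≃ Fin r) (s : β) (a : Fin r → β) (j : {j // j ≠ i}) :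
    (fun l' => Function.update a (e (Sum.inl j)) s (e (Sum.inr l'))) =
      fun l' => a (e (Sum.inr l')) := by
  funext l'
  rw [Function.update_of_ne]
  simp

theorem map_insertArg_add {m n r : ℕ} {i : Fin m} (e : {j : Fin m // j ≠ i} ⊕ Fin n ≃ Fin r)
    (φ : Multi k M m) (b b' : ColTot M) (a : Fin r → ColTot M) :
    φ (insertArg e (b + b') a) = φ (insertArg e b a) + φ (insertArg e b' a) := by
  rw [insertArg_eq_update e _ 0, φ.map_update_add, ← insertArg_eq_update, ← insertArg_eq_update]

theorem map_insertArg_smul {m n r : ℕ} {i : Fin m} (e : {j : Fin m // j ≠ i} ⊕ Fin n ≃ Fin r)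
    (φ : Multi k M m) (t : k) (b : ColTot M) (a : Fin r → ColTot M) :
    φ (insertArg e (t • b) a) = t • φ (insertArg e b a) := by
  rw [insertArg_eq_update e _ 0, φ.map_update_smul, ← insertArg_eq_update]

theorem map_insertArg_zero {m n r : ℕ} {i : Fin m} (e : {j : Fin m // j ≠ i} ⊕ Fin n ≃ Fin r)
    (φ : Multi k M m) (a : Fin r → ColTot M) : φ (insertArg e 0 a) = 0 :=
  φ.map_coord_zero i (insertArg_self _ _ _)

theorem map_insertArg_units {m n r : ℕ} {i : Fin m} (e : {j : Fin m // j ≠ i} ⊕ Fin n ≃ Fin r)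
    (φ : Multi k M m) (t : ℤˣ) (b : ColTot M) (a : Fin r → ColTot M) :
    φ (insertArg e (t • b) a) = t • φ (insertArg e b a) := by
  rw [Units.smul_def, Units.smul_def, ← Int.cast_smul_eq_zsmul k, map_insertArg_smul,
    Int.cast_smul_eq_zsmul]

/-- The composite of multilinear operations, without signs. -/
def graftMulti {m n r : ℕ} {i : Fin m} (e : {j : Fin m // j ≠ i} ⊕ Fin n ≃ Fin r)
    (φ : Multi k M m) (ψ : Multi k M n) : Multi k M r where
  toFun a := φ (insertArg e (ψ fun l => a (e (Sum.inr l))) a)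
  map_update_add' {inst} a v s t := by
    obtain rfl : inst = instDecidableEqFin r := Subsingleton.elim _ _
    obtain ⟨v, rfl⟩ := e.surjective v
    rcases v with j | l
    · simp only [insertArg_update_inl, update_inl_comp, φ.map_update_add]
    · simp only [insertArg_update_inr, update_inr_comp, ψ.map_update_add, map_insertArg_add]
  map_update_smul' {inst} a v s t := by
    obtain rfl : inst = instDecidableEqFin r := Subsingleton.elim _ _
    obtain ⟨v, rfl⟩ := e.surjective v
    rcases v with j | l
    · simp only [insertArg_update_inl, update_inl_comp, φ.map_update_smul]
    · simp only [insertArg_update_inr, update_inr_comp, ψ.map_update_smul, map_insertArg_smul]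

/-- The action of a permutation of the inputs, with the Koszul sign. -/
noncomputable def permMulti {n n' : ℕ} (σ : Fin n ≃ Fin n') : Multi k M n →ₗ[k] Multi k M n' :=
  (twist (permSign σ)).comp
    ({ toFun := MultilinearMap.domDomCongr σ
       map_add' := fun _ _ => MultilinearMap.ext fun _ => rfl
       map_smul' := fun _ _ => MultilinearMap.ext fun _ => rfl } : Multi k M n →ₗ[k] Multi k M n')

/-- The composition with the Koszul sign, for a second operation of degree `q`. -/
noncomputable def compMulti {m n r : ℕ} {i : Fin m} (e : {j : Fin m // j ≠ i} ⊕ Fin n ≃ Fin r) (q : ℤ) :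
    Multi k M m →ₗ[k] Multi k M n →ₗ[k] Multi k M r :=
  LinearMap.mk₂ k (fun φ ψ => twist (graftSign e q) (graftMulti e φ ψ))
    (fun φ φ' ψ => by rw [← map_add]; exact congrArg _ (MultilinearMap.ext fun _ => rfl))
    (fun t φ ψ => by rw [← map_smul]; exact congrArg _ (MultilinearMap.ext fun _ => rfl))
    (fun φ ψ ψ' => by
      rw [← map_add]; congr 1; refine MultilinearMap.ext fun a => ?_; exact map_insertArg_add e φ _ _ a)
    (fun t φ ψ => by
      rw [← map_smul]; congr 1; refine MultilinearMap.ext fun a => ?_; exact map_insertArg_smul e φ _ _ a)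

theorem permMulti_apply {n n' : ℕ} (σ : Fin n ≃ Fin n') (φ : Multi k M n) {x : Fin n' → C × ℤ}
    {a : Fin n' → ColTot M} (ha : ∀ j, a j ∈ component k M (x j)) :
    permMulti σ φ a =
      sgn (permSign σ fun j => ((x j).2 : ZMod 2)) • φ fun j => a (σ j) :=
  twist_apply _ _ ha

theorem compMulti_apply {m n r : ℕ} {i : Fin m} (e : {j : Fin m // j ≠ i} ⊕ Fin n ≃ Fin r) (q : ℤ)
    (φ : Multi k M m) (ψ : Multi k M n) {x : Fin r → C × ℤ}
    {a : Fin r → ColTot M} (ha : ∀ j, a j ∈ component k M (x j)) :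
    compMulti e q φ ψ a = sgn (graftSign e q fun j => ((x j).2 : ZMod 2)) •
      φ (insertArg e (ψ fun l => a (e (Sum.inr l))) a) :=
  twist_apply _ _ ha

variable (k M) in
/-- The operations with inputs of colours `c`, output of colour `o`, and degree `p`. -/
def endSub (n : ℕ) (c : Fin n → C) (o : C) (p : ℤ) : Submodule k (Multi k M n) where
  -- The vanishing clause removes all values on arguments of other colours, so that an operation is
  -- determined by its values on inputs of colours `c`.
  carrier := {φ | ∀ (x : Fin n → C × ℤ) (a : Fin n → ColTot M), (∀ j, a j ∈ component k M (x j)) →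
    φ a ∈ component k M (o, p + ∑ j, (x j).2) ∧ ((∃ j, (x j).1 ≠ c j) → φ a = 0)}
  add_mem' {φ ψ} hφ hψ x a ha :=
    ⟨add_mem (hφ x a ha).1 (hψ x a ha).1, fun h => by
      rw [_root_.add_apply, (hφ x a ha).2 h, (hψ x a ha).2 h, add_zero]⟩
  zero_mem' _ _ _ := ⟨zero_mem _, fun _ => rfl⟩
  smul_mem' t φ hφ x a ha :=
    ⟨Submodule.smul_mem _ t (hφ x a ha).1, fun h => by
      rw [_root_.smul_apply, (hφ x a ha).2 h, smul_zero]⟩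

theorem units_smul_mem {N : Type*} [AddCommGroup N] [Module k N] (K : Submodule k N) (t : ℤˣ) {a : N}
    (ha : a ∈ K) : t • a ∈ K := by
  rw [Units.smul_def]
  exact zsmul_mem ha _

theorem permMulti_mem {n n' : ℕ} {c : Fin n → C} {c' : Fin n' → C} {o : C} {p : ℤ}
    (σ : Fin n ≃ Fin n') (hσ : ∀ j, c' (σ j) = c j) {φ : Multi k M n}
    (hφ : φ ∈ endSub k M n c o p) : permMulti σ φ ∈ endSub k M n' c' o p := by
  intro x a ha
  rw [permMulti_apply σ φ ha]
  obtain ⟨h₁, h₂⟩ := hφ (fun j => x (σ j)) (fun j => a (σ j)) fun j => ha _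
  rw [σ.sum_comp fun j => (x j).2] at h₁
  refine ⟨units_smul_mem _ _ h₁, ?_⟩
  rintro ⟨j, hj⟩
  rw [h₂ ⟨σ.symm j, by rw [← hσ]; simpa using hj⟩, smul_zero]

theorem insertArg_mem {m n r : ℕ} {i : Fin m} (e : {j : Fin m // j ≠ i} ⊕ Fin n ≃ Fin r)
    {x : Fin r → C × ℤ} {a : Fin r → ColTot M} (ha : ∀ j, a j ∈ component k M (x j)) {y : C × ℤ}
    {b : ColTot M} (hb : b ∈ component k M y) (j : Fin m) :
    insertArg e b a j ∈ component k M (insertArg e y x j) := by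
  by_cases hj : j = i
  · subst hj; simpa using hb
  · rw [insertArg_of_ne _ _ _ hj, insertArg_of_ne _ _ _ hj]; exact ha _

theorem sum_insertArg_snd {m n r : ℕ} {i : Fin m} (e : {j : Fin m // j ≠ i} ⊕ Fin n ≃ Fin r)
    (x : Fin r → C × ℤ) (b : C) (q : ℤ) :
    ∑ j, (insertArg e (b, q + ∑ l, (x (e (Sum.inr l))).2) x j).2 = q + ∑ j, (x j).2 := by
  rw [insertArg_comp e Prod.snd, sum_insertArg_add e q fun j => (x j).2]

theorem compMulti_mem {m n r : ℕ} {c : Fin m → C} {i : Fin m} {c' : Fin n → C} {b : C}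
    {c'' : Fin r → C} {o : C} {p q t : ℤ} (g : Graft c i c' b c'') (h : p + q = t) {φ : Multi k M m}
    {ψ : Multi k M n} (hφ : φ ∈ endSub k M m c o p) (hψ : ψ ∈ endSub k M n c' b q) :
    compMulti g.e q φ ψ ∈ endSub k M r c'' o t := by
  intro x a ha
  rw [compMulti_apply g.e q φ ψ ha]
  obtain ⟨h₁, h₂⟩ := hψ (fun l => x (g.e (Sum.inr l))) (fun l => a (g.e (Sum.inr l))) fun j => ha _
  obtain ⟨h₃, h₄⟩ := hφ _ _ (insertArg_mem g.e ha h₁)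
  rw [sum_insertArg_snd, ← add_assoc, h] at h₃
  refine ⟨units_smul_mem _ _ h₃, ?_⟩
  rintro ⟨v, hv⟩
  obtain ⟨v, rfl⟩ := g.e.surjective v
  rcases v with j | l
  · rw [h₄ ⟨j.1, ?_⟩, smul_zero]
    rw [insertArg_of_ne _ _ _ j.2, ← g.outer]
    exact hv
  · rw [h₂ ⟨l, by rw [← g.inner]; exact hv⟩, map_insertArg_zero, smul_zero]

variable (k M) in
/-- The identity operation of a colour. -/
def oneMulti (o : C) : Multi k M 1 :=
  (LinearMap.compMultilinearMap (proj k fun x : C × ℤ => x.1 = o)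
    (MultilinearMap.ofSubsingleton k (ColTot M) (ColTot M) (0 : Fin 1) LinearMap.id))

theorem oneMulti_apply (o : C) {x : C × ℤ} {a : Fin 1 → ColTot M} (ha : a 0 ∈ component k M x) :
    oneMulti k M o a = if x.1 = o then a 0 else 0 :=
  proj_apply ha

theorem oneMulti_mem (o : C) : oneMulti k M o ∈ endSub k M 1 (fun _ => o) o 0 := by
  intro x a ha
  rw [oneMulti_apply o (ha 0), zero_add, Fin.sum_univ_one]
  constructor
  · split_ifs with h
    · rw [← h]; exact ha 0
    · exact zero_mem _
  · rintro ⟨j, hj⟩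
    obtain rfl := Subsingleton.elim j 0
    rw [if_neg hj]

theorem permMulti_refl {n : ℕ} (φ : Multi k M n) : permMulti (Equiv.refl _) φ = φ :=
  Multi.ext_component fun x a ha => by
    rw [permMulti_apply _ _ ha, permSign_refl, sgn_zero, one_smul]; rfl

theorem permMulti_permMulti {n n' n'' : ℕ} (σ : Fin n ≃ Fin n') (τ : Fin n' ≃ Fin n'')
    (φ : Multi k M n) : permMulti τ (permMulti σ φ) = permMulti (σ.trans τ) φ :=
  Multi.ext_component fun x a ha => by
    rw [permMulti_apply _ _ ha, permMulti_apply _ _ fun j => ha _, permMulti_apply _ _ ha,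
      smul_smul, ← sgn_add, permSign_trans]
    rfl

theorem cast_insertArg {m n r : ℕ} {i : Fin m} (e : {j : Fin m // j ≠ i} ⊕ Fin n ≃ Fin r)
    (x : Fin r → C × ℤ) (b : C) (q : ℤ) :
    (fun j => (((insertArg e (b, q + ∑ l, (x (e (Sum.inr l))).2) x j).2 : ℤ) : ZMod 2)) =
      insertArg e ((q : ZMod 2) + ∑ l, ((x (e (Sum.inr l))).2 : ZMod 2))
        fun j => ((x j).2 : ZMod 2) := by
  rw [insertArg_comp e fun y : C × ℤ => (y.2 : ZMod 2)]
  push_cast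
  rfl

/-- Homogeneity of `ψ` gives the parity of the inserted value, on which the sign of `σ` depends; the
exponents then match by `graftSign_map`. -/
theorem compMulti_permMulti {m n r m₁ n₁ r₁ : ℕ} {i : Fin m} {c' : Fin n → C} {b : C}
    {q : ℤ} (σ : Fin m ≃ Fin m₁) (τ : Fin n ≃ Fin n₁) (ρ : Fin r ≃ Fin r₁)
    (e : {j : Fin m // j ≠ i} ⊕ Fin n ≃ Fin r) (e₁ : {j : Fin m₁ // j ≠ σ i} ⊕ Fin n₁ ≃ Fin r₁)
    (h : ∀ j : {j // j ≠ i},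
      e₁ (Sum.inl ⟨σ j.1, fun w => j.2 (σ.injective w)⟩) = ρ (e (Sum.inl j)))
    (h' : ∀ l, e₁ (Sum.inr (τ l)) = ρ (e (Sum.inr l))) {φ : Multi k M m} {ψ : Multi k M n}
    (hψ : ψ ∈ endSub k M n c' b q) :
    compMulti e₁ q (permMulti σ φ) (permMulti τ ψ) = permMulti ρ (compMulti e q φ ψ) :=
  Multi.ext_component fun x a ha => by
    have hψ' := (permMulti_mem (c' := fun j => c' (τ.symm j)) τ (by simp) hψ _ _
      fun l => ha (e₁ (Sum.inr l))).1
    rw [compMulti_apply _ _ _ _ ha, permMulti_apply _ _ (insertArg_mem e₁ ha hψ'),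
      permMulti_apply _ _ ha, compMulti_apply _ _ _ _ fun j => ha _,
      permMulti_apply _ _ fun j => ha _, insertArg_map e σ ρ e₁ h, map_insertArg_units,
      smul_smul, smul_smul, smul_smul, ← sgn_add, ← sgn_add, ← sgn_add]
    rw [cast_insertArg, ← graftSign_map e σ τ ρ e₁ h h', add_assoc]
    simp only [h']

theorem compMulti_oneMulti_left {n r : ℕ} {c' : Fin n → C} {b : C} {q : ℤ}
    (e : {j : Fin 1 // j ≠ 0} ⊕ Fin n ≃ Fin r) (σ : Fin n ≃ Fin r)
    (h : ∀ l, σ l = e (Sum.inr l)) {ψ : Multi k M n} (hψ : ψ ∈ endSub k M n c' b q) :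
    compMulti e q (oneMulti k M b) ψ = permMulti σ ψ :=
  Multi.ext_component fun x a ha => by
    have hψ' := (hψ _ _ fun l => ha (e (Sum.inr l))).1
    rw [compMulti_apply _ _ _ _ ha, permMulti_apply _ _ ha, graftSign_one_comp e σ h,
      oneMulti_apply b (by rw [insertArg_self]; exact hψ'), if_pos rfl, insertArg_self]
    simp only [h]

theorem compMulti_oneMulti_right {m r : ℕ} {c : Fin m → C} {i : Fin m} {o : C} {p : ℤ}
    (e : {j : Fin m // j ≠ i} ⊕ Fin 1 ≃ Fin r) (σ : Fin m ≃ Fin r)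
    (h : ∀ j : {j // j ≠ i}, σ j.1 = e (Sum.inl j)) (h' : σ i = e (Sum.inr 0)) {φ : Multi k M m}
    (hφ : φ ∈ endSub k M m c o p) :
    compMulti e 0 φ (oneMulti k M (c i)) = permMulti σ φ :=
  Multi.ext_component fun x a ha => by
    have hi : ∀ β : Type u, ∀ a : Fin r → β, insertArg e (a (σ i)) a = fun j => a (σ j) := by
      intro β a
      funext j
      by_cases hj : j = i
      · subst hj; simp
      · rw [insertArg_of_ne _ _ _ hj, h ⟨j, hj⟩]
    rw [compMulti_apply _ _ _ _ ha, permMulti_apply _ _ ha, Int.cast_zero,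
      graftSign_comp_one e σ h h', oneMulti_apply (c i) (ha (e (Sum.inr 0))), ← h']
    -- If the argument does not have the colour `c i`, the identity operation kills it on one side
    -- and `φ` vanishes on the other by the colour clause of `endSub`.
    split_ifs with hc
    · rw [hi]
    · rw [map_insertArg_zero, ((hφ _ _ fun j => ha (σ j)).2 ⟨i, hc⟩)]

theorem compMulti_assoc {m n r n₁ n₂ n₃ : ℕ} {i : Fin m} {j : Fin n} {a : Fin r → C} {b' : C}
    {q s qs : ℤ} (hqs : q + s = qs)
    {e₁ : {l : Fin m // l ≠ i} ⊕ Fin n ≃ Fin n₁}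
    {e₂ : {l : Fin n₁ // l ≠ e₁ (Sum.inr j)} ⊕ Fin r ≃ Fin n₂}
    {e₃ : {l : Fin n // l ≠ j} ⊕ Fin r ≃ Fin n₃}
    {e₄ : {l : Fin m // l ≠ i} ⊕ Fin n₃ ≃ Fin n₂}
    (h₁ : ∀ (l : {l // l ≠ i}) w, e₂ (Sum.inl ⟨e₁ (Sum.inl l), w⟩) = e₄ (Sum.inl l))
    (h₂ : ∀ (l : {l // l ≠ j}) w,
      e₂ (Sum.inl ⟨e₁ (Sum.inr l.1), w⟩) = e₄ (Sum.inr (e₃ (Sum.inl l))))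
    (h₃ : ∀ l, e₂ (Sum.inr l) = e₄ (Sum.inr (e₃ (Sum.inr l))))
    (φ : Multi k M m) (ψ : Multi k M n) {χ : Multi k M r} (hχ : χ ∈ endSub k M r a b' s) :
    compMulti e₂ s (compMulti e₁ q φ ψ) χ = compMulti e₄ qs φ (compMulti e₃ s ψ χ) :=
  Multi.ext_component fun x v hv => by
    have hχ' := (hχ _ _ fun l => hv (e₂ (Sum.inr l))).1
    rw [compMulti_apply _ _ _ _ hv, compMulti_apply _ _ _ _ (insertArg_mem e₂ hv hχ'),
      compMulti_apply _ _ _ _ hv, compMulti_apply _ _ _ _ fun l => hv _, insertArg_assoc h₁,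
      insertArg_assoc_inr h₂, map_insertArg_units, smul_smul, smul_smul, ← sgn_add, ← sgn_add,
      cast_insertArg, graftSign_assoc h₁ h₂ h₃, ← hqs, Int.cast_add]
    simp only [h₃]

theorem compMulti_comm {m n r n₁ n₂ n₃ : ℕ} {i j : Fin m} {hij : i ≠ j} {a : Fin r → C} {b' : C}
    {c' : Fin n → C} {b : C} {q s : ℤ}
    {e₁ : {l : Fin m // l ≠ i} ⊕ Fin n ≃ Fin n₁}
    {e₂ : {l : Fin n₁ // l ≠ e₁ (Sum.inl ⟨j, hij.symm⟩)} ⊕ Fin r ≃ Fin n₂}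
    {e₃ : {l : Fin m // l ≠ j} ⊕ Fin r ≃ Fin n₃}
    {e₄ : {l : Fin n₃ // l ≠ e₃ (Sum.inl ⟨i, hij⟩)} ⊕ Fin n ≃ Fin n₂}
    (h₁ : ∀ (l : Fin m) (hi : l ≠ i) (hj : l ≠ j) w w',
      e₂ (Sum.inl ⟨e₁ (Sum.inl ⟨l, hi⟩), w⟩) = e₄ (Sum.inl ⟨e₃ (Sum.inl ⟨l, hj⟩), w'⟩))
    (h₂ : ∀ l w, e₂ (Sum.inl ⟨e₁ (Sum.inr l), w⟩) = e₄ (Sum.inr l))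
    (h₃ : ∀ l w, e₂ (Sum.inr l) = e₄ (Sum.inl ⟨e₃ (Sum.inr l), w⟩))
    (φ : Multi k M m) {ψ : Multi k M n} {χ : Multi k M r}
    (hψ : ψ ∈ endSub k M n c' b q) (hχ : χ ∈ endSub k M r a b' s) :
    compMulti e₂ s (compMulti e₁ q φ ψ) χ =
      (q * s).negOnePow • compMulti e₄ q (compMulti e₃ s φ χ) ψ :=
  Multi.ext_component fun x v hv => by
    have hχ' := (hχ _ _ fun l => hv (e₂ (Sum.inr l))).1
    have hψ' := (hψ _ _ fun l => hv (e₄ (Sum.inr l))).1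
    have h₃' : ∀ l w, e₄ (Sum.inl ⟨e₃ (Sum.inr l), w⟩) = e₂ (Sum.inr l) := fun l w => (h₃ l w).symm
    rw [_root_.smul_apply, compMulti_apply _ _ _ _ hv,
      compMulti_apply _ _ _ _ (insertArg_mem e₂ hv hχ'),
      compMulti_apply _ _ _ _ hv, compMulti_apply _ _ _ _ (insertArg_mem e₄ hv hψ'),
      insertArg_comm_inr h₂, insertArg_comm_inr h₃', insertArg_comm h₁,
      smul_smul, smul_smul, smul_smul, ← sgn_intCast, ← sgn_add, ← sgn_add, ← sgn_add,
      cast_insertArg, cast_insertArg, graftSign_comm h₁ h₂ h₃, Int.cast_mul, add_assoc]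

variable (k M) in
/-- The coloured endomorphism operad, with the Koszul sign rule. -/
noncomputable def endOperad : GradedOperad.{u} k C where
  -- All operations are multilinear maps on one space, the sum over all colours and degrees. Colours
  -- and degrees are conditions rather than types, so the axioms need no transport along equalities
  -- of colours.
  X n c o p := endSub k M n c o p
  addCommGroup _ _ _ _ := inferInstance
  module _ _ _ _ := inferInstance
  map σ hσ := LinearMap.restrict (permMulti σ) fun _ hφ => permMulti_mem σ hσ hφ
  one o := ⟨oneMulti k M o, oneMulti_mem o⟩
  comp {m n r c i c' b c'' o p q t} g h :=
    LinearMap.mk₂ k (fun φ ψ => ⟨compMulti g.e q φ.1 ψ.1, compMulti_mem g h φ.2 ψ.2⟩)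
      (fun _ _ _ => Subtype.ext (by simp)) (fun _ _ _ => Subtype.ext (by simp))
      (fun _ _ _ => Subtype.ext (by simp)) (fun _ _ _ => Subtype.ext (by simp))
  map_refl x := Subtype.ext (permMulti_refl x.1)
  map_map σ _ τ _ x := Subtype.ext (permMulti_permMulti σ τ x.1)
  comp_map _ σ _ τ _ ρ _ g g₁ h₁ h₂ _ y :=
    Subtype.ext (compMulti_permMulti σ τ ρ g.e g₁.e h₁ h₂ y.2)
  one_comp g σ _ h y := Subtype.ext (compMulti_oneMulti_left g.e σ h y.2)
  comp_one {m r c i b c'' o p} g σ hσ h h' x := by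
    obtain rfl := g.root
    exact Subtype.ext (compMulti_oneMulti_right g.e σ h h' x.2)
  comp_assoc _ _ h₃ _ _ _ _ _ e₁ e₂ e₃ x y z :=
    Subtype.ext (compMulti_assoc h₃ e₁ e₂ e₃ x.1 y.1 z.2)
  comp_comm _ _ _ _ _ _ _ _ _ _ _ _ _ _ _ _ _ _ _ _ _ _ _ e₁ e₂ e₃ x y z :=
    Subtype.ext ((compMulti_comm e₁ e₂ e₃ x.1 y.2 z.2).trans (by
      simp only [Units.smul_def]; rfl))

end Multi

end EndOperad

/-- The graft which composes an operation with one input of colour `b` into the input `i`, keeping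
all labels. -/
def Graft.unaryOf {C : Type} {n : ℕ} (c : Fin n → C) (i : Fin n) {b : C} (h : c i = b) :
    Graft c i (fun _ : Fin 1 => b) b c where
  e := (Graft.unary c i).e
  root := h
  outer _ := rfl
  inner _ := h

/-! ### The differential given by the commutator with a square-zero operation -/

namespace GradedOperad

variable {k : Type u} [Field k] {C : Type} (T : GradedOperad.{u} k C)
  (D : ∀ o, T.X 1 (fun _ => o) o (-1))

/-- Composition with `D` at the output. -/
def post {n : ℕ} (c : Fin n → C) (o : C) {p p' : ℤ} (h : p' + 1 = p) :
    T.X n c o p →ₗ[k] T.X n c o p' :=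
  T.comp (Graft.post c o) (by omega) (D o)

/-- Composition with `D` at the input `i`. -/
def ins {n : ℕ} (c : Fin n → C) (o : C) {p p' : ℤ} (h : p' + 1 = p) (i : Fin n) :
    T.X n c o p →ₗ[k] T.X n c o p' :=
  (T.comp (Graft.unary c i) (by omega)).flip (D (c i))

/-- The commutator with `D`. -/
def innerDiff {n : ℕ} {c : Fin n → C} {o : C} {p p' : ℤ} (h : p' + 1 = p) :
    T.X n c o p →ₗ[k] T.X n c o p' :=
  T.post D c o h - ((p.negOnePow : ℤ) : k) • ∑ i, T.ins D c o h i

variable {T D}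

theorem innerDiff_apply {n : ℕ} {c : Fin n → C} {o : C} {p p' : ℤ} (h : p' + 1 = p)
    (x : T.X n c o p) :
    T.innerDiff D h x = T.post D c o h x - p.negOnePow • ∑ i, T.ins D c o h i x := by
  rw [innerDiff, LinearMap.sub_apply, LinearMap.smul_apply, LinearMap.sum_apply, Units.smul_def,
    Int.cast_smul_eq_zsmul]

/-- At an input of a composite or of a relabelled operation, the colour agrees with the original one
only propositionally; this form lets the inserted `D` carry the original colour. -/
theorem ins_eq {n : ℕ} {c : Fin n → C} {o : C} {p p' : ℤ} (h : p' + 1 = p) (i : Fin n) {b : C}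
    (hb : c i = b) (h' : p + -1 = p') (x : T.X n c o p) :
    T.ins D c o h i x = T.comp (Graft.unaryOf c i hb) h' x (D b) := by
  subst hb; rfl

theorem map_post {n n' : ℕ} {c : Fin n → C} {c' : Fin n' → C} {o : C} {p p' : ℤ} (σ : Fin n ≃ Fin n')
    (hσ : ∀ j, c' (σ j) = c j) (h : p' + 1 = p) (x : T.X n c o p) :
    T.post D c' o h (T.map σ hσ x) = T.map σ hσ (T.post D c o h x) := by
  have := T.comp_map (c₁ := fun _ => o) (by omega : -1 + p = p') (Equiv.refl (Fin 1)) (fun _ => rfl) σ hσ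
    σ hσ (Graft.post c o) (Graft.post c' o) (fun j => isEmptyElim j) (fun _ => rfl) (D o) x
  rw [T.map_refl] at this
  exact this

theorem map_ins {n n' : ℕ} {c : Fin n → C} {c' : Fin n' → C} {o : C} {p p' : ℤ} (σ : Fin n ≃ Fin n')
    (hσ : ∀ j, c' (σ j) = c j) (h : p' + 1 = p) (i : Fin n) (x : T.X n c o p) :
    T.ins D c' o h (σ i) (T.map σ hσ x) = T.map σ hσ (T.ins D c o h i x) := by
  have := T.comp_map (c₁' := fun _ => c i) (by omega : p + -1 = p') σ hσ (Equiv.refl (Fin 1))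
    (fun _ => rfl) σ hσ (Graft.unary c i) (Graft.unaryOf c' (σ i) (hσ i)) (fun j => rfl)
    (fun _ => rfl) x (D (c i))
  rw [T.map_refl] at this
  rw [ins_eq h (σ i) (hσ i) (by omega)]
  exact this

section comp

variable {m n r : ℕ} {c : Fin m → C} {i : Fin m} {c' : Fin n → C} {b : C}
  {c'' : Fin r → C} {o : C} {p q t p' q' t' : ℤ} (g : Graft c i c' b c'') (h : p + q = t)

theorem post_comp (ht : t' + 1 = t) (hp : p' + 1 = p) (h₁ : p' + q = t') (x : T.X m c o p)
    (y : T.X n c' b q) :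
    T.post D c'' o ht (T.comp g h x y) = T.comp g h₁ (T.post D c o hp x) y :=
  (T.comp_assoc (by omega : -1 + p = p') h₁ h (by omega) (Graft.post c o) g g (Graft.post c'' o)
    (fun l => isEmptyElim l) (fun _ _ => rfl) (fun _ => rfl) (D o) x y).symm

theorem comp_post (hp : p' + 1 = p) (hq : q' + 1 = q) (h₁ : p' + q = t') (h₂ : p + q' = t')
    (x : T.X m c o p) (y : T.X n c' b q) :
    T.comp g h₂ x (T.post D c' b hq y) = T.comp g h₁ (T.ins D c o hp i x) y := by
  obtain rfl := g.root
  exact (T.comp_assoc (by omega : p + -1 = p') h₁ (by omega : -1 + q = q') h₂ (j := (0 : Fin 1))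
    (Graft.unary c i) g (Graft.post c' (c i)) g (fun _ _ => rfl) (fun l => isEmptyElim l)
    (fun _ => rfl) x (D (c i)) y).symm

theorem ins_comp_inr (ht : t' + 1 = t) (hq : q' + 1 = q) (h₂ : p + q' = t') (l : Fin n)
    (x : T.X m c o p) (y : T.X n c' b q) :
    T.ins D c'' o ht (g.e (Sum.inr l)) (T.comp g h x y) = T.comp g h₂ x (T.ins D c' b hq l y) := by
  rw [ins_eq ht _ (g.inner l) (by omega)]
  exact T.comp_assoc h (by omega : t + -1 = t') (by omega : q + -1 = q') h₂ g
    (Graft.unaryOf c'' (g.e (Sum.inr l)) (g.inner l)) (Graft.unary c' l) g (fun _ _ => rfl)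
    (fun _ _ => rfl) (fun _ => rfl) x y (D (c' l))

theorem ins_comp_inl (ht : t' + 1 = t) (hp : p' + 1 = p) (h₁ : p' + q = t') (j : {j // j ≠ i})
    (x : T.X m c o p) (y : T.X n c' b q) :
    T.ins D c'' o ht (g.e (Sum.inl j)) (T.comp g h x y) =
      q.negOnePow • T.comp g h₁ (T.ins D c o hp j.1 x) y := by
  rw [ins_eq ht _ (g.outer j) (by omega)]
  have := T.comp_comm j.2.symm h (by omega : t + -1 = t') (by omega : p + -1 = p') h₁ g
    (Graft.unaryOf c'' (g.e (Sum.inl j)) (g.outer j)) (Graft.unary c j.1) g (fun _ _ _ _ _ => rfl)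
    (fun _ _ => rfl) (fun _ _ => rfl) x y (D (c j.1))
  rw [mul_neg_one, Int.negOnePow_neg] at this
  exact this

/-- The inputs of the composite are the inputs of `y` and the inputs of `x` other than `i`. On the
right, `D` also appears at the junction, once as the input `i` of `x` and once as the output of `y`;
by `comp_post` these terms coincide, and they carry opposite signs. -/
theorem innerDiff_comp (ht : t' + 1 = t) (hp : p' + 1 = p) (hq : q' + 1 = q) (h₁ : p' + q = t')
    (h₂ : p + q' = t') (x : T.X m c o p) (y : T.X n c' b q) :
    T.innerDiff D ht (T.comp g h x y) =
      T.comp g h₁ (T.innerDiff D hp x) y + p.negOnePow • T.comp g h₂ x (T.innerDiff D hq y) := by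
  have hs : ∑ j, T.ins D c o hp j x =
      T.ins D c o hp i x + ∑ j : {j // j ≠ i}, T.ins D c o hp j.1 x := by
    rw [← Finset.add_sum_erase _ _ (Finset.mem_univ i)]
    congr 1
    rw [← Finset.sum_subtype_of_mem (p := fun j => j ≠ i)]
    · exact Finset.sum_congr (by ext j; simp [j.2]) fun _ _ => rfl
    · intro j hj; simpa using hj
  rw [innerDiff_apply, innerDiff_apply, innerDiff_apply, hs, ← g.e.sum_comp, Fintype.sum_sum_type]
  simp only [post_comp g h ht hp h₁, ins_comp_inl g h ht hp h₁, ins_comp_inr g h ht hq h₂, map_sub,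
    LinearMap.sub_apply, Units.smul_def, map_zsmul, LinearMap.smul_apply, map_sum, map_add,
    LinearMap.add_apply, LinearMap.sum_apply, comp_post g hp hq h₁ h₂, ← Finset.smul_sum]
  have hpq : ((t.negOnePow : ℤˣ) : ℤ) = p.negOnePow * q.negOnePow := by
    rw [← h, Int.negOnePow_add]; rfl
  have hqq : ((q.negOnePow : ℤˣ) : ℤ) * q.negOnePow = 1 := by
    rw [← Units.val_mul, Int.units_mul_self]; rfl
  rw [hpq]
  simp only [smul_add, smul_sub, smul_smul, mul_assoc, hqq, mul_one]
  abel

end comp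

theorem innerDiff_map {n n' : ℕ} {c : Fin n → C} {c' : Fin n' → C} {o : C} {p p' : ℤ}
    (σ : Fin n ≃ Fin n') (hσ : ∀ j, c' (σ j) = c j) (h : p' + 1 = p) (x : T.X n c o p) :
    T.innerDiff D h (T.map σ hσ x) = T.map σ hσ (T.innerDiff D h x) := by
  rw [innerDiff_apply, innerDiff_apply, map_post, ← σ.sum_comp, map_sub, Units.smul_def,
    Units.smul_def, map_zsmul, map_sum]
  simp only [map_ins]

/-- Applying `D` twice at the same place gives zero, insertions at different inputs anticommute
because `D` is odd, and the two mixed terms cancel because the sign changes with the degree. -/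
theorem innerDiff_innerDiff
    (hD : ∀ (o : C) (g : Graft (fun _ : Fin 1 => o) 0 (fun _ : Fin 1 => o) o (fun _ : Fin 1 => o))
      (h : -1 + -1 = (-2 : ℤ)), T.comp g h (D o) (D o) = 0)
    {n : ℕ} {c : Fin n → C} {o : C} {p p' p'' : ℤ} (h : p' + 1 = p) (h' : p'' + 1 = p')
    (x : T.X n c o p) : T.innerDiff D h' (T.innerDiff D h x) = 0 := by
  have hp : p + -1 = p' := by omega
  have hp' : p' + -1 = p'' := by omega
  have hp'' : p + -2 = p'' := by omega
  have hl : -1 + p = p' := by omega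
  have hl' : -2 + p = p'' := by omega
  have h2 : -2 + 1 = (-1 : ℤ) := by omega
  have e₁ : T.post D c o h' (T.post D c o h x) = 0 := by
    have hD' : T.post D (fun _ : Fin 1 => o) o h2 (D o) = 0 := hD o _ _
    refine (post_comp (Graft.post c o) hl h' h2 hl' (D o) x).trans ?_
    rw [hD', map_zero, LinearMap.zero_apply]
  have e₂ : ∀ i, T.ins D c o h' i (T.post D c o h x) = T.post D c o h' (T.ins D c o h i x) :=
    fun i => ins_comp_inr (Graft.post c o) hl h' h (by omega) i (D o) x
  have e₃ : ∀ i, T.ins D c o h' i (T.ins D c o h i x) = 0 := by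
    intro i
    have hD' : T.ins D (fun _ : Fin 1 => c i) (c i) h2 0 (D (c i)) = 0 := hD (c i) _ _
    refine (ins_comp_inr (Graft.unary c i) hp h' h2 hp'' 0 x (D (c i))).trans ?_
    rw [hD', map_zero]
  have e₄ : ∀ i j, j ≠ i → T.ins D c o h' j (T.ins D c o h i x) =
      - T.ins D c o h' i (T.ins D c o h j x) := by
    intro i j hj
    refine (ins_comp_inl (Graft.unary c i) hp h' h hp' ⟨j, hj⟩ x (D (c i))).trans ?_
    rw [Int.negOnePow_neg, Int.negOnePow_one, Units.neg_smul, one_smul]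
    rfl
  have e₅ : ∑ j, ∑ i, T.ins D c o h' j (T.ins D c o h i x) = 0 := by
    rw [← Finset.sum_product']
    -- Exchanging the two inputs pairs off the terms; the fixed points are the diagonal terms, which
    -- vanish by `e₃`.
    refine Finset.sum_involution (fun a _ => (a.2, a.1)) ?_ ?_ (fun _ _ => Finset.mem_univ _)
      (fun _ _ => rfl)
    · rintro ⟨j, i⟩ -
      by_cases hj : j = i
      · subst hj; simp [e₃]
      · simp [e₄ i j hj]
    · rintro ⟨j, i⟩ - hne w
      obtain rfl : i = j := congrArg Prod.fst w
      exact hne (e₃ i)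
  rw [innerDiff_apply, innerDiff_apply]
  simp only [map_sub, Units.smul_def, map_zsmul, map_sum, e₁, e₂, ← Finset.smul_sum,
    Finset.sum_sub_distrib, e₅, smul_zero, sub_zero, zero_sub]
  have hs : p.negOnePow = -p'.negOnePow := by rw [← h, Int.negOnePow_succ]
  rw [hs]
  simp

end GradedOperad

/-! ### Extension of coefficients and adjunction of an odd square-zero element -/

section Coefficients

open scoped TensorProduct

namespace GradedOperad

variable {k : Type u} [Field k] {C : Type}

section Coeff

variable (T : GradedOperad.{u} k C) (A : Type u) [CommRing A] [Algebra k A]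

/-- Extension of coefficients along a commutative algebra. -/
noncomputable def coeff : GradedOperad.{u} k C where
  X n c o p := T.X n c o p ⊗[k] A
  addCommGroup _ _ _ _ := inferInstance
  module _ _ _ _ := inferInstance
  map σ hσ := (T.map σ hσ).rTensor A
  one o := T.one o ⊗ₜ 1
  comp g h := TensorProduct.map₂ (T.comp g h) (LinearMap.mul k A)
  map_refl {n c o p} x := by
    have h : (T.map (c := c) (c' := c) (Equiv.refl _) (fun _ => rfl) :
        T.X n c o p →ₗ[k] T.X n c o p) = LinearMap.id := LinearMap.ext T.map_refl
    exact (LinearMap.congr_fun (congrArg (LinearMap.rTensor A) h) x).trans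
      (LinearMap.congr_fun (LinearMap.rTensor_id A (T.X n c o p)) x)
  map_map σ hσ τ hτ x := by
    induction x with
    | zero => simp
    | add x y hx hy => rw [map_add, map_add, map_add, hx, hy]
    | tmul x a => simp only [LinearMap.rTensor_tmul, T.map_map]
  comp_map h σ hσ τ hτ ρ hρ g g₁ h₁ h₂ x y := by
    induction x with
    | zero => simp
    | add x x' hx hx' => simp only [map_add, LinearMap.add_apply, hx, hx']
    | tmul x a =>
      induction y with
      | zero => simp
      | add y y' hy hy' => simp only [map_add, hy, hy']
      | tmul y b =>
        simp only [LinearMap.rTensor_tmul, TensorProduct.map₂_apply_tmul, TensorProduct.map_tmul]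
        rw [T.comp_map h σ hσ τ hτ ρ hρ g g₁ h₁ h₂]
  one_comp g σ hσ h y := by
    induction y with
    | zero => simp
    | add y y' hy hy' => simp only [map_add, hy, hy']
    | tmul y b =>
      simp only [LinearMap.rTensor_tmul, TensorProduct.map₂_apply_tmul, TensorProduct.map_tmul, LinearMap.mul_apply',
        one_mul]
      rw [T.one_comp g σ hσ h]
  comp_one g σ hσ h h' x := by
    induction x with
    | zero => simp
    | add y y' hy hy' => simp only [map_add, LinearMap.add_apply, hy, hy']
    | tmul y b =>
      simp only [LinearMap.rTensor_tmul, TensorProduct.map₂_apply_tmul, TensorProduct.map_tmul, LinearMap.mul_apply',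
        mul_one]
      rw [T.comp_one g σ hσ h h']
  comp_assoc h₁ h₂ h₃ h₄ g₁ g₂ g₃ g₄ e₁ e₂ e₃ x y z := by
    induction x with
    | zero => simp
    | add x x' hx hx' => simp only [map_add, LinearMap.add_apply, hx, hx']
    | tmul x a =>
      induction y with
      | zero => simp
      | add y y' hy hy' => simp only [map_add, LinearMap.add_apply, hy, hy']
      | tmul y b =>
        induction z with
        | zero => simp
        | add z z' hz hz' => simp only [map_add, hz, hz']
        | tmul z d =>
          simp only [TensorProduct.map₂_apply_tmul, TensorProduct.map_tmul, LinearMap.mul_apply', mul_assoc]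
          rw [T.comp_assoc h₁ h₂ h₃ h₄ g₁ g₂ g₃ g₄ e₁ e₂ e₃]
  comp_comm {m n r n₁ n₂ n₃ c i j} hij {c' b a b' c₁ c₂ c₃ o p q s pq ps t} h₁ h₂ h₃ h₄ g₁ g₂ g₃ g₄
      e₁ e₂ e₃ x y z := by
    induction x with
    | zero => simp
    | add x x' hx hx' => simp only [map_add, LinearMap.add_apply, hx, hx', smul_add]
    | tmul x a =>
      induction y with
      | zero => simp
      | add y y' hy hy' => simp only [map_add, LinearMap.add_apply, hy, hy', smul_add]
      | tmul y b =>
        induction z with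
        | zero => simp
        | add z z' hz hz' => simp only [map_add, LinearMap.add_apply, hz, hz', smul_add]
        | tmul z d =>
          simp only [TensorProduct.map₂_apply_tmul, TensorProduct.map_tmul, LinearMap.mul_apply']
          rw [T.comp_comm hij h₁ h₂ h₃ h₄ g₁ g₂ g₃ g₄ e₁ e₂ e₃, Units.smul_def, Units.smul_def,
            TensorProduct.smul_tmul', mul_right_comm]

end Coeff

section Eps

variable (S : GradedOperad.{u} k C)

/-- The composition of `S[ε]`. -/
def epsComp {m n r : ℕ} {c : Fin m → C} {i : Fin m} {c' : Fin n → C} {b : C} {c'' : Fin r → C} {o : C}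
    {p q t : ℤ} (g : Graft c i c' b c'') (h : p + q = t) :
    S.X m c o p × S.X m c o (p + 1) →ₗ[k] S.X n c' b q × S.X n c' b (q + 1) →ₗ[k]
      S.X r c'' o t × S.X r c'' o (t + 1) :=
  LinearMap.mk₂ k
    -- The sign `(-1)^q` comes from moving `ε` in `x.2 ε` to the right past `y.1`; the product of
    -- the two `ε`-terms vanishes.
    (fun x y => (S.comp g h x.1 y.1, S.comp g (by omega) x.1 y.2 +
      q.negOnePow • S.comp g (by omega) x.2 y.1))
    (fun _ _ _ => by
      simp only [Prod.fst_add, Prod.snd_add, map_add, LinearMap.add_apply, smul_add, Prod.mk_add_mk]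
      congr 1; abel)
    (fun _ _ _ => by
      simp only [Prod.smul_fst, Prod.smul_snd, map_smul, LinearMap.smul_apply, Prod.smul_mk,
        smul_add, Units.smul_def]
      rw [smul_comm])
    (fun _ _ _ => by
      simp only [Prod.fst_add, Prod.snd_add, map_add, smul_add, Prod.mk_add_mk]
      congr 1; abel)
    (fun _ _ _ => by
      simp only [Prod.smul_fst, Prod.smul_snd, map_smul, Prod.smul_mk, smul_add, Units.smul_def]
      rw [smul_comm])

variable {S} in
theorem epsComp_apply {m n r : ℕ} {c : Fin m → C} {i : Fin m}
    {c' : Fin n → C} {b : C} {c'' : Fin r → C} {o : C} {p q t : ℤ} (g : Graft c i c' b c'')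
    (h : p + q = t) (h₁ : p + (q + 1) = t + 1) (h₂ : p + 1 + q = t + 1)
    (x : S.X m c o p × S.X m c o (p + 1)) (y : S.X n c' b q × S.X n c' b (q + 1)) :
    S.epsComp g h x y =
      (S.comp g h x.1 y.1, S.comp g h₁ x.1 y.2 + q.negOnePow • S.comp g h₂ x.2 y.1) := rfl

/-- The operad obtained by adjoining an element `ε` of square zero and degree `-1`; the pair `(x, y)`
stands for `x + y ε`. -/
def eps : GradedOperad.{u} k C where
  X n c o p := S.X n c o p × S.X n c o (p + 1)
  addCommGroup _ _ _ _ := inferInstance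
  module _ _ _ _ := inferInstance
  map σ hσ := (S.map σ hσ).prodMap (S.map σ hσ)
  one o := (S.one o, 0)
  comp g h := epsComp S g h
  map_refl x := Prod.ext (S.map_refl x.1) (S.map_refl x.2)
  map_map σ hσ τ hτ x := Prod.ext (S.map_map σ hσ τ hτ x.1) (S.map_map σ hσ τ hτ x.2)
  comp_map h σ hσ τ hτ ρ hρ g g₁ h₁ h₂ x y := by
    refine Prod.ext (S.comp_map h σ hσ τ hτ ρ hρ g g₁ h₁ h₂ x.1 y.1) ?_
    simp only [epsComp, LinearMap.mk₂_apply, LinearMap.prodMap_apply, map_add, Units.smul_def, map_zsmul]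
    rw [S.comp_map _ σ hσ τ hτ ρ hρ g g₁ h₁ h₂, S.comp_map _ σ hσ τ hτ ρ hρ g g₁ h₁ h₂]
  one_comp g σ hσ h y := by
    refine Prod.ext (S.one_comp g σ hσ h y.1) ?_
    simp only [epsComp, LinearMap.mk₂_apply, map_zero, LinearMap.zero_apply, smul_zero, add_zero]
    exact S.one_comp g σ hσ h y.2
  comp_one {m r c i b c'' o p} g σ hσ h h' x := by
    refine Prod.ext (S.comp_one g σ hσ h h' x.1) ?_
    simp only [epsComp, LinearMap.mk₂_apply, map_zero, Int.negOnePow_zero, one_smul, zero_add]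
    exact S.comp_one g σ hσ h h' x.2
  comp_assoc {m n r n₁ n₂ n₃ c i c' b j a b' c₁ c₂ c₃ o p q s pq qs t} h₁ h₂ h₃ h₄ g₁ g₂ g₃ g₄ e₁ e₂ e₃ x y z := by
    refine Prod.ext (S.comp_assoc h₁ h₂ h₃ h₄ g₁ g₂ g₃ g₄ e₁ e₂ e₃ x.1 y.1 z.1) ?_
    simp only [epsComp, LinearMap.mk₂_apply, map_add, LinearMap.add_apply, Units.smul_def, map_zsmul,
      LinearMap.smul_apply, smul_add]
    have d₁ : p + (q + 1) = pq + 1 := by omega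
    have d₂ : p + 1 + q = pq + 1 := by omega
    have d₃ : pq + 1 + s = t + 1 := by omega
    have hs : qs.negOnePow = q.negOnePow * s.negOnePow := by rw [← h₃, Int.negOnePow_add]
    -- There is one term for each of the three factors that can supply `ε`, and associativity in `S`
    -- applies to each of them.
    rw [S.comp_assoc h₁ (by omega) (by omega : q + (s + 1) = qs + 1) (by omega) g₁ g₂ g₃ g₄ e₁ e₂ e₃,
      S.comp_assoc d₁ d₃ (by omega : q + 1 + s = qs + 1) (by omega) g₁ g₂ g₃ g₄ e₁ e₂ e₃,
      S.comp_assoc d₂ d₃ h₃ (by omega) g₁ g₂ g₃ g₄ e₁ e₂ e₃, hs, smul_smul, Units.val_mul, mul_comm]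
    exact (add_assoc _ _ _).symm
  comp_comm {m n r n₁ n₂ n₃ c i j} hij {c' b a b' c₁ c₂ c₃ o p q s pq ps t} h₁ h₂ h₃ h₄ g₁ g₂ g₃ g₄
      e₁ e₂ e₃ x y z := by
    refine Prod.ext (S.comp_comm hij h₁ h₂ h₃ h₄ g₁ g₂ g₃ g₄ e₁ e₂ e₃ x.1 y.1 z.1) ?_
    simp only [epsComp, LinearMap.mk₂_apply, map_add, LinearMap.add_apply, Units.smul_def, map_zsmul,
      LinearMap.smul_apply, smul_add, Prod.smul_snd]
    have d₁ : p + (q + 1) = pq + 1 := by omega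
    have d₂ : p + 1 + q = pq + 1 := by omega
    have d₃ : pq + 1 + s = t + 1 := by omega
    have d₄ : p + (s + 1) = ps + 1 := by omega
    have d₅ : p + 1 + s = ps + 1 := by omega
    rw [S.comp_comm hij h₁ (by omega) d₄ (by omega) g₁ g₂ g₃ g₄ e₁ e₂ e₃,
      S.comp_comm hij d₁ d₃ h₃ (by omega) g₁ g₂ g₃ g₄ e₁ e₂ e₃,
      S.comp_comm hij d₂ d₃ d₅ (by omega) g₁ g₂ g₃ g₄ e₁ e₂ e₃]
    simp only [Units.smul_def, smul_smul, ← Units.val_mul, ← Int.negOnePow_add]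
    have a₁ : (q * (s + 1)).negOnePow = (q * s + q).negOnePow := by congr 1; ring
    have a₂ : (s + (q + 1) * s).negOnePow = (q * s).negOnePow := by
      rw [show s + (q + 1) * s = q * s + 2 * s by ring, Int.negOnePow_add, Int.negOnePow_two_mul,
        mul_one]
    have a₄ : (s + (q + q * s)).negOnePow = (q * s + (q + s)).negOnePow := by congr 1; ring
    simp only [a₁, a₂, a₄]
    exact add_left_comm _ _ _

end Eps

end GradedOperad

end Coefficients

/-! ### Twisting the differential of `S[ε]` by a derivation -/

section Epsilon

open scoped TensorProduct

namespace GradedOperad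

variable {k : Type u} [Field k] {C : Type}

/-- Transport along an equality of degrees. -/
def castDeg (T : GradedOperad.{u} k C) {n : ℕ} {c : Fin n → C} {o : C} {p q : ℤ} (h : p = q) :
    T.X n c o p →ₗ[k] T.X n c o q :=
  h ▸ LinearMap.id

end GradedOperad

namespace DGOperad

variable {k : Type u} [Field k] {C : Type}

/-- Derivations of degree `0` of a dg operad. -/
structure Derivation (S : DGOperad.{u} k C) where
  app : ∀ {n : ℕ} {c : Fin n → C} {o : C} {p : ℤ}, S.X n c o p →ₗ[k] S.X n c o p
  app_map : ∀ {n n' : ℕ} {c : Fin n → C} {c' : Fin n' → C} {o : C} {p : ℤ} (σ : Fin n ≃ Fin n')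
    (hσ : ∀ j, c' (σ j) = c j) (x : S.X n c o p), app (S.map σ hσ x) = S.map σ hσ (app x)
  app_comp : ∀ {m n r : ℕ} {c : Fin m → C} {i : Fin m} {c' : Fin n → C} {b : C} {c'' : Fin r → C}
    {o : C} {p q t : ℤ} (g : Graft c i c' b c'') (h : p + q = t) (x : S.X m c o p)
    (y : S.X n c' b q), app (S.comp g h x y) = S.comp g h (app x) y + S.comp g h x (app y)
  app_diff : ∀ {n : ℕ} {c : Fin n → C} {o : C} {p p' : ℤ} (h : p' + 1 = p) (x : S.X n c o p),
    app (S.diff h x) = S.diff h (app x)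

namespace Derivation

variable {S : DGOperad.{u} k C} (δ : S.Derivation)

/-- A derivation, with a degree of the result that is only propositionally the right one. -/
def der {n : ℕ} {c : Fin n → C} {o : C} {p p₁ : ℤ} (h : p = p₁) : S.X n c o p →ₗ[k] S.X n c o p₁ :=
  (S.castDeg h).comp δ.app

theorem der_map {n n' : ℕ} {c : Fin n → C} {c' : Fin n' → C} {o : C} {p p₁ : ℤ} (h : p = p₁)
    (σ : Fin n ≃ Fin n') (hσ : ∀ j, c' (σ j) = c j) (x : S.X n c o p) :
    δ.der h (S.map σ hσ x) = S.map σ hσ (δ.der h x) := by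
  subst h; exact δ.app_map σ hσ x

theorem der_diff {n : ℕ} {c : Fin n → C} {o : C} {p p' p₁ p₁' : ℤ} (h : p' + 1 = p) (hp : p = p₁)
    (hp' : p' = p₁') (h₁ : p₁' + 1 = p₁) (x : S.X n c o p) :
    δ.der hp' (S.diff h x) = S.diff h₁ (δ.der hp x) := by
  subst hp hp'; exact δ.app_diff h x

theorem der_comp {m n r : ℕ} {c : Fin m → C} {i : Fin m} {c' : Fin n → C} {b : C} {c'' : Fin r → C}
    {o : C} {p q t p₁ q₁ t₁ : ℤ} (g : Graft c i c' b c'') (h : p + q = t) (hp : p = p₁) (hq : q = q₁)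
    (ht : t = t₁) (h₁ : p₁ + q = t₁) (h₂ : p + q₁ = t₁) (x : S.X m c o p) (y : S.X n c' b q) :
    δ.der ht (S.comp g h x y) = S.comp g h₁ (δ.der hp x) y + S.comp g h₂ x (δ.der hq y) := by
  subst hp hq ht; exact δ.app_comp g h x y

/-- The differential `∂ + ε δ`. -/
def epsDiff {n : ℕ} {c : Fin n → C} {o : C} {p p' : ℤ} (h : p' + 1 = p) :
    S.X n c o p × S.X n c o (p + 1) →ₗ[k] S.X n c o p' × S.X n c o (p' + 1) :=
  LinearMap.prod ((S.diff h).comp (LinearMap.fst k _ _))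
    ((S.diff (by omega)).comp (LinearMap.snd k _ _) +
      -- Moving `ε` in `ε δ(x)` to the right past an operation of degree `p` produces this sign.
      ((p.negOnePow : ℤ) : k) • (δ.der h.symm).comp (LinearMap.fst k _ _))

theorem epsDiff_apply {n : ℕ} {c : Fin n → C} {o : C} {p p' : ℤ} (h : p' + 1 = p)
    (h' : p' + 1 + 1 = p + 1) (x : S.X n c o p × S.X n c o (p + 1)) :
    δ.epsDiff h x = (S.diff h x.1, S.diff h' x.2 + p.negOnePow • δ.der h.symm x.1) := by
  refine Prod.ext rfl ?_
  change _ + ((p.negOnePow : ℤ) : k) • δ.der h.symm x.1 = _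
  rw [Units.smul_def, Int.cast_smul_eq_zsmul]
  rfl

end Derivation

namespace Derivation

variable {S : DGOperad.{u} k C} (δ : S.Derivation)

/-- The `ε`-component of the square contains `∂δ` and `δ∂` with opposite signs, and `δ` commutes
with `∂`. -/
theorem epsDiff_epsDiff {n : ℕ} {c : Fin n → C} {o : C} {p p' p'' : ℤ} (h : p' + 1 = p)
    (h' : p'' + 1 = p') (x : S.X n c o p × S.X n c o (p + 1)) :
    δ.epsDiff h' (δ.epsDiff h x) = 0 := by
  have hs : p.negOnePow = -p'.negOnePow := by rw [← h, Int.negOnePow_succ]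
  rw [δ.epsDiff_apply h (by omega), δ.epsDiff_apply h' (by omega)]
  refine Prod.ext (S.diff_diff _ _ _) ?_
  dsimp only
  rw [map_add, S.diff_diff, δ.der_diff h h.symm h'.symm (by omega), hs, Units.neg_smul, map_neg,
    Units.smul_def, map_zsmul]
  simp [Units.smul_def]

theorem epsDiff_map {n n' : ℕ} {c : Fin n → C} {c' : Fin n' → C} {o : C} {p p' : ℤ}
    (σ : Fin n ≃ Fin n') (hσ : ∀ j, c' (σ j) = c j) (h : p' + 1 = p)
    (x : S.X n c o p × S.X n c o (p + 1)) :
    δ.epsDiff h ((S.map σ hσ).prodMap (S.map σ hσ) x) =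
      (S.map σ hσ).prodMap (S.map σ hσ) (δ.epsDiff h x) := by
  rw [δ.epsDiff_apply h (by omega), δ.epsDiff_apply h (by omega)]
  refine Prod.ext (S.diff_map _ _ _ _) ?_
  simp only [LinearMap.prodMap_apply]
  rw [S.diff_map, δ.der_map, map_add, Units.smul_def, Units.smul_def, map_zsmul]

/-- The `ε`-component combines the Leibniz rule of `∂` for the two terms containing `ε` with the
derivation rule of `δ`. -/
theorem epsDiff_epsComp {m n r : ℕ} {c : Fin m → C} {i : Fin m} {c' : Fin n → C} {b : C}
    {c'' : Fin r → C} {o : C} {p q t p' q' t' : ℤ} (g : Graft c i c' b c'') (h : p + q = t)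
    (ht : t' + 1 = t) (hp : p' + 1 = p) (hq : q' + 1 = q) (h₁ : p' + q = t') (h₂ : p + q' = t')
    (x : S.X m c o p × S.X m c o (p + 1)) (y : S.X n c' b q × S.X n c' b (q + 1)) :
    δ.epsDiff ht (S.epsComp g h x y) = S.epsComp g h₁ (δ.epsDiff hp x) y +
      p.negOnePow • S.epsComp g h₂ x (δ.epsDiff hq y) := by
  have s₁ : t.negOnePow = p.negOnePow * q.negOnePow := by rw [← h, Int.negOnePow_add]
  have s₂ : q.negOnePow = -q'.negOnePow := by rw [← hq, Int.negOnePow_succ]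
  have s₃ : (p + 1).negOnePow = -p.negOnePow := Int.negOnePow_succ _
  have d₁ : p' + (q + 1) = t' + 1 := by omega
  have d₂ : p' + 1 + q = t' + 1 := by omega
  have d₃ : p + (q' + 1) = t' + 1 := by omega
  have d₄ : p + 1 + q' = t' + 1 := by omega
  rw [δ.epsDiff_apply hp (by omega), δ.epsDiff_apply hq (by omega), δ.epsDiff_apply ht (by omega),
    GradedOperad.epsComp_apply g h (by omega) (by omega),
    GradedOperad.epsComp_apply g h₁ d₁ d₂, GradedOperad.epsComp_apply g h₂ d₃ d₄]
  refine Prod.ext (S.diff_comp g h ht hp hq h₁ h₂ x.1 y.1) ?_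
  dsimp only
  rw [map_add, Units.smul_def q.negOnePow, map_zsmul,
    S.diff_comp g _ (by omega) hp (by omega : q' + 1 + 1 = q + 1) d₁ d₃,
    S.diff_comp g _ (by omega) (by omega : p' + 1 + 1 = p + 1) hq d₂ d₄,
    δ.der_comp g h hp.symm hq.symm ht.symm d₂ d₃, s₁, s₂, s₃]
  simp only [map_add, LinearMap.add_apply, Units.smul_def, map_zsmul, LinearMap.smul_apply,
    Prod.snd_add, Prod.smul_snd, smul_add, smul_smul, Units.val_neg, Units.val_mul, neg_mul,
    mul_neg, neg_smul, smul_neg, map_neg, mul_comm (p.negOnePow : ℤ)]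
  abel

end Derivation

/-- The operad `S[ε]` with the differential `∂ + ε δ` for a derivation `δ`. -/
def epsDG (S : DGOperad.{u} k C) (δ : S.Derivation) : DGOperad.{u} k C where
  toGradedOperad := S.toGradedOperad.eps
  diff h := δ.epsDiff h
  diff_diff h h' x := δ.epsDiff_epsDiff h h' x
  diff_map σ hσ h x := δ.epsDiff_map σ hσ h x
  diff_comp g h ht hp hq h₁ h₂ x y := δ.epsDiff_epsComp g h ht hp hq h₁ h₂ x y

end DGOperad

end Epsilon

/-! ### The polynomial path object -/

section Path

open scoped TensorProduct
open Polynomial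

namespace DGOperad

variable {k : Type u} [Field k] {C : Type}

section Coeff

variable (T : DGOperad.{u} k C) (A : Type u) [CommRing A] [Algebra k A]

theorem rTensor_diff_diff {n : ℕ} {c : Fin n → C} {o : C} {p p' p'' : ℤ} (h : p' + 1 = p)
    (h' : p'' + 1 = p') (x : T.X n c o p ⊗[k] A) :
    (T.diff h').rTensor A ((T.diff h).rTensor A x) = 0 := by
  refine TensorProduct.induction_on x (by simp) (fun x a => ?_) fun x y hx hy => ?_
  · simp [T.diff_diff]
  · rw [map_add, map_add, hx, hy, add_zero]

theorem rTensor_diff_map {n n' : ℕ} {c : Fin n → C} {c' : Fin n' → C} {o : C} {p p' : ℤ}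
    (σ : Fin n ≃ Fin n') (hσ : ∀ j, c' (σ j) = c j) (h : p' + 1 = p) (x : T.X n c o p ⊗[k] A) :
    (T.diff h).rTensor A ((T.map σ hσ).rTensor A x) =
      (T.map σ hσ).rTensor A ((T.diff h).rTensor A x) := by
  refine TensorProduct.induction_on x (by simp) (fun x a => ?_) fun x y hx hy => ?_
  · simp [T.diff_map]
  · simp only [map_add, hx, hy]

theorem rTensor_diff_comp {m n r : ℕ} {c : Fin m → C} {i : Fin m} {c' : Fin n → C} {b : C}
    {c'' : Fin r → C} {o : C} {p q t p' q' t' : ℤ} (g : Graft c i c' b c'') (h : p + q = t)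
    (ht : t' + 1 = t) (hp : p' + 1 = p) (hq : q' + 1 = q) (h₁ : p' + q = t') (h₂ : p + q' = t')
    (x : T.X m c o p ⊗[k] A) (y : T.X n c' b q ⊗[k] A) :
    (T.diff ht).rTensor A (TensorProduct.map₂ (T.comp g h) (LinearMap.mul k A) x y) =
      TensorProduct.map₂ (T.comp g h₁) (LinearMap.mul k A) ((T.diff hp).rTensor A x) y +
        p.negOnePow • TensorProduct.map₂ (T.comp g h₂) (LinearMap.mul k A) x
          ((T.diff hq).rTensor A y) := by
  refine TensorProduct.induction_on x (by simp) (fun x a => ?_) fun x x' hx hx' => ?_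
  · refine TensorProduct.induction_on y (by simp) (fun y b => ?_) fun y y' hy hy' => ?_
    · simp only [LinearMap.rTensor_tmul, TensorProduct.map₂_apply_tmul, TensorProduct.map_tmul]
      rw [T.diff_comp g h ht hp hq h₁ h₂, TensorProduct.add_tmul, Units.smul_def, Units.smul_def,
        TensorProduct.smul_tmul']
    · simp only [map_add, hy, hy', smul_add]; abel
  · simp only [map_add, LinearMap.add_apply, hx, hx', smul_add]; abel

/-- Extension of coefficients of a dg operad along a commutative algebra. -/
noncomputable def coeff : DGOperad.{u} k C where
  toGradedOperad := T.toGradedOperad.coeff A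
  diff h := (T.diff h).rTensor A
  diff_diff h h' x := T.rTensor_diff_diff A h h' x
  diff_map σ hσ h x := T.rTensor_diff_map A σ hσ h x
  diff_comp g h ht hp hq h₁ h₂ x y := T.rTensor_diff_comp A g h ht hp hq h₁ h₂ x y

variable {A}

theorem lTensor_map {n n' : ℕ} {c : Fin n → C} {c' : Fin n' → C} {o : C} {p : ℤ}
    (d : A →ₗ[k] A) (σ : Fin n ≃ Fin n') (hσ : ∀ j, c' (σ j) = c j) (x : T.X n c o p ⊗[k] A) :
    d.lTensor (T.X n' c' o p) ((T.map σ hσ).rTensor A x) =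
      (T.map σ hσ).rTensor A (d.lTensor (T.X n c o p) x) := by
  refine TensorProduct.induction_on x (by simp) (fun x a => ?_) fun x y hx hy => ?_
  · simp
  · simp only [map_add, hx, hy]

theorem lTensor_diff {n : ℕ} {c : Fin n → C} {o : C} {p p' : ℤ} (d : A →ₗ[k] A)
    (h : p' + 1 = p) (x : T.X n c o p ⊗[k] A) :
    d.lTensor (T.X n c o p') ((T.diff h).rTensor A x) =
      (T.diff h).rTensor A (d.lTensor (T.X n c o p) x) := by
  refine TensorProduct.induction_on x (by simp) (fun x a => ?_) fun x y hx hy => ?_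
  · simp
  · simp only [map_add, hx, hy]

theorem lTensor_derivation_comp {m n r : ℕ} {c : Fin m → C} {i : Fin m} {c' : Fin n → C} {b : C}
    {c'' : Fin r → C} {o : C} {p q t : ℤ} (d : _root_.Derivation k A A) (g : Graft c i c' b c'')
    (h : p + q = t) (x : T.X m c o p ⊗[k] A) (y : T.X n c' b q ⊗[k] A) :
    (d : A →ₗ[k] A).lTensor (T.X r c'' o t)
        (TensorProduct.map₂ (T.comp g h) (LinearMap.mul k A) x y) =
      TensorProduct.map₂ (T.comp g h) (LinearMap.mul k A)
          ((d : A →ₗ[k] A).lTensor (T.X m c o p) x) y +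
        TensorProduct.map₂ (T.comp g h) (LinearMap.mul k A) x
          ((d : A →ₗ[k] A).lTensor (T.X n c' b q) y) := by
  refine TensorProduct.induction_on x (by simp) (fun x a => ?_) fun x x' hx hx' => ?_
  · refine TensorProduct.induction_on y (by simp) (fun y b => ?_) fun y y' hy hy' => ?_
    · simp only [LinearMap.lTensor_tmul, TensorProduct.map₂_apply_tmul, TensorProduct.map_tmul,
        LinearMap.mul_apply', Derivation.coeFn_coe, d.leibniz, TensorProduct.tmul_add, smul_eq_mul]
      rw [mul_comm b, add_comm]
    · simp only [map_add, hy, hy']; abel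
  · simp only [map_add, LinearMap.add_apply, hx, hx']; abel

/-- The derivation of the operad with coefficients in `A` induced by a derivation of `A`. -/
noncomputable def coeffDerivation (d : _root_.Derivation k A A) : (T.coeff A).Derivation where
  app {n c o p} := LinearMap.lTensor (T.X n c o p) (d : A →ₗ[k] A)
  app_map σ hσ x := T.lTensor_map (d : A →ₗ[k] A) σ hσ x
  app_comp g h x y := T.lTensor_derivation_comp d g h x y
  app_diff h x := T.lTensor_diff (d : A →ₗ[k] A) h x

end Coeff

variable (T : DGOperad.{u} k C)

/-- The path object `T ⊗ k[t, dt]` of a dg operad `T`. -/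
noncomputable def path : DGOperad.{u} k C :=
  -- Here `ε` plays the role of `dt`, so `∂ + ε d/dt` is the total differential of `T ⊗ k[t, dt]`.
  epsDG (T.coeff k[X]) (T.coeffDerivation (derivative' (R := k)))

variable {T}

/-- Evaluation of coefficients at a point. -/
noncomputable def evalCoeff (a : k) {n : ℕ} {c : Fin n → C} {o : C} {p : ℤ} :
    T.X n c o p ⊗[k] k[X] →ₗ[k] T.X n c o p :=
  (TensorProduct.rid k _).toLinearMap.comp (LinearMap.lTensor _ (aeval a).toLinearMap)

theorem evalCoeff_tmul (a : k) {n : ℕ} {c : Fin n → C} {o : C} {p : ℤ} (x : T.X n c o p) (f : k[X]) :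
    evalCoeff a (x ⊗ₜ f) = eval a f • x := by
  simp [evalCoeff, coe_aeval_eq_eval]

variable (T)

/-- Evaluation of paths at a point. -/
noncomputable def pathEval (a : k) : Hom T.path T where
  -- Evaluation at a point sends `dt` to zero, so only the first component matters.
  app {n c o p} := (evalCoeff a).comp
    (LinearMap.fst k (T.X n c o p ⊗[k] k[X]) (T.X n c o (p + 1) ⊗[k] k[X]))
  app_map {n n' c c' o p} σ hσ x := by
    have key : ∀ x : T.X n c o p ⊗[k] k[X],
        evalCoeff a (LinearMap.rTensor k[X] (T.map σ hσ) x) = T.map σ hσ (evalCoeff a x) := by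
      intro x
      refine TensorProduct.induction_on x (by simp) (fun x f => ?_) fun x y hx hy => ?_
      · rw [LinearMap.rTensor_tmul, evalCoeff_tmul, evalCoeff_tmul, map_smul]
      · simp only [map_add, hx, hy]
    exact key x.1
  app_one o := (evalCoeff_tmul a (T.one o) 1).trans (by simp)
  app_comp {m n r c i c' b c'' o p q t} g h x y := by
    have key : ∀ (x : T.X m c o p ⊗[k] k[X]) (y : T.X n c' b q ⊗[k] k[X]),
        evalCoeff a (TensorProduct.map₂ (T.comp g h) (LinearMap.mul k k[X]) x y) =
          T.comp g h (evalCoeff a x) (evalCoeff a y) := by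
      intro x y
      refine TensorProduct.induction_on x (by simp) (fun x a => ?_) fun x x' hx hx' => ?_
      · refine TensorProduct.induction_on y (by simp) (fun y b => ?_) fun y y' hy hy' => ?_
        · simp [TensorProduct.map₂_apply_tmul, evalCoeff_tmul, smul_smul, mul_comm]
        · simp only [map_add, hy, hy']
      · simp only [map_add, LinearMap.add_apply, hx, hx']
    exact key x.1 y.1
  app_diff {n c o p p'} h x := by
    have key : ∀ x : T.X n c o p ⊗[k] k[X],
        evalCoeff a (LinearMap.rTensor k[X] (T.diff h) x) = T.diff h (evalCoeff a x) := by
      intro x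
      refine TensorProduct.induction_on x (by simp) (fun x f => ?_) fun x y hx hy => ?_
      · rw [LinearMap.rTensor_tmul, evalCoeff_tmul, evalCoeff_tmul, map_smul]
      · simp only [map_add, hx, hy]
    exact key x.1

theorem epsComp_constant (S : GradedOperad.{u} k C) {m n r : ℕ} {c : Fin m → C} {i : Fin m}
    {c' : Fin n → C} {b : C} {c'' : Fin r → C} {o : C} {p q t : ℤ} (g : Graft c i c' b c'')
    (h : p + q = t) (x : S.X m c o p) (y : S.X n c' b q) :
    S.epsComp g h (x, 0) (y, 0) = (S.comp g h x y, 0) := by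
  rw [GradedOperad.epsComp_apply g h (by omega) (by omega)]
  simp

theorem epsDiff_tmul_one {n : ℕ} {c : Fin n → C} {o : C} {p p' : ℤ} (h : p' + 1 = p)
    (x : T.X n c o p) :
    (T.coeffDerivation (derivative' (R := k))).epsDiff h (x ⊗ₜ[k] (1 : k[X]), 0) =
      (T.diff h x ⊗ₜ[k] (1 : k[X]), 0) := by
  rw [Derivation.epsDiff_apply _ h (by omega)]
  refine Prod.ext rfl ?_
  subst h
  have key : (T.coeffDerivation (derivative' (R := k))).der rfl (x ⊗ₜ[k] (1 : k[X])) = 0 := by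
    change x ⊗ₜ[k] derivative (1 : k[X]) = 0
    simp
  dsimp only
  rw [map_zero, zero_add]
  exact (congrArg _ key).trans (smul_zero _)

/-- The constant paths. -/
noncomputable def pathConst : Hom T T.path where
  app {n c o p} := LinearMap.inl k (T.X n c o p ⊗[k] k[X]) (T.X n c o (p + 1) ⊗[k] k[X]) ∘ₗ
    (TensorProduct.mk k (T.X n c o p) k[X]).flip 1
  app_map σ hσ _ :=
    Prod.ext rfl (LinearMap.map_zero ((T.map σ hσ).rTensor k[X])).symm
  app_one _ := rfl
  app_comp g h x y := by
    refine Eq.trans ?_ (epsComp_constant (T.coeff k[X]).toGradedOperad g h (x ⊗ₜ[k] (1 : k[X]))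
      (y ⊗ₜ[k] (1 : k[X]))).symm
    refine Prod.ext ?_ rfl
    change T.comp g h x y ⊗ₜ[k] (1 : k[X]) = T.comp g h x y ⊗ₜ[k] (1 * 1 : k[X])
    rw [mul_one]
  app_diff h x := (T.epsDiff_tmul_one h x).symm

theorem pathEval_pathConst (a : k) {n : ℕ} {c : Fin n → C} {o : C} {p : ℤ} (x : T.X n c o p) :
    (T.pathEval a).app (T.pathConst.app x) = x :=
  (evalCoeff_tmul a x 1).trans (by simp)


/-- Cycles of `Q`, together with a chain of `P` bounding their image, lift to bounding chains. -/
def Hom.LiftsBoundaries {Q P : DGOperad.{u} k C} (π : Hom Q P) : Prop :=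
  ∀ (n : ℕ) (c : Fin n → C) (o : C) (p p' : ℤ) (h : p' + 1 = p) (z : Q.X n c o p')
    (w : P.X n c o p), (∀ (p'' : ℤ) (h' : p'' + 1 = p'), Q.diff h' z = 0) →
    P.diff h w = π.app z → ∃ x : Q.X n c o p, Q.diff h x = z ∧ π.app x = w

end DGOperad

/-! ### Integration of polynomials -/

namespace Polynomial

variable {k : Type u} [Field k]

/-- The antiderivative that vanishes at `0`. -/
noncomputable def antideriv : k[X] →ₗ[k] k[X] :=
  (basisMonomials k).constr k fun n => monomial (n + 1) ((n : k) + 1)⁻¹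

theorem antideriv_monomial_one (n : ℕ) :
    antideriv (monomial n (1 : k)) = monomial (n + 1) ((n : k) + 1)⁻¹ := by
  have := (basisMonomials k).constr_basis k
    (fun n : ℕ => (monomial (n + 1) ((n : k) + 1)⁻¹ : k[X])) n
  rwa [coe_basisMonomials] at this

theorem eval_zero_antideriv (f : k[X]) : eval 0 (antideriv f) = 0 := by
  have key : leval 0 ∘ₗ antideriv = (0 : k[X] →ₗ[k] k) := by
    refine (basisMonomials k).ext fun n => ?_
    rw [coe_basisMonomials, LinearMap.comp_apply, antideriv_monomial_one, leval_apply,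
      eval_monomial]
    simp
  exact LinearMap.congr_fun key f

variable [CharZero k]

theorem derivative_antideriv (f : k[X]) : derivative (antideriv f) = f := by
  have key : (derivative : k[X] →ₗ[k] k[X]) ∘ₗ antideriv = LinearMap.id := by
    refine (basisMonomials k).ext fun n => ?_
    rw [coe_basisMonomials, LinearMap.comp_apply, antideriv_monomial_one, derivative_monomial]
    have : ((n : k) + 1) ≠ 0 := by exact_mod_cast Nat.succ_ne_zero n
    simp [this]
  exact LinearMap.congr_fun key f

theorem antideriv_derivative (f : k[X]) : antideriv (derivative f) = f - C (eval 0 f) := by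
  have key : antideriv ∘ₗ (derivative : k[X] →ₗ[k] k[X]) =
      LinearMap.id - (Algebra.linearMap k k[X]) ∘ₗ (leval 0) := by
    refine (basisMonomials k).ext fun n => ?_
    rw [coe_basisMonomials]
    simp only [LinearMap.comp_apply, LinearMap.sub_apply, leval_apply, LinearMap.id_apply,
      derivative_monomial, one_mul, Algebra.linearMap_apply, eval_monomial]
    rcases n with _ | n
    · simp
    · have h : (monomial (n + 1 - 1) ((n + 1 : ℕ) : k) : k[X]) =
          ((n + 1 : ℕ) : k) • monomial n 1 := by simp [smul_monomial]
      have h₀ : ((n : k) + 1) ≠ 0 := by exact_mod_cast Nat.succ_ne_zero n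
      rw [h, map_smul, antideriv_monomial_one, smul_monomial]
      simp [h₀]
  exact LinearMap.congr_fun key f

end Polynomial

/-! ### Evaluation at zero lifts boundaries -/

namespace DGOperad

variable {k : Type u} [Field k] {C : Type} (T : DGOperad.{u} k C)

theorem evalCoeff_lTensor_antideriv {n : ℕ} {c : Fin n → C} {o : C} {p : ℤ}
    (x : T.X n c o p ⊗[k] k[X]) : evalCoeff 0 (antideriv.lTensor (T.X n c o p) x) = 0 := by
  refine TensorProduct.induction_on x (by simp) (fun x f => ?_) fun x y hx hy => ?_
  · rw [LinearMap.lTensor_tmul, evalCoeff_tmul, eval_zero_antideriv, zero_smul]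
  · simp only [map_add, hx, hy, add_zero]

variable [CharZero k]

theorem lTensor_derivative_antideriv {n : ℕ} {c : Fin n → C} {o : C} {p : ℤ}
    (x : T.X n c o p ⊗[k] k[X]) :
    (derivative : k[X] →ₗ[k] k[X]).lTensor (T.X n c o p) (antideriv.lTensor (T.X n c o p) x) =
      x := by
  refine TensorProduct.induction_on x (by simp) (fun x f => ?_) fun x y hx hy => ?_
  · rw [LinearMap.lTensor_tmul, LinearMap.lTensor_tmul, derivative_antideriv]
  · simp only [map_add, hx, hy]

theorem lTensor_antideriv_derivative {n : ℕ} {c : Fin n → C} {o : C} {p : ℤ}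
    (x : T.X n c o p ⊗[k] k[X]) :
    antideriv.lTensor (T.X n c o p) ((derivative : k[X] →ₗ[k] k[X]).lTensor (T.X n c o p) x) =
      x - evalCoeff 0 x ⊗ₜ 1 := by
  refine TensorProduct.induction_on x (by simp) (fun x f => ?_) fun x y hx hy => ?_
  · rw [LinearMap.lTensor_tmul, LinearMap.lTensor_tmul, antideriv_derivative, evalCoeff_tmul,
      TensorProduct.tmul_sub, TensorProduct.smul_tmul, smul_eq_C_mul, mul_one]
  · simp only [map_add, hx, hy, TensorProduct.add_tmul]; abel

/-- For `z = z₀ + z₁ dt` a solution of the form `(q₀, 0)` must satisfy `∂q₀ = z₀`, `(-1)^p q₀' = z₁`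
and `q₀(0) = w`. The last two equations force `q₀ = w + (-1)^p ∫ z₁`, with the integral starting at
`0`. The first then follows, since the cycle condition expresses `∂z₁` through `z₀'` and `∂w =
z₀(0)`. -/
theorem pathEval_liftsBoundaries : (T.pathEval 0).LiftsBoundaries := by
  intro n c o p p' h z w hz hw
  obtain ⟨p'', rfl⟩ : ∃ p'', p'' + 1 = p' := ⟨p' - 1, by omega⟩
  subst h
  obtain ⟨z₀, z₁⟩ := z
  change T.X n c o (p'' + 1) ⊗[k] k[X] at z₀
  change T.X n c o (p'' + 1 + 1) ⊗[k] k[X] at z₁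
  have hz' := (Derivation.epsDiff_apply (T.coeffDerivation (derivative' (R := k))) rfl rfl
    (z₀, z₁)).symm.trans (hz p'' rfl)
  have hz₀ : (T.diff rfl).rTensor k[X] z₀ = 0 := congrArg Prod.fst hz'
  have hz₁ : (T.diff rfl).rTensor k[X] z₁ +
      (p'' + 1).negOnePow • (derivative : k[X] →ₗ[k] k[X]).lTensor (T.X n c o (p'' + 1)) z₀ = 0 :=
    congrArg Prod.snd hz'
  change T.diff rfl w = evalCoeff 0 z₀ at hw
  let q₀ : T.X n c o (p'' + 1 + 1) ⊗[k] k[X] :=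
    w ⊗ₜ 1 + (p'' + 1 + 1).negOnePow • antideriv.lTensor (T.X n c o (p'' + 1 + 1)) z₁
  have e₁ : (T.diff rfl).rTensor k[X] q₀ = z₀ := by
    -- Integrating the `dt`-part of the cycle condition recovers `z₀ - z₀(0)` up to sign.
    have := congrArg (antideriv.lTensor (T.X n c o (p'' + 1))) (eq_neg_of_add_eq_zero_left hz₁)
    rw [T.lTensor_diff, map_neg, Units.smul_def, map_zsmul, T.lTensor_antideriv_derivative] at this
    simp only [q₀]
    rw [map_add, LinearMap.rTensor_tmul, hw, Units.smul_def, map_zsmul, this,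
      Int.negOnePow_succ (p'' + 1), Units.val_neg, neg_smul, smul_neg, neg_neg, smul_smul,
      Int.units_coe_mul_self, one_smul]
    abel
  have e₂ : (p'' + 1 + 1).negOnePow •
      (derivative : k[X] →ₗ[k] k[X]).lTensor (T.X n c o (p'' + 1 + 1)) q₀ = z₁ := by
    simp only [q₀]
    rw [map_add, Units.smul_def, Units.smul_def, map_zsmul, T.lTensor_derivative_antideriv,
      LinearMap.lTensor_tmul, smul_add, smul_smul, Int.units_coe_mul_self]
    simp
  refine ⟨(q₀, 0), ?_, ?_⟩
  · refine (Derivation.epsDiff_apply (T.coeffDerivation (derivative' (R := k))) rfl rfl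
      (q₀, 0)).trans (Prod.ext e₁ ?_)
    refine Eq.trans ?_ e₂
    dsimp only
    rw [map_zero]
    exact zero_add _
  · change evalCoeff 0 q₀ = w
    simp only [q₀]
    rw [map_add, Units.smul_def, map_zsmul, T.evalCoeff_lTensor_antideriv, evalCoeff_tmul]
    simp

end DGOperad

end Path

/-! ### Equivariant sections and the lifting property -/

namespace DGOperad

variable {k : Type u} [Field k] {C : Type} {P Q R : DGOperad.{u} k C}

namespace Hom

section Section

variable (π : Hom Q P)

/-- The boundary of an operation together with its image. -/
def boundary {n : ℕ} (c : Fin n → C) (o : C) {p p' : ℤ} (h : p' + 1 = p) :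
    Q.X n c o p →ₗ[k] Q.X n c o p' × P.X n c o p :=
  (Q.diff h).prod π.app

theorem boundary_map {n : ℕ} {c d : Fin n → C} (o : C) {p p' : ℤ} (h : p' + 1 = p)
    (σ : Fin n ≃ Fin n) (hσ : ∀ j, d (σ j) = c j) (x : Q.X n c o p) :
    π.boundary d o h (Q.map σ hσ x) =
      (Q.map σ hσ).prodMap (P.map σ hσ) (π.boundary c o h x) :=
  Prod.ext (Q.diff_map σ hσ h x) (π.app_map σ hσ x)

/-- Over a field a linear map splits over its range, and the splitting extends to the whole target.
The values outside the range are arbitrary, so the section property is only claimed on the range. -/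
theorem exists_linear_section {n : ℕ} (c : Fin n → C) (o : C) {p p' : ℤ} (h : p' + 1 = p) :
    ∃ l : Q.X n c o p' × P.X n c o p →ₗ[k] Q.X n c o p,
      ∀ x, π.boundary c o h (l (π.boundary c o h x)) = π.boundary c o h x := by
  obtain ⟨g, hg⟩ := (π.boundary c o h).rangeRestrict.exists_rightInverse_of_surjective
    (LinearMap.range_rangeRestrict _)
  obtain ⟨l, hl⟩ := LinearMap.exists_extend g
  refine ⟨l, fun x => ?_⟩
  have h₁ : l (π.boundary c o h x) = g ((π.boundary c o h).rangeRestrict x) :=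
    LinearMap.congr_fun hl ((π.boundary c o h).rangeRestrict x)
  rw [h₁]
  exact congrArg Subtype.val (LinearMap.congr_fun hg ((π.boundary c o h).rangeRestrict x))

/-- A linear section of `boundary`, conjugated by a permutation. -/
noncomputable def conjSection {n : ℕ} {c : Fin n → C} (o : C) {p p' : ℤ} (h : p' + 1 = p)
    (σ : Fin n ≃ Fin n) (d : Fin n → C) (hσ : ∀ j, d (σ j) = c j) :
    Q.X n c o p' × P.X n c o p →ₗ[k] Q.X n c o p :=
  (Q.map σ.symm (fun j => by rw [← hσ, σ.apply_symm_apply])) ∘ₗ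
    (π.exists_linear_section d o h).choose ∘ₗ (Q.map σ hσ).prodMap (P.map σ hσ)

theorem map_map_symm (Q : GradedOperad.{u} k C) {n n' : ℕ} {c : Fin n → C} {d : Fin n' → C} {o : C}
    {p : ℤ} (σ : Fin n ≃ Fin n') (hσ : ∀ j, d (σ j) = c j) (hσ' : ∀ j, c (σ.symm j) = d j)
    (x : Q.X n c o p) : Q.map σ.symm hσ' (Q.map σ hσ x) = x := by
  rw [Q.map_map]
  have : ∀ (ρ : Fin n ≃ Fin n) (hρ : ∀ j, c (ρ j) = c j), ρ = Equiv.refl _ → Q.map ρ hρ x = x := by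
    rintro ρ hρ rfl
    exact Q.map_refl x
  exact this _ _ σ.self_trans_symm

theorem boundary_conjSection {n : ℕ} {c : Fin n → C} (o : C) {p p' : ℤ} (h : p' + 1 = p)
    (σ : Fin n ≃ Fin n) (d : Fin n → C) (hσ : ∀ j, d (σ j) = c j) (x : Q.X n c o p) :
    π.boundary c o h (π.conjSection o h σ d hσ (π.boundary c o h x)) = π.boundary c o h x := by
  simp only [conjSection, LinearMap.comp_apply]
  rw [← π.boundary_map, π.boundary_map, (π.exists_linear_section d o h).choose_spec,
    π.boundary_map]
  exact Prod.ext (map_map_symm _ _ _ _ _) (map_map_symm _ _ _ _ _)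

theorem conjSection_map {n : ℕ} {c c' : Fin n → C} (o : C) {p p' : ℤ} (h : p' + 1 = p)
    (σ τ : Fin n ≃ Fin n) (d d' : Fin n → C) (hσ : ∀ j, d (σ j) = c' j) (hτ : ∀ j, c' (τ j) = c j)
    (hd : d = d') (v : Q.X n c o p' × P.X n c o p) :
    π.conjSection o h σ d hσ ((Q.map τ hτ).prodMap (P.map τ hτ) v) =
      Q.map τ hτ (π.conjSection o h (τ.trans σ) d' (fun j => by rw [← hd, ← hτ, ← hσ]; rfl) v) := by
  subst hd
  simp only [conjSection, LinearMap.comp_apply, LinearMap.prodMap_apply]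
  rw [Q.map_map, P.map_map, Q.map_map]
  congr 1
  congr 1
  ext j
  simp

/-- An equivariant linear section of `boundary`. -/
noncomputable def equivSection {n : ℕ} (c : Fin n → C) (o : C) {p p' : ℤ} (h : p' + 1 = p) :
    Q.X n c o p' × P.X n c o p →ₗ[k] Q.X n c o p :=
  (n.factorial : k)⁻¹ • ∑ σ : Fin n ≃ Fin n,
    π.conjSection o h σ (fun j => c (σ.symm j)) (fun j => by rw [σ.symm_apply_apply])

theorem equivSection_apply {n : ℕ} (c : Fin n → C) (o : C) {p p' : ℤ} (h : p' + 1 = p)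
    (v : Q.X n c o p' × P.X n c o p) :
    π.equivSection c o h v = (n.factorial : k)⁻¹ • ∑ σ : Fin n ≃ Fin n,
      π.conjSection o h σ (fun j => c (σ.symm j)) (fun j => by rw [σ.symm_apply_apply]) v := by
  rw [equivSection, LinearMap.smul_apply, LinearMap.sum_apply]

/-- Since `boundary` is equivariant, each of the `n!` conjugates is a section on its range, hence so
is their average. -/
theorem boundary_equivSection [CharZero k] {n : ℕ} (c : Fin n → C) (o : C) {p p' : ℤ}
    (h : p' + 1 = p) (x : Q.X n c o p) :
    π.boundary c o h (π.equivSection c o h (π.boundary c o h x)) = π.boundary c o h x := by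
  have hn : (n.factorial : k) ≠ 0 := by exact_mod_cast n.factorial_ne_zero
  simp only [equivSection_apply, map_smul, map_sum,
    π.boundary_conjSection]
  rw [Finset.sum_const, Finset.card_univ, Fintype.card_perm, Fintype.card_fin,
    ← Nat.cast_smul_eq_nsmul k, smul_smul, inv_mul_cancel₀ hn, one_smul]

/-- Relabelling by `τ` translates the index set of the average. Permutations change the input
colours, so each summand uses a section chosen for the permuted colours. -/
theorem equivSection_map {n n' : ℕ} {c : Fin n → C} {c' : Fin n' → C} (o : C) {p p' : ℤ}
    (h : p' + 1 = p) (τ : Fin n ≃ Fin n') (hτ : ∀ j, c' (τ j) = c j)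
    (v : Q.X n c o p' × P.X n c o p) :
    π.equivSection c' o h ((Q.map τ hτ).prodMap (P.map τ hτ) v) =
      Q.map τ hτ (π.equivSection c o h v) := by
  obtain rfl : n = n' := Fin.equiv_iff_eq.mp ⟨τ⟩
  simp only [equivSection_apply, map_smul, map_sum]
  congr 1
  refine Fintype.sum_equiv (Equiv.mulRight τ) _ _ fun σ => ?_
  refine π.conjSection_map o h σ τ _ _ _ hτ ?_ v
  funext j
  rw [← hτ]
  exact congrArg c' (τ.apply_symm_apply (σ.symm j)).symm

end Section

/-- The lifting property of cofibrations. The cofibration is given by the operations `B` of the source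
and the generators `E` of the target, and `adm` singles out the morphisms with the prescribed values
on `B`. -/
theorem LiftsBoundaries.exists_lift [CharZero k] {π : Hom Q P} (hπ : π.LiftsBoundaries)
    (α : Hom R P) (E : ℕ → R.toGradedOperad.SubCollection)
    (adm : GradedOperad.Hom R.toGradedOperad Q.toGradedOperad → Prop)
    (B : ∀ (n : ℕ) (c : Fin n → C) (o : C) (p : ℤ), Set (R.X n c o p))
    (hext : ∀ ψ : ∀ N, (E N).Hom Q.toGradedOperad, ∃ Φ, adm Φ ∧
      ∀ (N n : ℕ) (c : Fin n → C) (o : C) (p : ℤ) (x : (E N).carrier n c o p),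
        Φ.app x.1 = (ψ N).app x)
    (hB : ∀ Φ Ψ, adm Φ → adm Ψ → ∀ n c o p, ∀ x ∈ B n c o p, Φ.app x = Ψ.app x)
    (hBd : ∀ Φ, adm Φ → ∀ n c o p, ∀ x ∈ B n c o p, x ∈ (commLocus Φ).carrier n c o p)
    (hBα : ∀ Φ, adm Φ → ∀ n c o p, ∀ x ∈ B n c o p, π.app (Φ.app x) = α.app x)
    (hgen : ∀ K : R.toGradedOperad.Suboperad, (∀ n c o p, B n c o p ⊆ K.carrier n c o p) →
      (∀ N n c o p, (E N).carrier n c o p ≤ K.carrier n c o p) → ∀ n c o p, K.carrier n c o p = ⊤)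
    (hfil : ∀ (N : ℕ) (K : R.toGradedOperad.Suboperad),
      (∀ n c o p, B n c o p ⊆ K.carrier n c o p) →
      (∀ N' < N, ∀ n c o p, (E N').carrier n c o p ≤ K.carrier n c o p) →
      ∀ (n : ℕ) (c : Fin n → C) (o : C) (p p' : ℤ) (h : p' + 1 = p),
        ∀ x ∈ (E N).carrier n c o p, R.diff h x ∈ K.carrier n c o p') :
    ∃ Φ : Hom R Q, adm Φ.toHom ∧
      ∀ (n : ℕ) (c : Fin n → C) (o : C) (p : ℤ) (x : R.X n c o p), π.app (Φ.app x) = α.app x := by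
  -- `val Φ x` is the candidate for a solution `y` of `∂y = Φ(∂x)` and `π y = α x`. It is defined
  -- for every `Φ`, whether or not a solution exists.
  let val : ∀ (Φ : GradedOperad.Hom R.toGradedOperad Q.toGradedOperad) {n : ℕ} {c : Fin n → C}
      {o : C} {p : ℤ}, R.X n c o p →ₗ[k] Q.X n c o p := fun Φ {n c o p} =>
    π.equivSection c o (sub_add_cancel p 1) ∘ₗ
      (Φ.app ∘ₗ R.diff (sub_add_cancel p 1)).prod α.app
  have val_apply : ∀ (Φ : GradedOperad.Hom R.toGradedOperad Q.toGradedOperad) {n : ℕ}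
      {c : Fin n → C} {o : C} {p : ℤ} (x : R.X n c o p), val Φ x =
        π.equivSection c o (sub_add_cancel p 1)
          (Φ.app (R.diff (sub_add_cancel p 1) x), α.app x) := fun _ _ _ _ _ _ => rfl
  have val_map : ∀ (Φ : GradedOperad.Hom R.toGradedOperad Q.toGradedOperad) {n n' : ℕ}
      {c : Fin n → C} {c' : Fin n' → C} {o : C} {p : ℤ} (σ : Fin n ≃ Fin n')
      (hσ : ∀ j, c' (σ j) = c j) (x : R.X n c o p),
      val Φ (R.map σ hσ x) = Q.map σ hσ (val Φ x) := by
    intro Φ n n' c c' o p σ hσ x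
    rw [val_apply, val_apply, ← π.equivSection_map, R.diff_map, Φ.app_map, α.app_map]
    rfl
  -- For `x` in `E N`, the boundary `∂x` is generated by `B` and the earlier generators, so `val Φ
  -- x` depends only on the values of `Φ` there.
  have val_congr : ∀ (N : ℕ) (Φ Ψ : GradedOperad.Hom R.toGradedOperad Q.toGradedOperad),
      adm Φ → adm Ψ → (∀ N' < N, ∀ n c o p, ∀ x ∈ (E N').carrier n c o p, Φ.app x = Ψ.app x) →
      ∀ n c o p, ∀ x ∈ (E N).carrier n c o p, val Φ x = val Ψ x := by
    intro N Φ Ψ hΦ hΨ hE n c o p x hx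
    have : Φ.app (R.diff (sub_add_cancel p 1) x) = Ψ.app (R.diff (sub_add_cancel p 1) x) :=
      hfil N (Φ.eqLocus Ψ) (hB Φ Ψ hΦ hΨ) hE n c o p _ (sub_add_cancel p 1) x hx
    rw [val_apply, val_apply, this]
  have step : ∀ Φ : GradedOperad.Hom R.toGradedOperad Q.toGradedOperad, ∃ Ψ, adm Ψ ∧
      ∀ (N n : ℕ) (c : Fin n → C) (o : C) (p : ℤ), ∀ x ∈ (E N).carrier n c o p,
        Ψ.app x = val Φ x := by
    intro Φ
    obtain ⟨Ψ, h₁, h₂⟩ := hext fun N =>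
      { app := (val Φ) ∘ₗ Submodule.subtype _
        app_map := fun σ hσ x => val_map Φ σ hσ x.1 }
    exact ⟨Ψ, h₁, fun N n c o p x hx => h₂ N n c o p ⟨x, hx⟩⟩
  obtain ⟨Φ₀, hΦ₀, -⟩ := hext fun N => { app := 0, app_map := fun σ hσ x => by simp }
  choose F hF₁ hF₂ using step
  -- The universal property assigns all generators at once, so the recursion over stages becomes an
  -- iteration: each application of `F` fixes the values on one more stage, and on `E N` they no
  -- longer change from the iterate `N + 1` on.
  let Φs : ℕ → GradedOperad.Hom R.toGradedOperad Q.toGradedOperad := fun m => F^[m] Φ₀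
  have hs : ∀ m, Φs (m + 1) = F (Φs m) := fun m => Function.iterate_succ_apply' F m Φ₀
  have hadm : ∀ m, adm (Φs m) := by
    rintro (_ | m)
    · exact hΦ₀
    · rw [hs]; exact hF₁ _
  have stab : ∀ N m, N < m → ∀ n c o p, ∀ x ∈ (E N).carrier n c o p,
      (Φs m).app x = (Φs (m + 1)).app x := by
    intro N
    induction N using Nat.strong_induction_on with
    | _ N ih =>
      rintro (_ | m) hm n c o p x hx
      · exact absurd hm (Nat.not_lt_zero _)
      rw [hs m, hs (m + 1), hF₂ _ N n c o p x hx, hF₂ _ N n c o p x hx]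
      exact val_congr N _ _ (hadm m) (hadm (m + 1)) (fun N' hN' => ih N' hN' m (by omega)) n c o p x hx
  have stab' : ∀ N m, N < m → ∀ n c o p, ∀ x ∈ (E N).carrier n c o p,
      (Φs (N + 1)).app x = (Φs m).app x := by
    intro N m hm
    induction m, hm using Nat.le_induction with
    | base => exact fun _ _ _ _ _ _ => rfl
    | succ m hm ih =>
      intro n c o p x hx
      rw [ih n c o p x hx, stab N m hm n c o p x hx]
  -- The limit morphism takes the stable value on every stage; it is a fixed point of the iteration
  -- on the generators.
  obtain ⟨Φ, hΦ, hΦE⟩ := hext fun N => (Φs (N + 1)).restrict (E N)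
  have hΦs : ∀ N m, N < m → ∀ n c o p, ∀ x ∈ (E N).carrier n c o p, Φ.app x = (Φs m).app x :=
    fun N m hm n c o p x hx => (hΦE N n c o p ⟨x, hx⟩).trans (stab' N m hm n c o p x hx)
  have hval : ∀ N n c o p, ∀ x ∈ (E N).carrier n c o p, Φ.app x = val Φ x := by
    intro N n c o p x hx
    rw [hΦs N (N + 1) (Nat.lt_succ_self N) n c o p x hx, hs, hF₂ _ N n c o p x hx]
    exact val_congr N _ _ (hadm N) hΦ
      (fun N' hN' n c o p x hx => (hΦs N' N hN' n c o p x hx).symm) n c o p x hx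
  let K : R.toGradedOperad.Suboperad :=
    (commLocus Φ).inter ((π.toHom.comp Φ).eqLocus α.toHom)
  have hKB : ∀ n c o p, B n c o p ⊆ K.carrier n c o p := fun n c o p x hx =>
    ⟨hBd Φ hΦ n c o p x hx, hBα Φ hΦ n c o p x hx⟩
  have hKE : ∀ N n c o p, (E N).carrier n c o p ≤ K.carrier n c o p := by
    intro N
    induction N using Nat.strong_induction_on with
    | _ N ih =>
      intro n c o p x hx
      -- By induction `∂x` already lies in `K`. Thus `Φ(∂x)` is a cycle whose image is `∂(α x)`, the
      -- equations for `x` have a solution, and so `val Φ x` is a solution.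
      have hd := hfil N K hKB ih n c o p _ (sub_add_cancel p 1) x hx
      have hd₁ : Φ.app (R.diff (sub_add_cancel (p - 1) 1) (R.diff (sub_add_cancel p 1) x)) =
        Q.diff (sub_add_cancel (p - 1) 1) (Φ.app (R.diff (sub_add_cancel p 1) x)) := hd.1
      have hd₂ : π.app (Φ.app (R.diff (sub_add_cancel p 1) x)) =
        α.app (R.diff (sub_add_cancel p 1) x) := hd.2
      rw [R.diff_diff, map_zero] at hd₁
      obtain ⟨y, hy₁, hy₂⟩ := hπ n c o p (p - 1) (sub_add_cancel p 1)
        (Φ.app (R.diff (sub_add_cancel p 1) x)) (α.app x)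
        (fun p'' h' => by
          obtain rfl : p'' = p - 1 - 1 := by omega
          exact hd₁.symm)
        (by rw [hd₂, α.app_diff])
      have hy := π.boundary_equivSection c o (sub_add_cancel p 1) y
      have hyx : π.boundary c o (sub_add_cancel p 1) y =
          (Φ.app (R.diff (sub_add_cancel p 1) x), α.app x) := Prod.ext hy₁ hy₂
      rw [hyx] at hy
      rw [← val_apply, ← hval N n c o p x hx] at hy
      exact ⟨(congrArg Prod.fst hy).symm, congrArg Prod.snd hy⟩
  have hK := hgen K hKB hKE
  have hmem : ∀ n c o p (x : R.X n c o p), x ∈ K.carrier n c o p := fun n c o p x => by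
    rw [hK]; trivial
  exact ⟨{ toHom := Φ
           app_diff := app_diff_of_commLocus fun n c o p x => (hmem n c o p x).1 }, hΦ,
    fun n c o p x => (hmem n c o p x).2⟩

end Hom

end DGOperad

/-! ### Lifting out of cofibrant operads and along endpoint cofibrations -/

namespace DGOperad

variable {k : Type u} [Field k] {C : Type}

/-- Morphisms from a cofibrant operad lift. -/
theorem IsCofibrant.exists_lift [CharZero k] {P Q R : DGOperad.{u} k C} (hR : R.IsCofibrant)
    {π : Hom Q P} (hπ : π.LiftsBoundaries) (α : Hom R P) :
    ∃ Φ : Hom R Q,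
      ∀ (n : ℕ) (c : Fin n → C) (o : C) (p : ℤ) (x : R.X n c o p), π.app (Φ.app x) = α.app x := by
  obtain ⟨E, huniv, hfil⟩ := hR
  obtain ⟨Φ, -, hΦ⟩ := hπ.exists_lift α E (fun _ => True) (fun _ _ _ _ => ∅)
    (fun ψ => by
      obtain ⟨Φ, hΦ, -⟩ := huniv Q.toGradedOperad ψ
      exact ⟨Φ, trivial, hΦ⟩)
    (fun _ _ _ _ _ _ _ _ _ hx => hx.elim) (fun _ _ _ _ _ _ _ hx => hx.elim)
    (fun _ _ _ _ _ _ _ hx => hx.elim)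
    (fun K _ hK n c o p => by
      -- The universal property implies generation: a suboperad containing the generators receives a
      -- morphism from `R`, and its composite with the inclusion is the identity by uniqueness.
      obtain ⟨Φ, hΦ, -⟩ := huniv K.toOperad fun N => K.inclusion (E N) (hK N)
      obtain ⟨Ψ, -, hΨ⟩ := huniv R.toGradedOperad fun N =>
        (GradedOperad.Hom.id R.toGradedOperad).restrict (E N)
      have h : K.incl.comp Φ = GradedOperad.Hom.id R.toGradedOperad :=
        (hΨ _ fun N n c o p x => congrArg Subtype.val (hΦ N n c o p x)).trans
          (hΨ _ fun _ _ _ _ _ _ => rfl).symm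
      refine Submodule.eq_top_iff'.mpr fun x => ?_
      have hx : (Φ.app x).1 = x :=
        congrArg (fun F : GradedOperad.Hom R.toGradedOperad R.toGradedOperad => F.app x) h
      rw [← hx]
      exact (Φ.app x).2)
    (fun N K _ hK => hfil N K hK)
  exact ⟨Φ, hΦ⟩

/-- The operations of `R` that are given by the source of an endpoint cofibration. -/
inductive EndpointOperation {R₀ : DGOperad.{u} k Unit} {R : DGOperad.{u} k Bool}
    (i₀ : Hom R₀ (R.pull fun _ => false)) (i₁ : Hom R₀ (R.pull fun _ => true))
    (s : R.X 1 (fun _ => false) true 0) :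
    ∀ (n : ℕ) (c : Fin n → Bool) (o : Bool) (p : ℤ), R.X n c o p → Prop
  | source {n : ℕ} {c : Fin n → Unit} {o : Unit} {p : ℤ} (x : R₀.X n c o p) :
    EndpointOperation i₀ i₁ s n (fun _ => false) false p (i₀.app x)
  | target {n : ℕ} {c : Fin n → Unit} {o : Unit} {p : ℤ} (x : R₀.X n c o p) :
    EndpointOperation i₀ i₁ s n (fun _ => true) true p (i₁.app x)
  | arrow : EndpointOperation i₀ i₁ s 1 (fun _ => false) true 0 s

/-- Morphisms lift along endpoint cofibrations. -/
theorem IsEndpointCofibration.exists_lift [CharZero k] {R₀ : DGOperad.{u} k Unit}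
    {P Q R : DGOperad.{u} k Bool} {i₀ : Hom R₀ (R.pull fun _ => false)}
    {i₁ : Hom R₀ (R.pull fun _ => true)} {s : R.X 1 (fun _ => false) true 0}
    (hR : IsEndpointCofibration i₀ i₁ s) (hs : ∀ (p : ℤ) (h : p + 1 = 0), R.diff h s = 0)
    {π : Hom Q P} (hπ : π.LiftsBoundaries) (α : Hom R P)
    (φ₀ : Hom R₀ (Q.pull fun _ => false)) (φ₁ : Hom R₀ (Q.pull fun _ => true))
    (t : Q.X 1 (fun _ => false) true 0) (ht : ∀ (p : ℤ) (h : p + 1 = 0), Q.diff h t = 0)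
    (h₀ : ∀ (n : ℕ) (c : Fin n → Unit) (o : Unit) (p : ℤ) (x : R₀.X n c o p),
      π.app (φ₀.app x) = α.app (i₀.app x))
    (h₁ : ∀ (n : ℕ) (c : Fin n → Unit) (o : Unit) (p : ℤ) (x : R₀.X n c o p),
      π.app (φ₁.app x) = α.app (i₁.app x))
    (hts : π.app t = α.app s) :
    ∃ Φ : Hom R Q,
      (∀ (n : ℕ) (c : Fin n → Unit) (o : Unit) (p : ℤ) (x : R₀.X n c o p),
        Φ.app (i₀.app x) = φ₀.app x ∧ Φ.app (i₁.app x) = φ₁.app x) ∧ Φ.app s = t := by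
  obtain ⟨E, huniv, hfil⟩ := hR
  obtain ⟨Φ, hΦ, -⟩ := hπ.exists_lift α E
    (fun Φ => (∀ (n : ℕ) (c : Fin n → Unit) (o : Unit) (p : ℤ) (x : R₀.X n c o p),
        Φ.app (i₀.app x) = φ₀.app x ∧ Φ.app (i₁.app x) = φ₁.app x) ∧ Φ.app s = t)
    (fun n c o p => {x | EndpointOperation i₀ i₁ s n c o p x})
    (fun ψ => by
      obtain ⟨Φ, hΦ, -⟩ := huniv Q.toGradedOperad φ₀.toHom φ₁.toHom t ψ
      exact ⟨Φ, ⟨hΦ.1, hΦ.2.1⟩, hΦ.2.2⟩)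
    (by
      rintro Φ Ψ ⟨hΦ, hΦs⟩ ⟨hΨ, hΨs⟩ n c o p x (x | x | _)
      · exact (hΦ _ _ _ _ x).1.trans (hΨ _ _ _ _ x).1.symm
      · exact (hΦ _ _ _ _ x).2.trans (hΨ _ _ _ _ x).2.symm
      · exact hΦs.trans hΨs.symm)
    (by
      rintro Φ ⟨hΦ, hΦs⟩ n c o p x (x | x | _)
      · change Φ.app (R.diff _ (i₀.app x)) = Q.diff _ (Φ.app (i₀.app x))
        have e := i₀.app_diff (sub_add_cancel _ 1) x
        have e' := φ₀.app_diff (sub_add_cancel _ 1) x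
        refine (congrArg Φ.app e.symm).trans ((hΦ _ _ _ _ _).1.trans (e'.trans ?_))
        exact congrArg (Q.diff _) (hΦ _ _ _ _ x).1.symm
      · change Φ.app (R.diff _ (i₁.app x)) = Q.diff _ (Φ.app (i₁.app x))
        have e := i₁.app_diff (sub_add_cancel _ 1) x
        have e' := φ₁.app_diff (sub_add_cancel _ 1) x
        refine (congrArg Φ.app e.symm).trans ((hΦ _ _ _ _ _).2.trans (e'.trans ?_))
        exact congrArg (Q.diff _) (hΦ _ _ _ _ x).2.symm
      · change Φ.app (R.diff _ s) = Q.diff _ (Φ.app s)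
        rw [hs, hΦs, ht, map_zero])
    (by
      rintro Φ ⟨hΦ, hΦs⟩ n c o p x (x | x | _)
      · exact (congrArg π.app (hΦ _ _ _ _ x).1).trans (h₀ _ _ _ _ x)
      · exact (congrArg π.app (hΦ _ _ _ _ x).2).trans (h₁ _ _ _ _ x)
      · rw [hΦs, hts])
    (fun K hB hK n c o p => by
      -- The same argument, relative to the operations that come from the endpoints and the arrow.
      obtain ⟨Φ, hΦ, -⟩ := huniv K.toOperad
        { app := LinearMap.codRestrict (K.carrier _ (fun _ => false) false _) i₀.app
            fun x => hB _ _ _ _ (.source x)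
          app_map := fun σ hσ x => Subtype.ext (i₀.app_map σ hσ x)
          app_one := fun o => Subtype.ext (i₀.app_one o)
          app_comp := fun g h x y => Subtype.ext (i₀.app_comp g h x y) }
        { app := LinearMap.codRestrict (K.carrier _ (fun _ => true) true _) i₁.app
            fun x => hB _ _ _ _ (.target x)
          app_map := fun σ hσ x => Subtype.ext (i₁.app_map σ hσ x)
          app_one := fun o => Subtype.ext (i₁.app_one o)
          app_comp := fun g h x y => Subtype.ext (i₁.app_comp g h x y) }
        ⟨s, hB _ _ _ _ .arrow⟩ fun N => K.inclusion (E N) (hK N)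
      obtain ⟨Ψ, -, hΨ⟩ := huniv R.toGradedOperad i₀.toHom i₁.toHom s fun N =>
        (GradedOperad.Hom.id R.toGradedOperad).restrict (E N)
      have h : K.incl.comp Φ = GradedOperad.Hom.id R.toGradedOperad :=
        (hΨ _ ⟨fun n c o p x => ⟨congrArg Subtype.val (hΦ.1 n c o p x).1,
            congrArg Subtype.val (hΦ.1 n c o p x).2⟩, congrArg Subtype.val hΦ.2.1,
            fun N n c o p x => congrArg Subtype.val (hΦ.2.2 N n c o p x)⟩).trans
          (hΨ _ ⟨fun _ _ _ _ _ => ⟨rfl, rfl⟩, rfl, fun _ _ _ _ _ _ => rfl⟩).symm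
      refine Submodule.eq_top_iff'.mpr fun x => ?_
      have hx : (Φ.app x).1 = x :=
        congrArg (fun F : GradedOperad.Hom R.toGradedOperad R.toGradedOperad => F.app x) h
      rw [← hx]
      exact (Φ.app x).2)
    (fun N K hB hK => hfil N K (fun n c o p x =>
      ⟨hB _ _ _ _ (.source x), hB _ _ _ _ (.target x)⟩) (hB _ _ _ _ .arrow) hK)
  exact ⟨Φ, hΦ.1, hΦ.2⟩

end DGOperad

/-! ### Passing between single colours and the sum over all colours -/

section Colours

theorem Graft.unary_isPlanar {C : Type} {n : ℕ} (c : Fin n → C) (i : Fin n) : (Graft.unary c i).IsPlanar :=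
  ⟨fun _ _ => Iff.rfl, fun l l' => by simp [Subsingleton.elim l l'], fun _ _ => Iff.rfl⟩

variable {k : Type u} [Field k] {C : Type} (U : C → ChainComplex (ModuleCat.{u} k) ℤ)

/-- The components of a coloured chain complex. -/
abbrev colComponents (x : C × ℤ) : Type u := (U x.1).X x.2

/-- `tcast` as a linear map. -/
def tcastHom {c c' : C} (h : c = c') : Tot (U c) →ₗ[k] Tot (U c') := h ▸ LinearMap.id

theorem IsHomog.tcast {c c' : C} (h : c = c') {i : ℤ} {a : Tot (U c)} (ha : IsHomog i a) :
    IsHomog i (tcast U h a) := by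
  subst h; exact ha

theorem IsHomog.zero {V : ChainComplex (ModuleCat.{u} k) ℤ} (i : ℤ) : IsHomog i (0 : Tot V) :=
  ⟨0, (LinearMap.map_zero _).symm⟩

variable [DecidableEq C]

/-- The inclusion of the complex of a given colour. -/
noncomputable def colIncl (c : C) : Tot (U c) →ₗ[k] ColTot (colComponents U) :=
  DirectSum.toModule k ℤ _ fun i => DirectSum.lof k (C × ℤ) (colComponents U) (c, i)

/-- The projection to the complex of a given colour. -/
noncomputable def colProj (c : C) : ColTot (colComponents U) →ₗ[k] Tot (U c) :=
  DirectSum.toModule k (C × ℤ) _ fun x =>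
    if h : x.1 = c then tcastHom U h ∘ₗ DirectSum.lof k ℤ (fun i => (U x.1).X i) x.2 else 0

theorem colIncl_lof (c : C) (i : ℤ) (v : (U c).X i) :
    colIncl U c (DirectSum.lof k ℤ (fun i => (U c).X i) i v) =
      DirectSum.lof k (C × ℤ) (colComponents U) (c, i) v :=
  DirectSum.toModule_lof _ _ _

theorem colProj_lof (c : C) (i : ℤ) (v : (U c).X i) :
    colProj U c (DirectSum.lof k (C × ℤ) (colComponents U) (c, i) v) =
      DirectSum.lof k ℤ (fun i => (U c).X i) i v := by
  rw [colProj, DirectSum.toModule_lof, dif_pos rfl]; rfl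

theorem colProj_lof_of_ne {c : C} {x : C × ℤ} (hx : x.1 ≠ c) (v : (U x.1).X x.2) :
    colProj U c (DirectSum.lof k (C × ℤ) (colComponents U) x v) = 0 := by
  rw [colProj, DirectSum.toModule_lof, dif_neg hx]; rfl

@[simp] theorem colProj_colIncl (c : C) (a : Tot (U c)) : colProj U c (colIncl U c a) = a := by
  have : colProj U c ∘ₗ colIncl U c = LinearMap.id :=
    DirectSum.linearMap_ext k fun i => LinearMap.ext fun v => by
      simp only [LinearMap.comp_apply, colIncl_lof, colProj_lof, LinearMap.id_apply]
  exact LinearMap.congr_fun this a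

theorem colIncl_mem {c : C} {i : ℤ} {a : Tot (U c)} (ha : IsHomog i a) :
    colIncl U c a ∈ component k (colComponents U) (c, i) := by
  obtain ⟨v, rfl⟩ := ha
  rw [colIncl_lof]
  exact ⟨v, rfl⟩

theorem isHomog_colProj {c : C} {i : ℤ} {a : ColTot (colComponents U)}
    (ha : a ∈ component k (colComponents U) (c, i)) : IsHomog i (colProj U c a) := by
  obtain ⟨v, rfl⟩ := ha
  exact ⟨v, colProj_lof U c i v⟩

theorem colIncl_colProj {c : C} {i : ℤ} {a : ColTot (colComponents U)}
    (ha : a ∈ component k (colComponents U) (c, i)) : colIncl U c (colProj U c a) = a := by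
  obtain ⟨v, rfl⟩ := ha
  rw [colProj_lof, colIncl_lof]

theorem colProj_of_ne {c : C} {x : C × ℤ} (hx : x.1 ≠ c) {a : ColTot (colComponents U)}
    (ha : a ∈ component k (colComponents U) x) : colProj U c a = 0 := by
  obtain ⟨v, rfl⟩ := ha
  exact colProj_lof_of_ne U hx v

theorem colIncl_tcast {c c' : C} (h : c = c') (a : Tot (U c)) :
    colIncl U c' (tcast U h a) = colIncl U c a := by
  subst h; rfl

variable {U}

/-- Both operations vanish as soon as one argument has the wrong colour; all other homogeneous
arguments come from the complexes `U (c j)`. -/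
theorem endSub_ext {n : ℕ} {c : Fin n → C} {o o' : C} {p p' : ℤ} {φ ψ : Multi k (colComponents U) n}
    (hφ : φ ∈ endSub k (colComponents U) n c o p) (hψ : ψ ∈ endSub k (colComponents U) n c o' p')
    (h : ∀ (s : Fin n → ℤ) (a : ∀ j, Tot (U (c j))), (∀ j, IsHomog (s j) (a j)) →
      φ (fun j => colIncl U (c j) (a j)) = ψ fun j => colIncl U (c j) (a j)) : φ = ψ := by
  refine Multi.ext_component fun x a ha => ?_
  by_cases hx : ∃ j, (x j).1 ≠ c j
  · rw [(hφ x a ha).2 hx, (hψ x a ha).2 hx]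
  · push Not at hx
    have ha' : ∀ j, a j ∈ component k (colComponents U) (c j, (x j).2) := fun j => by
      have := ha j
      rwa [show x j = (c j, (x j).2) from Prod.ext (hx j) rfl] at this
    have := h (fun j => (x j).2) (fun j => colProj U (c j) (a j)) fun j => isHomog_colProj U (ha' j)
    simpa only [fun j => colIncl_colProj U (ha' j)] using this

/-- The operation with one input given by a linear map. -/
noncomputable def unaryMulti {c o : C} (f : Tot (U c) →ₗ[k] Tot (U o)) :
    Multi k (colComponents U) 1 :=
  LinearMap.compMultilinearMap (colIncl U o ∘ₗ f ∘ₗ colProj U c)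
    (MultilinearMap.ofSubsingleton k (ColTot (colComponents U)) (ColTot (colComponents U)) (0 : Fin 1)
      LinearMap.id)

theorem unaryMulti_apply {c o : C} (f : Tot (U c) →ₗ[k] Tot (U o))
    (a : Fin 1 → ColTot (colComponents U)) :
    unaryMulti f a = colIncl U o (f (colProj U c (a 0))) := rfl

theorem unaryMulti_mem {c o : C} {f : Tot (U c) →ₗ[k] Tot (U o)} {p : ℤ}
    (hf : ∀ i a, IsHomog i a → IsHomog (p + i) (f a)) :
    unaryMulti f ∈ endSub k (colComponents U) 1 (fun _ => c) o p := by
  intro x a ha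
  rw [unaryMulti_apply, Fin.sum_univ_one]
  by_cases hx : (x 0).1 = c
  · have h0 := ha 0
    rw [show x 0 = (c, (x 0).2) from Prod.ext hx rfl] at h0
    exact ⟨colIncl_mem U (hf _ _ (isHomog_colProj U h0)), fun ⟨j, hj⟩ =>
      absurd (Subsingleton.elim j 0 ▸ hx) hj⟩
  · rw [colProj_of_ne U hx (ha 0), map_zero, map_zero]
    exact ⟨zero_mem _, fun _ => rfl⟩

theorem permMulti_colIncl {n n' : ℕ} {c : Fin n → C} {c' : Fin n' → C} (σ : Fin n ≃ Fin n')
    (hσ : ∀ j, c' (σ j) = c j) (φ : Multi k (colComponents U) n) {s : Fin n' → ℤ}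
    {a : ∀ j, Tot (U (c' j))} (ha : ∀ j, IsHomog (s j) (a j)) :
    permMulti σ φ (fun j => colIncl U (c' j) (a j)) =
      (koszulExp σ s).negOnePow • φ fun j => colIncl U (c j) (tcast U (hσ j) (a (σ j))) := by
  rw [permMulti_apply σ φ (x := fun j => (c' j, s j)) fun j => colIncl_mem U (ha j),
    permSign_koszulExp, sgn_intCast]
  simp only [colIncl_tcast]

/-- For planar grafts the abstract sign becomes the explicit one in `OperadAlgebra.act_comp`. -/
theorem compMulti_colIncl {m n r : ℕ} {c : Fin m → C} {i : Fin m} {c' : Fin n → C} {b : C}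
    {c'' : Fin r → C} (g : Graft c i c' b c'') (hg : g.IsPlanar) (q : ℤ)
    (φ : Multi k (colComponents U) m) (ψ : Multi k (colComponents U) n) {s : Fin r → ℤ}
    {a : ∀ j, Tot (U (c'' j))} (ha : ∀ j, IsHomog (s j) (a j)) :
    compMulti g.e q φ ψ (fun j => colIncl U (c'' j) (a j)) =
      (q * ∑ j : {j // j ≠ i}, if j.1 < i then s (g.e (Sum.inl j)) else 0).negOnePow •
        φ (insertArg g.e (ψ fun l => colIncl U (c' l) (tcast U (g.inner l) (a (g.e (Sum.inr l)))))
          fun j => colIncl U (c'' j) (a j)) := by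
  rw [compMulti_apply g.e q φ ψ (x := fun j => (c'' j, s j)) fun j => colIncl_mem U (ha j),
    graftSign_of_planar g.e hg.1 hg.2.1 hg.2.2, ← sgn_intCast]
  simp only [colIncl_tcast]
  push_cast
  congr 3

theorem insertArg_colIncl {m n r : ℕ} {c : Fin m → C} {i : Fin m} {c' : Fin n → C} {b : C}
    {c'' : Fin r → C} (g : Graft c i c' b c'') (a : ∀ j, Tot (U (c'' j))) (y : Tot (U b)) :
    insertArg g.e (colIncl U b y) (fun j => colIncl U (c'' j) (a j)) = fun j => colIncl U (c j)
      (if hj : j = i then tcast U (g.root.symm.trans (congrArg c hj.symm)) y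
        else tcast U (g.outer ⟨j, hj⟩) (a (g.e (Sum.inl ⟨j, hj⟩)))) := by
  funext j
  by_cases hj : j = i
  · subst hj
    rw [insertArg_self, dif_pos rfl, colIncl_tcast]
  · rw [insertArg_of_ne _ _ _ hj, dif_neg hj, colIncl_tcast]

end Colours

/-! ### Chain maps and homotopies on total spaces -/

section Tot

variable {k : Type u} [Field k] {V W : ChainComplex (ModuleCat.{u} k) ℤ}

theorem totD_lof (V : ChainComplex (ModuleCat.{u} k) ℤ) (i : ℤ) (v : V.X i) :
    totD V (DirectSum.lof k ℤ (fun i => V.X i) i v) =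
      DirectSum.lof k ℤ (fun i => V.X i) (i - 1) ((V.d i (i - 1)).hom v) :=
  DirectSum.toModule_lof _ _ _

theorem totD_totD (a : Tot V) : totD V (totD V a) = 0 := by
  have : totD V ∘ₗ totD V = 0 :=
    DirectSum.linearMap_ext k fun i => LinearMap.ext fun v => by
      have h : (V.d (i - 1) (i - 1 - 1)).hom ((V.d i (i - 1)).hom v) = 0 :=
        LinearMap.congr_fun (congrArg ModuleCat.Hom.hom (V.d_comp_d i (i - 1) (i - 1 - 1))) v
      simp only [LinearMap.comp_apply, totD_lof, LinearMap.zero_apply, h, map_zero]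
  exact LinearMap.congr_fun this a

theorem totD_isHomog (i : ℤ) (a : Tot V) (ha : IsHomog i a) : IsHomog (-1 + i) (totD V a) := by
  obtain ⟨v, rfl⟩ := ha
  rw [totD_lof, neg_add_eq_sub]
  exact ⟨_, rfl⟩

/-- The map of direct sums given by a chain map. -/
noncomputable def totMap (f : V ⟶ W) : Tot V →ₗ[k] Tot W :=
  DirectSum.toModule k ℤ (Tot W) fun i => DirectSum.lof k ℤ (fun i => W.X i) i ∘ₗ (f.f i).hom

theorem totMap_lof (f : V ⟶ W) (i : ℤ) (v : V.X i) :
    totMap f (DirectSum.lof k ℤ (fun i => V.X i) i v) =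
      DirectSum.lof k ℤ (fun i => W.X i) i ((f.f i).hom v) :=
  DirectSum.toModule_lof _ _ _

theorem totMap_isHomog (f : V ⟶ W) (i : ℤ) (a : Tot V) (ha : IsHomog i a) :
    IsHomog (0 + i) (totMap f a) := by
  obtain ⟨v, rfl⟩ := ha
  rw [totMap_lof, zero_add]
  exact ⟨_, rfl⟩

theorem totD_totMap (f : V ⟶ W) (a : Tot V) : totD W (totMap f a) = totMap f (totD V a) := by
  have : totD W ∘ₗ totMap f = totMap f ∘ₗ totD V :=
    DirectSum.linearMap_ext k fun i => LinearMap.ext fun v => by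
      have h : (W.d i (i - 1)).hom ((f.f i).hom v) = (f.f (i - 1)).hom ((V.d i (i - 1)).hom v) :=
        LinearMap.congr_fun (congrArg ModuleCat.Hom.hom (f.comm i (i - 1))) v
      simp only [LinearMap.comp_apply, totD_lof, totMap_lof, h]
  exact LinearMap.congr_fun this a

/-- The map of direct sums given by a chain homotopy. -/
noncomputable def totHomotopy {f g : V ⟶ W} (h : Homotopy f g) : Tot V →ₗ[k] Tot W :=
  DirectSum.toModule k ℤ (Tot W) fun i =>
    DirectSum.lof k ℤ (fun i => W.X i) (i + 1) ∘ₗ (h.hom i (i + 1)).hom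

theorem totHomotopy_lof {f g : V ⟶ W} (h : Homotopy f g) (i : ℤ) (v : V.X i) :
    totHomotopy h (DirectSum.lof k ℤ (fun i => V.X i) i v) =
      DirectSum.lof k ℤ (fun i => W.X i) (i + 1) ((h.hom i (i + 1)).hom v) :=
  DirectSum.toModule_lof _ _ _

theorem totHomotopy_isHomog {f g : V ⟶ W} (h : Homotopy f g) (i : ℤ) (a : Tot V)
    (ha : IsHomog i a) : IsHomog (1 + i) (totHomotopy h a) := by
  obtain ⟨v, rfl⟩ := ha
  rw [totHomotopy_lof, add_comm i]
  exact ⟨_, rfl⟩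

theorem totHomotopy_comm {f g : V ⟶ W} (h : Homotopy f g) (a : Tot V) :
    totD W (totHomotopy h a) + totHomotopy h (totD V a) = totMap f a - totMap g a := by
  have : totD W ∘ₗ totHomotopy h + totHomotopy h ∘ₗ totD V = totMap f - totMap g := by
    refine DirectSum.linearMap_ext k fun i => LinearMap.ext fun v => ?_
    have hc := h.comm i
    rw [dNext_eq h.hom (show (ComplexShape.down ℤ).Rel i (i - 1) by simp),
      prevD_eq h.hom (show (ComplexShape.down ℤ).Rel (i + 1) i by simp)] at hc
    -- The degrees `i + 1 - 1` and `i - 1 + 1` equal `i` only propositionally; inside the direct sum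
    -- both terms can still be compared.
    have e₁ : DirectSum.lof k ℤ (fun i => W.X i) (i + 1 - 1)
        ((W.d (i + 1) (i + 1 - 1)).hom ((h.hom i (i + 1)).hom v)) =
        DirectSum.lof k ℤ (fun i => W.X i) i ((W.d (i + 1) i).hom ((h.hom i (i + 1)).hom v)) := by
      rw [add_sub_cancel_right]
    have e₂ : DirectSum.lof k ℤ (fun i => W.X i) (i - 1 + 1)
        ((h.hom (i - 1) (i - 1 + 1)).hom ((V.d i (i - 1)).hom v)) =
        DirectSum.lof k ℤ (fun i => W.X i) i ((h.hom (i - 1) i).hom ((V.d i (i - 1)).hom v)) := by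
      rw [sub_add_cancel]
    simp only [LinearMap.comp_apply, LinearMap.add_apply, LinearMap.sub_apply, totD_lof,
      totHomotopy_lof, totMap_lof]
    rw [e₁, e₂, hc, ← map_add, ← map_sub]
    congr 1
    simp only [ModuleCat.hom_add, ModuleCat.hom_comp, LinearMap.add_apply, LinearMap.comp_apply]
    abel
  exact LinearMap.congr_fun this a

end Tot

/-! ### The dg endomorphism operad -/

section EndVal

variable {k : Type u} [Field k] {C : Type} [DecidableEq C] {M : C × ℤ → Type u}
  [∀ x, AddCommGroup (M x)] [∀ x, Module k (M x)]

/-- The multilinear map underlying an operation of the endomorphism operad. -/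
noncomputable def endVal {n : ℕ} {c : Fin n → C} {o : C} {p : ℤ} :
    (endOperad k M).X n c o p →ₗ[k] Multi k M n :=
  Submodule.subtype (endSub k M n c o p)

theorem endVal_mem {n : ℕ} {c : Fin n → C} {o : C} {p : ℤ} (φ : (endOperad k M).X n c o p) :
    endVal φ ∈ endSub k M n c o p :=
  Subtype.property (p := fun φ => φ ∈ endSub k M n c o p) φ

theorem endVal_injective {n : ℕ} {c : Fin n → C} {o : C} {p : ℤ} :
    Function.Injective (endVal : (endOperad k M).X n c o p →ₗ[k] Multi k M n) :=
  Subtype.val_injective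

theorem endVal_comp {m n r : ℕ} {c : Fin m → C} {i : Fin m} {c' : Fin n → C} {b : C}
    {c'' : Fin r → C} {o : C} {p q t : ℤ} (g : Graft c i c' b c'') (h : p + q = t)
    (φ : (endOperad k M).X m c o p) (ψ : (endOperad k M).X n c' b q) :
    endVal ((endOperad k M).comp g h φ ψ) = compMulti g.e q (endVal φ) (endVal ψ) := rfl

end EndVal

namespace DGOperad

variable {k : Type u} [Field k] {C : Type}

/-- A graded operad, with the differential given by the commutator with an operation `D` of square
zero. -/
def inner (T : GradedOperad.{u} k C) (D : ∀ o, T.X 1 (fun _ => o) o (-1))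
    (hD : ∀ (o : C) (g : Graft (fun _ : Fin 1 => o) 0 (fun _ : Fin 1 => o) o (fun _ : Fin 1 => o))
      (h : -1 + -1 = (-2 : ℤ)), T.comp g h (D o) (D o) = 0) : DGOperad.{u} k C where
  toGradedOperad := T
  diff h := T.innerDiff D h
  diff_diff h h' x := GradedOperad.innerDiff_innerDiff hD h h' x
  diff_map σ hσ h x := GradedOperad.innerDiff_map σ hσ h x
  diff_comp g h ht hp hq h₁ h₂ x y := GradedOperad.innerDiff_comp g h ht hp hq h₁ h₂ x y

end DGOperad

section EndDG

variable {k : Type u} [Field k] {C : Type} [DecidableEq C]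
  (U : C → ChainComplex (ModuleCat.{u} k) ℤ)

/-- The operation with one input given by a homogeneous linear map. -/
noncomputable def unaryOp {c o : C} (f : Tot (U c) →ₗ[k] Tot (U o)) {p : ℤ}
    (hf : ∀ i a, IsHomog i a → IsHomog (p + i) (f a)) :
    (endOperad k (colComponents U)).X 1 (fun _ => c) o p :=
  (⟨unaryMulti f, unaryMulti_mem hf⟩ : endSub k (colComponents U) 1 (fun _ => c) o p)

theorem endVal_unaryOp {c o : C} (f : Tot (U c) →ₗ[k] Tot (U o)) {p : ℤ}
    (hf : ∀ i a, IsHomog i a → IsHomog (p + i) (f a)) : endVal (unaryOp U f hf) = unaryMulti f := rfl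

/-- The differential as an operation with one input. -/
noncomputable def diffOp (o : C) : (endOperad k (colComponents U)).X 1 (fun _ => o) o (-1) :=
  unaryOp U (totD (U o)) totD_isHomog

theorem comp_diffOp_diffOp (o : C)
    (g : Graft (fun _ : Fin 1 => o) 0 (fun _ : Fin 1 => o) o (fun _ : Fin 1 => o))
    (h : -1 + -1 = (-2 : ℤ)) :
    (endOperad k (colComponents U)).comp g h (diffOp U o) (diffOp U o) = 0 := by
  refine endVal_injective (Multi.ext_component fun x a ha => ?_)
  rw [endVal_comp, compMulti_apply _ _ _ _ ha, diffOp, endVal_unaryOp, unaryMulti_apply,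
    insertArg_self, unaryMulti_apply, colProj_colIncl, totD_totD, map_zero, smul_zero, map_zero]
  rfl

/-- The coloured dg endomorphism operad of a coloured chain complex. -/
noncomputable def endDG : DGOperad.{u} k C :=
  DGOperad.inner (endOperad k (colComponents U)) (diffOp U) (comp_diffOp_diffOp U)

variable {U}

/-- The differential is odd and passes the arguments to the left of `i`, which is the source of the
sign. -/
theorem endVal_ins {n : ℕ} {c : Fin n → C} {o : C} {p p' : ℤ} (h : p' + 1 = p)
    (φ : (endOperad k (colComponents U)).X n c o p) (i : Fin n) {s : Fin n → ℤ}
    {a : ∀ j, Tot (U (c j))} (ha : ∀ j, IsHomog (s j) (a j)) :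
    endVal ((endOperad k (colComponents U)).ins (diffOp U) c o h i φ)
        (fun j => colIncl U (c j) (a j)) =
      (∑ l : Fin n, if l < i then s l else 0).negOnePow •
        endVal φ fun j => colIncl U (c j) (Function.update a i (totD (U (c i)) (a i)) j) := by
  refine (compMulti_colIncl (Graft.unary c i) (Graft.unary_isPlanar c i) (-1) (endVal φ)
    (endVal (diffOp U (c i))) ha).trans ?_
  rw [diffOp, endVal_unaryOp, unaryMulti_apply, colProj_colIncl, insertArg_colIncl]
  congr 1
  · rw [neg_one_mul, Int.negOnePow_neg]
    congr 1
    rw [← Finset.add_sum_erase _ _ (Finset.mem_univ i), if_neg (lt_irrefl i), zero_add,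
      ← Finset.sum_subtype_of_mem (p := fun j => j ≠ i)]
    · exact Finset.sum_congr (by ext j; simp [j.2]) fun _ _ => rfl
    · intro j hj; simpa using hj
  · congr 1
    funext j
    by_cases hj : j = i
    · subst hj
      rw [dif_pos rfl, Function.update_self]
      rfl
    · rw [dif_neg hj, Function.update_of_ne hj]
      rfl

theorem endVal_post {n : ℕ} {c : Fin n → C} {o : C} {p p' : ℤ} (h : p' + 1 = p)
    (φ : (endOperad k (colComponents U)).X n c o p) {s : Fin n → ℤ}
    {a : ∀ j, Tot (U (c j))} (ha : ∀ j, IsHomog (s j) (a j)) :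
    endVal ((endOperad k (colComponents U)).post (diffOp U) c o h φ)
        (fun j => colIncl U (c j) (a j)) =
      colIncl U o (totD (U o) (colProj U o (endVal φ fun j => colIncl U (c j) (a j)))) := by
  have hg : (Graft.post c o).IsPlanar :=
    ⟨fun j => isEmptyElim j, fun _ _ => Iff.rfl, fun j => isEmptyElim j⟩
  refine (compMulti_colIncl (Graft.post c o) hg p (endVal (diffOp U o)) (endVal φ) ha).trans ?_
  rw [diffOp, endVal_unaryOp, unaryMulti_apply, insertArg_self, Finset.univ_eq_empty,
    Finset.sum_empty, mul_zero, Int.negOnePow_zero, one_smul]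
  simp only [colIncl_tcast]
  rfl

/-- Matches the commutator differential with the formula in `OperadAlgebra.act_diff`. -/
theorem endVal_diff {n : ℕ} {c : Fin n → C} {o : C} {p p' : ℤ} (h : p' + 1 = p)
    (φ : (endDG U).X n c o p) {s : Fin n → ℤ}
    {a : ∀ j, Tot (U (c j))} (ha : ∀ j, IsHomog (s j) (a j)) :
    endVal ((endDG U).diff h φ) (fun j => colIncl U (c j) (a j)) =
      colIncl U o (totD (U o) (colProj U o (endVal φ fun j => colIncl U (c j) (a j)))) -
        p.negOnePow • ∑ i : Fin n, (∑ l : Fin n, if l < i then s l else 0).negOnePow •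
          endVal φ fun j => colIncl U (c j) (Function.update a i (totD (U (c i)) (a i)) j) := by
  have := GradedOperad.innerDiff_apply (T := endOperad k (colComponents U)) (D := diffOp U) h φ
  refine (congrArg (fun ψ => endVal ψ fun j => colIncl U (c j) (a j)) this).trans ?_
  rw [map_sub, Units.smul_def, map_zsmul, map_sum]
  simp only [_root_.sub_apply, _root_.smul_apply, _root_.sum_apply, endVal_post h φ ha,
    endVal_ins h φ _ ha, Units.smul_def]

end EndDG

/-! ### Reduction of arbitrary grafts to planar ones -/

theorem exists_equiv_fin_lt_iff {S L : Type} [Fintype S] [LinearOrder L] {r : ℕ}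
    (hr : Fintype.card S = r) (key : S → L) (hkey : Function.Injective key) :
    ∃ e : S ≃ Fin r, ∀ a b, e a < e b ↔ key a < key b := by
  let inst : LinearOrder S := LinearOrder.lift' key hkey
  exact ⟨(Fintype.orderIsoFinOfCardEq S hr).symm.toEquiv,
    fun a b => (Fintype.orderIsoFinOfCardEq S hr).symm.lt_iff_lt⟩

namespace Graft

theorem exists_planar_equiv {m n r : ℕ} {i : Fin m} (e : {j : Fin m // j ≠ i} ⊕ Fin n ≃ Fin r) :
    ∃ e₀ : {j : Fin m // j ≠ i} ⊕ Fin n ≃ Fin r,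
      (∀ j j', e₀ (Sum.inl j) < e₀ (Sum.inl j') ↔ j.1 < j'.1) ∧
      (∀ l l', e₀ (Sum.inr l) < e₀ (Sum.inr l') ↔ l < l') ∧
      (∀ j l, e₀ (Sum.inl j) < e₀ (Sum.inr l) ↔ j.1 < i) := by
  -- Sorting first by the position in the first operation and then by the position in the second
  -- gives the planar order. The entry `0` for outer inputs causes no collision, since these have a
  -- first coordinate other than `i`.
  let key : {j : Fin m // j ≠ i} ⊕ Fin n → Fin m ×ₗ ℕ :=
    Sum.elim (fun j => toLex (j.1, 0)) fun l => toLex (i, l.1)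
  have hkey : Function.Injective key := by
    rintro (j | l) (j' | l') h
    · have := congrArg (fun y => (ofLex y).1) h
      exact congrArg Sum.inl (Subtype.ext this)
    · exact absurd (congrArg (fun y => (ofLex y).1) h) j.2
    · exact absurd (congrArg (fun y => (ofLex y).1) h).symm j'.2
    · have := congrArg (fun y => (ofLex y).2) h
      exact congrArg Sum.inr (Fin.ext this)
  obtain ⟨e₁, hlt⟩ := exists_equiv_fin_lt_iff
    ((Fintype.card_congr e).trans (Fintype.card_fin r)) key hkey
  refine ⟨e₁, fun j j' => (hlt _ _).trans ?_, fun l l' => (hlt _ _).trans ?_,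
    fun j l => (hlt _ _).trans ?_⟩
  · simp [key, Prod.Lex.toLex_lt_toLex]
  · simp [key, Prod.Lex.toLex_lt_toLex]
  · simp [key, Prod.Lex.toLex_lt_toLex, j.2]

/-- Algebras are only required to respect planar compositions, while morphisms respect all of them;
together with equivariance this factorization bridges the difference. -/
theorem exists_planar {C : Type} {m n r : ℕ} {c : Fin m → C} {i : Fin m} {c' : Fin n → C} {b : C}
    {c'' : Fin r → C} (g : Graft c i c' b c'') :
    ∃ (c₁ : Fin r → C) (g₀ : Graft c i c' b c₁) (ρ : Fin r ≃ Fin r), g₀.IsPlanar ∧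
      (∀ j, c'' (ρ j) = c₁ j) ∧ ∀ a, g.e a = ρ (g₀.e a) := by
  obtain ⟨e₀, h⟩ := exists_planar_equiv g.e
  refine ⟨fun j => c'' (g.e (e₀.symm j)), ⟨e₀, g.root, fun j => ?_, fun l => ?_⟩,
    e₀.symm.trans g.e, h, fun j => rfl, fun a => ?_⟩
  · rw [e₀.symm_apply_apply, g.outer]
  · rw [e₀.symm_apply_apply, g.inner]
  · simp

end Graft

theorem GradedOperad.comp_relabel {k : Type u} [Field k] {C : Type} (T : GradedOperad.{u} k C)
    {m n r : ℕ} {c : Fin m → C} {i : Fin m} {c' : Fin n → C} {b : C} {c₁ c'' : Fin r → C} {o : C}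
    {p q t : ℤ} (h : p + q = t) (g : Graft c i c' b c'') (g₀ : Graft c i c' b c₁)
    (ρ : Fin r ≃ Fin r) (hρ : ∀ j, c'' (ρ j) = c₁ j) (hg : ∀ a, g.e a = ρ (g₀.e a))
    (x : T.X m c o p) (y : T.X n c' b q) :
    T.comp g h x y = T.map ρ hρ (T.comp g₀ h x y) := by
  have := T.comp_map h (Equiv.refl _) (fun _ => rfl) (Equiv.refl _) (fun _ => rfl) ρ hρ g₀ g
    (fun j => hg _) (fun l => hg _) x y
  rwa [T.map_refl, T.map_refl] at this

/-! ### Algebras as morphisms to the endomorphism operad -/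

namespace OperadAlgebra

variable {k : Type u} [Field k] {C : Type} [DecidableEq C] {R : DGOperad.{u} k C}
  {U : C → ChainComplex (ModuleCat.{u} k) ℤ}

/-- The multilinear map on the sum of all components by which an operation acts. -/
noncomputable def actMulti (A : OperadAlgebra R U) {n : ℕ} {c : Fin n → C} {o : C} {p : ℤ} :
    R.X n c o p →ₗ[k] Multi k (colComponents U) n where
  toFun x := LinearMap.compMultilinearMap (colIncl U o)
    ((A.act x).compLinearMap fun j => colProj U (c j))
  map_add' x y := by
    refine MultilinearMap.ext fun a => ?_
    simp
  map_smul' t x := by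
    refine MultilinearMap.ext fun a => ?_
    simp

theorem actMulti_apply (A : OperadAlgebra R U) {n : ℕ} {c : Fin n → C} {o : C} {p : ℤ}
    (x : R.X n c o p) (a : Fin n → ColTot (colComponents U)) :
    A.actMulti x a = colIncl U o (A.act x fun j => colProj U (c j) (a j)) := rfl

theorem actMulti_colIncl (A : OperadAlgebra R U) {n : ℕ} {c : Fin n → C} {o : C} {p : ℤ}
    (x : R.X n c o p) (a : ∀ j, Tot (U (c j))) :
    A.actMulti x (fun j => colIncl U (c j) (a j)) = colIncl U o (A.act x a) := by
  rw [actMulti_apply]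
  simp only [colProj_colIncl]

theorem actMulti_mem (A : OperadAlgebra R U) {n : ℕ} {c : Fin n → C} {o : C} {p : ℤ}
    (x : R.X n c o p) : A.actMulti x ∈ endSub k (colComponents U) n c o p := by
  intro y a ha
  rw [actMulti_apply]
  by_cases hy : ∃ j, (y j).1 ≠ c j
  · obtain ⟨j, hj⟩ := hy
    rw [(A.act x).map_coord_zero j (colProj_of_ne U hj (ha j)), map_zero]
    exact ⟨zero_mem _, fun _ => rfl⟩
  · refine ⟨colIncl_mem U (A.act_homog x (fun j => (y j).2) _ fun j => ?_), fun h => absurd h hy⟩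
    push Not at hy
    have := ha j
    rw [show y j = (c j, (y j).2) from Prod.ext (hy j) rfl] at this
    exact isHomog_colProj U this

theorem actMulti_map (A : OperadAlgebra R U) {n n' : ℕ} {c : Fin n → C} {c' : Fin n' → C} {o : C}
    {p : ℤ} (σ : Fin n ≃ Fin n') (hσ : ∀ j, c' (σ j) = c j) (x : R.X n c o p) :
    A.actMulti (R.map σ hσ x) = permMulti σ (A.actMulti x) :=
  endSub_ext (A.actMulti_mem _) (permMulti_mem σ hσ (A.actMulti_mem x)) fun s a ha => by
    rw [actMulti_colIncl, permMulti_colIncl σ hσ _ ha, A.act_map σ hσ x s a ha, actMulti_colIncl,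
      Units.smul_def, map_zsmul, Units.smul_def]

theorem actMulti_comp_of_planar (A : OperadAlgebra R U) {m n r : ℕ} {c : Fin m → C} {i : Fin m}
    {c' : Fin n → C} {b : C} {c'' : Fin r → C} {o : C} {p q t : ℤ} (g : Graft c i c' b c'')
    (hg : g.IsPlanar) (h : p + q = t) (x : R.X m c o p) (y : R.X n c' b q) :
    A.actMulti (R.comp g h x y) = compMulti g.e q (A.actMulti x) (A.actMulti y) :=
  endSub_ext (A.actMulti_mem _) (compMulti_mem g h (A.actMulti_mem x) (A.actMulti_mem y))
    fun s a ha => by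
      rw [actMulti_colIncl, compMulti_colIncl g hg q _ _ ha, A.act_comp g hg h x y s a ha,
        actMulti_colIncl, insertArg_colIncl, actMulti_colIncl, Units.smul_def, map_zsmul,
        Units.smul_def]

/-- The morphism to the endomorphism operad given by an algebra. -/
noncomputable def toEnd (A : OperadAlgebra R U) : DGOperad.Hom R (endDG U) where
  app {n c o p} := LinearMap.codRestrict (endSub k (colComponents U) n c o p) A.actMulti
    A.actMulti_mem
  app_map σ hσ x := endVal_injective (A.actMulti_map σ hσ x)
  app_one o := by
    refine endVal_injective (endSub_ext (A.actMulti_mem _) (oneMulti_mem o) fun s a ha => ?_)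
    refine (A.actMulti_colIncl _ a).trans ((congrArg _ (A.act_one o a)).trans ?_)
    exact ((oneMulti_apply o (colIncl_mem U (ha 0))).trans (if_pos rfl)).symm
  app_comp {m n r c i c' b c'' o p q t} g h x y := by
    -- Replace the graft by a planar one followed by a relabelling; both `R` and the endomorphism
    -- operad are compatible with this.
    obtain ⟨c₁, g₀, ρ, hg₀, hρ, hg⟩ := g.exists_planar
    have e₁ : A.actMulti (R.comp g h x y) =
        permMulti ρ (compMulti g₀.e q (A.actMulti x) (A.actMulti y)) := by
      rw [R.comp_relabel h g g₀ ρ hρ hg, actMulti_map, A.actMulti_comp_of_planar g₀ hg₀]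
    refine endVal_injective (e₁.trans ?_)
    exact (congrArg endVal ((endOperad k (colComponents U)).comp_relabel h g g₀ ρ hρ hg
      (⟨A.actMulti x, A.actMulti_mem x⟩ : endSub k (colComponents U) m c o p)
      (⟨A.actMulti y, A.actMulti_mem y⟩ : endSub k (colComponents U) n c' b q))).symm
  app_diff {n c o p p'} h x := by
    let φ : (endDG U).X n c o p :=
      (⟨A.actMulti x, A.actMulti_mem x⟩ : endSub k (colComponents U) n c o p)
    refine endVal_injective (endSub_ext (A.actMulti_mem _) (endVal_mem _) fun s a ha => ?_)
    refine Eq.trans ?_ (endVal_diff h φ ha).symm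
    have hφ : ∀ a : ∀ j, Tot (U (c j)), endVal φ (fun j => colIncl U (c j) (a j)) =
      colIncl U o (A.act x a) := A.actMulti_colIncl x
    refine (A.actMulti_colIncl _ a).trans ?_
    rw [A.act_diff h x s a ha]
    simp only [hφ, colProj_colIncl, map_sub, Units.smul_def, map_zsmul, map_sum]

theorem endVal_toEnd (A : OperadAlgebra R U) {n : ℕ} {c : Fin n → C} {o : C} {p : ℤ}
    (x : R.X n c o p) : endVal (A.toEnd.app x) = A.actMulti x := rfl

section OfEnd

variable (G : DGOperad.Hom R (endDG U))

theorem endVal_eq {n : ℕ} {c : Fin n → C} {o : C} {p : ℤ} (φ : (endDG U).X n c o p) {s : Fin n → ℤ}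
    {a : ∀ j, Tot (U (c j))} (ha : ∀ j, IsHomog (s j) (a j)) :
    colIncl U o (colProj U o (endVal φ fun j => colIncl U (c j) (a j))) =
      endVal φ fun j => colIncl U (c j) (a j) :=
  colIncl_colProj U (endVal_mem φ (fun j => (c j, s j)) _ fun j => colIncl_mem U (ha j)).1

/-- The action of the operations of the endomorphism operad. -/
noncomputable def endAct {n : ℕ} {c : Fin n → C} {o : C} {p : ℤ} :
    (endOperad k (colComponents U)).X n c o p →ₗ[k]
      MultilinearMap k (fun j => Tot (U (c j))) (Tot (U o)) where
  toFun φ := LinearMap.compMultilinearMap (colProj U o)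
    ((endVal φ).compLinearMap fun j => colIncl U (c j))
  map_add' φ ψ := by
    refine MultilinearMap.ext fun a => ?_
    rw [map_add]
    simp
  map_smul' t φ := by
    refine MultilinearMap.ext fun a => ?_
    rw [map_smul]
    simp

/-- The algebra given by a morphism to the endomorphism operad. -/
noncomputable def ofEnd : OperadAlgebra R U where
  act := endAct ∘ₗ G.app
  act_homog x s a ha := isHomog_colProj U
    (endVal_mem (G.app x) (fun j => (_, s j)) _ fun j => colIncl_mem U (ha j)).1
  act_map {n n' c c' o p} σ hσ x s a ha := by
    change colProj U o (endVal (G.app (R.map σ hσ x)) fun j => colIncl U (c' j) (a j)) =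
      _ • colProj U o (endVal (G.app x) _)
    rw [G.app_map, show endVal ((endDG U).map σ hσ (G.app x)) = permMulti σ (endVal (G.app x))
      from rfl, permMulti_colIncl σ hσ _ ha, Units.smul_def, map_zsmul, Units.smul_def]
  act_one o a := by
    change colProj U o (endVal (G.app (R.one o)) fun j => colIncl U o (a j)) = a 0
    rw [G.app_one, show endVal ((endDG U).one o) = oneMulti k _ o from rfl]
    have : ∀ v : Tot (U o), colProj U o (oneMulti k (colComponents U) o fun _ => colIncl U o v) = v := by
      intro v
      have e : colProj U o ∘ₗ proj k (fun x : C × ℤ => x.1 = o) ∘ₗ colIncl U o = LinearMap.id :=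
        DirectSum.linearMap_ext k fun i => LinearMap.ext fun v => by
          simp only [LinearMap.comp_apply]
          rw [proj_apply (colIncl_mem U ⟨v, rfl⟩), if_pos rfl, colProj_colIncl]
          rfl
      exact LinearMap.congr_fun e v
    rw [← this (a 0)]
    congr 2
  act_comp {m n r c i c' b c'' o p q t} g hg h x y s a ha := by
    change colProj U o (endVal (G.app (R.comp g h x y)) fun j => colIncl U (c'' j) (a j)) =
      _ • colProj U o (endVal (G.app x) _)
    rw [G.app_comp, show endVal ((endDG U).comp g h (G.app x) (G.app y)) =
      compMulti g.e q (endVal (G.app x)) (endVal (G.app y)) from rfl,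
      compMulti_colIncl g hg q _ _ ha, ← endVal_eq (G.app y) (s := fun l => s (g.e (Sum.inr l)))
        (fun l => IsHomog.tcast U _ (ha _)), insertArg_colIncl, Units.smul_def, map_zsmul,
      Units.smul_def]
    rfl
  act_diff {n c o p p'} h x s a ha := by
    change colProj U o (endVal (G.app (R.diff h x)) fun j => colIncl U (c j) (a j)) =
      totD (U o) (colProj U o (endVal (G.app x) _)) - _ • ∑ j, _ • colProj U o (endVal (G.app x) _)
    rw [G.app_diff]
    refine (congrArg (colProj U o) (endVal_diff h (G.app x) ha)).trans ?_
    simp only [map_sub, Units.smul_def, map_zsmul, map_sum, colProj_colIncl]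

theorem ofEnd_act {n : ℕ} {c : Fin n → C} {o : C} {p : ℤ} (x : R.X n c o p)
    (a : ∀ j, Tot (U (c j))) :
    (ofEnd G).act x a = colProj U o (endVal (G.app x) fun j => colIncl U (c j) (a j)) := rfl

/-- Agreement of the two morphisms is only needed at the operation in question, which is how the
structures on source and target are seen to be unchanged. -/
theorem ofEnd_act_of_eq {A : OperadAlgebra R U} {n : ℕ} {c : Fin n → C} {o : C} {p : ℤ}
    {x : R.X n c o p} (h : G.app x = A.toEnd.app x) : (ofEnd G).act x = A.act x := by
  refine MultilinearMap.ext fun a => ?_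
  rw [ofEnd_act, h, endVal_toEnd, actMulti_colIncl, colProj_colIncl]

end OfEnd

section ActsAs

variable {R : DGOperad.{u} k Bool} {U : Bool → ChainComplex (ModuleCat.{u} k) ℤ}
  {s : R.X 1 (fun _ => false) true 0}

theorem ActsAs.toEnd_app {A : OperadAlgebra R U} {f : U false ⟶ U true} (h : A.ActsAs s f) :
    A.toEnd.app s = unaryOp U (totMap f) (totMap_isHomog f) := by
  refine endVal_injective (endSub_ext (endVal_mem _) (endVal_mem _) fun i a ha => ?_)
  rw [endVal_toEnd, actMulti_colIncl, endVal_unaryOp, unaryMulti_apply, colProj_colIncl]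
  obtain ⟨v, hv⟩ := ha 0
  have ha : a = fun _ => a 0 := funext fun j => by rw [Subsingleton.elim j 0]
  rw [ha, hv, h, totMap_lof]

theorem actsAs_ofEnd {G : DGOperad.Hom R (endDG U)} {f : U false ⟶ U true}
    (h : G.app s = unaryOp U (totMap f) (totMap_isHomog f)) : (ofEnd G).ActsAs s f := by
  intro i v
  rw [ofEnd_act, h, endVal_unaryOp, unaryMulti_apply, colProj_colIncl, colProj_colIncl, totMap_lof]

end ActsAs

end OperadAlgebra

/-! ### Homotopies as paths, and the statement with fixed source and target -/

section Homotopies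

open scoped TensorProduct
open Polynomial

namespace DGOperad

variable {k : Type u} [Field k] {C D : Type}

/-- Change of colours of a morphism. -/
def Hom.pull {P Q : DGOperad.{u} k D} (f : C → D) (Φ : Hom P Q) : Hom (P.pull f) (Q.pull f) where
  toHom := Φ.toHom.pull f
  app_diff h x := Φ.app_diff h x

/-- Homologous cycles are joined by a path. -/
theorem exists_path (T : DGOperad.{u} k C) {n : ℕ} {c : Fin n → C} {o : C} {p p' : ℤ}
    (h : p' + 1 = p) {x y : T.X n c o p} {w : T.X n c o (p + 1)} (hx : T.diff h x = 0)
    (hy : T.diff h y = 0) (hw : T.diff rfl w = p.negOnePow • (x - y)) :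
    ∃ z : T.path.X n c o p, T.path.diff h z = 0 ∧ (T.pathEval 0).app z = x ∧
      (T.pathEval 1).app z = y := by
  subst h
  -- The straight segment from `x` to `y`. Its derivative `y - x` is compensated by the boundary of
  -- the `dt`-component `w`.
  let z₀ : T.X n c o (p' + 1) ⊗[k] k[X] := x ⊗ₜ (1 - X) + y ⊗ₜ X
  let z₁ : T.X n c o (p' + 1 + 1) ⊗[k] k[X] := w ⊗ₜ 1
  have e₀ : (T.diff rfl).rTensor k[X] z₀ = 0 := by
    simp [z₀, hx, hy]
  have e₁ : (T.diff rfl).rTensor k[X] z₁ +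
      (p' + 1).negOnePow • (derivative : k[X] →ₗ[k] k[X]).lTensor (T.X n c o (p' + 1)) z₀ = 0 := by
    simp only [z₀, z₁, map_add, LinearMap.rTensor_tmul, LinearMap.lTensor_tmul, hw, derivative_sub,
      derivative_one, derivative_X, zero_sub, TensorProduct.tmul_neg, Units.smul_def,
      ← TensorProduct.smul_tmul', ← smul_add, TensorProduct.sub_tmul]
    rw [← smul_zero (((p' + 1).negOnePow : ℤˣ) : ℤ)]
    congr 1
    abel
  refine ⟨(z₀, z₁), ?_, ?_, ?_⟩
  · exact (Derivation.epsDiff_apply (T.coeffDerivation (derivative' (R := k))) rfl rfl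
      (z₀, z₁)).trans (Prod.ext e₀ e₁)
  · change evalCoeff 0 z₀ = x
    simp [z₀, evalCoeff_tmul]
  · change evalCoeff 1 z₀ = y
    simp [z₀, evalCoeff_tmul]

end DGOperad

section Homotopy

variable {k : Type u} [Field k] {C : Type} [DecidableEq C]
  {U : C → ChainComplex (ModuleCat.{u} k) ℤ}

theorem diff_unaryOp {c o : C} {p p' : ℤ} (h : p' + 1 = p) (f : Tot (U c) →ₗ[k] Tot (U o))
    (hf : ∀ i a, IsHomog i a → IsHomog (p + i) (f a)) (f' : Tot (U c) →ₗ[k] Tot (U o))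
    (hf' : ∀ i a, IsHomog i a → IsHomog (p' + i) (f' a))
    (hff : ∀ a, f' a = totD (U o) (f a) - p.negOnePow • f (totD (U c) a)) :
    (endDG U).diff h (unaryOp U f hf) = unaryOp U f' hf' := by
  refine endVal_injective (endSub_ext (endVal_mem _) (endVal_mem _) fun s a ha => ?_)
  refine (endVal_diff h (unaryOp U f hf) ha).trans ?_
  rw [Fin.sum_univ_one, Fin.sum_univ_one, if_neg (lt_irrefl _), Int.negOnePow_zero, one_smul,
    endVal_unaryOp, endVal_unaryOp, unaryMulti_apply, unaryMulti_apply, unaryMulti_apply,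
    colProj_colIncl, colProj_colIncl, colProj_colIncl, hff, map_sub, Function.update_self,
    Units.smul_def, Units.smul_def, map_zsmul]

/-- A homotopy has degree `1`, so its boundary in the endomorphism operad is `dh + hd = f - g`; it
can serve directly as the `dt`-component of a path. -/
theorem exists_path_of_homotopy {U : Bool → ChainComplex (ModuleCat.{u} k) ℤ}
    {f g : U false ⟶ U true} (h : Homotopy f g) :
    ∃ z : (endDG U).path.X 1 (fun _ => false) true 0,
      (endDG U).path.diff (neg_add_cancel 1) z = 0 ∧
      ((endDG U).pathEval 0).app z = unaryOp U (totMap f) (totMap_isHomog f) ∧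
      ((endDG U).pathEval 1).app z = unaryOp U (totMap g) (totMap_isHomog g) := by
  have hcycle : ∀ f : U false ⟶ U true, (endDG U).diff (neg_add_cancel 1)
      (unaryOp U (totMap f) (totMap_isHomog f)) = 0 := by
    intro f
    refine (diff_unaryOp _ _ _ 0 (fun i a _ => IsHomog.zero _) fun a => ?_).trans
      (endVal_injective (MultilinearMap.ext fun a => ?_))
    · rw [Int.negOnePow_zero, one_smul, totD_totMap, sub_self, LinearMap.zero_apply]
    · rw [endVal_unaryOp, unaryMulti_apply, LinearMap.zero_apply, map_zero]
      rfl
  have hh : ∀ i a, IsHomog i a → IsHomog (0 + 1 + i) (totHomotopy h a) := fun i a ha =>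
    totHomotopy_isHomog h i a ha
  refine (endDG U).exists_path (neg_add_cancel 1) (hcycle f) (hcycle g)
    (w := unaryOp U (totHomotopy h) hh) ?_
  refine (diff_unaryOp rfl _ hh (totMap f - totMap g) (fun i a ha => ?_) fun a => ?_).trans ?_
  · obtain ⟨v, hv⟩ := totMap_isHomog f i a ha
    obtain ⟨w, hw⟩ := totMap_isHomog g i a ha
    exact ⟨v - w, by rw [LinearMap.sub_apply, hv, hw, map_sub]⟩
  · rw [zero_add, Int.negOnePow_one, Units.neg_smul, one_smul, sub_neg_eq_add, totHomotopy_comm,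
      LinearMap.sub_apply]
  · rw [Int.negOnePow_zero, one_smul]
    refine endVal_injective (MultilinearMap.ext fun a => ?_)
    refine Eq.trans ?_ (congrArg (fun φ : Multi k (colComponents U) 1 => φ a)
      (map_sub (endVal (M := colComponents U)) (unaryOp U (totMap f) (totMap_isHomog f))
        (unaryOp U (totMap g) (totMap_isHomog g)))).symm
    rw [_root_.sub_apply, endVal_unaryOp, endVal_unaryOp, endVal_unaryOp, unaryMulti_apply,
      unaryMulti_apply, unaryMulti_apply, LinearMap.sub_apply, map_sub]

/-- The given structure is lifted along evaluation at `0`, with constant paths on source and target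
and the path of the homotopy on the arrow; the lift is then evaluated at `1`. -/
theorem OperadAlgebra.exists_actsAs_of_homotopy_rel [CharZero k] {R : DGOperad.{u} k Bool}
    {s : R.X 1 (fun _ => false) true 0} (hs : ∀ (p : ℤ) (h : p + 1 = 0), R.diff h s = 0)
    {U : Bool → ChainComplex (ModuleCat.{u} k) ℤ} {R₀ : DGOperad.{u} k Unit}
    {i₀ : DGOperad.Hom R₀ (R.pull fun _ => false)} {i₁ : DGOperad.Hom R₀ (R.pull fun _ => true)}
    (hi : DGOperad.IsEndpointCofibration i₀ i₁ s)
    {V : OperadAlgebra R₀ fun _ => U false} {W : OperadAlgebra R₀ fun _ => U true}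
    {F : OperadAlgebra R U} {f g : U false ⟶ U true} (hV : F.RestrictsTo i₀ V)
    (hW : F.RestrictsTo i₁ W) (hf : F.ActsAs s f) (h : Homotopy f g) :
    ∃ G : OperadAlgebra R U, G.RestrictsTo i₀ V ∧ G.RestrictsTo i₁ W ∧ G.ActsAs s g := by
  obtain ⟨z, hz, hz₀, hz₁⟩ := exists_path_of_homotopy h
  let Φ : DGOperad.Hom R (endDG U).path := (endDG U).pathConst.comp F.toEnd
  obtain ⟨Ψ, hΨ, hΨs⟩ := hi.exists_lift hs (endDG U).pathEval_liftsBoundaries F.toEnd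
    ((Φ.pull fun _ => false).comp i₀) ((Φ.pull fun _ => true).comp i₁) z
    (fun p hp => by
      obtain rfl : p = -1 := by omega
      exact hz)
    (fun n c o p x => (endDG U).pathEval_pathConst 0 _)
    (fun n c o p x => (endDG U).pathEval_pathConst 0 _)
    (hz₀.trans hf.toEnd_app.symm)
  refine ⟨ofEnd (((endDG U).pathEval 1).comp Ψ), fun n c o p x => ?_, fun n c o p x => ?_,
    actsAs_ofEnd ?_⟩
  · rw [← hV]
    refine ofEnd_act_of_eq _ ((congrArg ((endDG U).pathEval 1).app (hΨ n c o p x).1).trans ?_)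
    exact (endDG U).pathEval_pathConst 1 _
  · rw [← hW]
    refine ofEnd_act_of_eq _ ((congrArg ((endDG U).pathEval 1).app (hΨ n c o p x).2).trans ?_)
    exact (endDG U).pathEval_pathConst 1 _
  · exact (congrArg ((endDG U).pathEval 1).app hΨs).trans hz₁

end Homotopy

end Homotopies

/-! ### Cutting down arities zero and one, and the statement for the underlying map -/

theorem Graft.card_eq {C : Type} {m n r : ℕ} {c : Fin m → C} {i : Fin m} {c' : Fin n → C} {b : C}
    {c'' : Fin r → C} (g : Graft c i c' b c'') : m + n = r + 1 := by
  have h := Fintype.card_congr g.e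
  rw [Fintype.card_sum, Fintype.card_subtype_compl, Fintype.card_fin, Fintype.card_fin,
    Fintype.card_fin, Fintype.card_subtype_eq] at h
  have := i.pos
  omega

theorem Submodule.mem_span_of_subsingleton {k V : Type*} [Ring k] [AddCommGroup V] [Module k V]
    {S : Set V} (hS : S.Subsingleton) {x : V} (hx : x ∈ Submodule.span k S) :
    x = 0 ∨ ∃ y ∈ S, ∃ a : k, x = a • y := by
  rcases hS.eq_empty_or_singleton with rfl | ⟨y, rfl⟩
  · left; simpa using hx
  · obtain ⟨a, rfl⟩ := Submodule.mem_span_singleton.mp hx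
    exact Or.inr ⟨y, rfl, a, rfl⟩

namespace GradedOperad

variable {k : Type u} [Field k] (T : GradedOperad.{u} k Bool)
  (s : T.X 1 (fun _ => false) true 0)

/-- The units, the operation `s`, and all operations with at least two inputs. -/
inductive LowGen : ∀ (n : ℕ) (c : Fin n → Bool) (o : Bool) (p : ℤ), T.X n c o p → Prop
  | one (o : Bool) : LowGen 1 (fun _ => o) o 0 (T.one o)
  | arrow : LowGen 1 (fun _ => false) true 0 s
  | high {n : ℕ} {c : Fin n → Bool} {o : Bool} {p : ℤ} (hn : 2 ≤ n) (x : T.X n c o p) :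
    LowGen n c o p x

variable {T s}

theorem LowGen.pos {n : ℕ} {c : Fin n → Bool} {o : Bool} {p : ℤ} {x : T.X n c o p}
    (hx : T.LowGen s n c o p x) : 1 ≤ n := by
  cases hx with
  | one => exact le_rfl
  | arrow => exact le_rfl
  | high hn => omega

theorem LowGen.heq_one {n : ℕ} {c : Fin n → Bool} {o : Bool} {p : ℤ} {x : T.X n c o p}
    (hx : T.LowGen s n c o p x) (hn : n = 1) (hc : ∀ j, c j = o) : HEq x (T.one o) := by
  cases hx with
  | one => rfl
  | arrow => exact absurd (hc 0) (by simp)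
  | high h => omega

theorem LowGen.heq_arrow {n : ℕ} {c : Fin n → Bool} {o : Bool} {p : ℤ} {x : T.X n c o p}
    (hx : T.LowGen s n c o p x) (hn : n = 1) (hc : ∀ j, c j ≠ o) : HEq x s := by
  cases hx with
  | one => exact absurd rfl (hc 0)
  | arrow => rfl
  | high h => omega

/-- In arity `1` the colours decide: equal input and output colours allow only the unit, different
ones only the arrow. In arity `0` there is nothing. -/
theorem LowGen.subsingleton {n : ℕ} (hn : n < 2) (c : Fin n → Bool) (o : Bool) (p : ℤ) :
    {x | T.LowGen s n c o p x}.Subsingleton := by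
  intro x (hx : T.LowGen s n c o p x) y (hy : T.LowGen s n c o p y)
  have hn1 : n = 1 := le_antisymm (by omega) hx.pos
  subst hn1
  by_cases hc : c 0 = o
  · have hc' : ∀ j, c j = o := fun j => by rw [Subsingleton.elim j 0, hc]
    exact eq_of_heq ((hx.heq_one rfl hc').trans (hy.heq_one rfl hc').symm)
  · have hc' : ∀ j, c j ≠ o := fun j => by rwa [Subsingleton.elim j 0]
    exact eq_of_heq ((hx.heq_arrow rfl hc').trans (hy.heq_arrow rfl hc').symm)

theorem LowGen.map {n n' : ℕ} {c : Fin n → Bool} {c' : Fin n' → Bool} {o : Bool} {p : ℤ}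
    (σ : Fin n ≃ Fin n') (hσ : ∀ j, c' (σ j) = c j) {x : T.X n c o p}
    (hx : T.LowGen s n c o p x) : T.LowGen s n' c' o p (T.map σ hσ x) := by
  obtain rfl : n = n' := Fin.equiv_iff_eq.mp ⟨σ⟩
  by_cases hn : 2 ≤ n
  · exact .high hn _
  · have hn1 : n = 1 := le_antisymm (by omega) hx.pos
    subst hn1
    obtain rfl : σ = Equiv.refl _ := Subsingleton.elim _ _
    obtain rfl : c' = c := funext hσ
    rw [show T.map (Equiv.refl (Fin 1)) hσ x = x from T.map_refl x]
    exact hx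

/-- No generator has arity `0`, so a composite with fewer than two inputs has two unary factors. One
of them is a unit, since the colours do not allow composing the arrow with itself. -/
theorem LowGen.comp {m n r : ℕ} {c : Fin m → Bool} {i : Fin m} {c' : Fin n → Bool} {b : Bool}
    {c'' : Fin r → Bool} {o : Bool} {p q t : ℤ} (g : Graft c i c' b c'') (h : p + q = t)
    {x : T.X m c o p} {y : T.X n c' b q} (hx : T.LowGen s m c o p x)
    (hy : T.LowGen s n c' b q y) : T.LowGen s r c'' o t (T.comp g h x y) := by
  have hr := g.card_eq
  have hy1 := hy.pos
  by_cases hr2 : 2 ≤ r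
  · exact .high hr2 _
  have hm := hx.pos
  obtain rfl : m = 1 := by omega
  obtain rfl : n = 1 := by omega
  obtain rfl := Subsingleton.elim i 0
  cases hx with
  | one =>
    obtain rfl : o = b := g.root
    obtain rfl : q = t := by omega
    have := T.one_comp g ((Equiv.emptySum _ _).symm.trans g.e) (fun l => g.inner l)
      (fun l => rfl) y
    rw [this]
    exact hy.map _ _
  | arrow =>
    have hb : false = b := g.root
    cases hy with
    | one =>
      obtain rfl : t = 0 := by omega
      have := T.comp_one g ((Equiv.emptySum _ _).symm.trans g.e)
        (fun j => (g.inner j).trans hb.symm) (fun j => isEmptyElim j) rfl s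
      rw [this]
      exact LowGen.arrow.map _ _
    | arrow => exact absurd hb (by simp)
    | high h => omega
  | high hn => omega

/-- The suboperad generated by the units, the operation `s`, and all operations with at least two
inputs. -/
def lowSub (T : GradedOperad.{u} k Bool) (s : T.X 1 (fun _ => false) true 0) : T.Suboperad where
  carrier n c o p := Submodule.span k {x | T.LowGen s n c o p x}
  map_mem {n n' c c' o p} σ hσ x hx := by
    have h : Submodule.span k {x | T.LowGen s n c o p x} ≤
        (Submodule.span k {x | T.LowGen s n' c' o p x}).comap (T.map σ hσ) :=
      Submodule.span_le.mpr fun x hx => Submodule.subset_span (LowGen.map σ hσ hx)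
    exact h hx
  one_mem o := Submodule.subset_span (.one o)
  comp_mem {m n r c i c' b c'' o p q t} g h x y hx hy := by
    induction hx, hy using Submodule.span_induction₂ with
    | mem_mem x y hx hy => exact Submodule.subset_span (hx.comp g h hy)
    | zero_left y hy => simp
    | zero_right x hx => simp
    | add_left x y z _ _ _ h₁ h₂ => rw [map_add]; exact add_mem h₁ h₂
    | add_right x y z _ _ _ h₁ h₂ => rw [map_add]; exact add_mem h₁ h₂
    | smul_left a x y _ _ h => rw [map_smul]; exact Submodule.smul_mem _ a h
    | smul_right a x y _ _ h => rw [map_smul]; exact Submodule.smul_mem _ a h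

end GradedOperad

namespace DGOperad

variable {k : Type u} [Field k]

theorem isStable_lowSub (T : DGOperad.{u} k Bool) {s : T.X 1 (fun _ => false) true 0}
    (hs : ∀ (p : ℤ) (h : p + 1 = 0), T.diff h s = 0) :
    T.IsStable (T.toGradedOperad.lowSub s) := by
  intro n c o p p' h x hx
  have : Submodule.span k {x | T.toGradedOperad.LowGen s n c o p x} ≤
      (Submodule.span k {x | T.toGradedOperad.LowGen s n c o p' x}).comap (T.diff h) := by
    refine Submodule.span_le.mpr ?_
    rintro x (_ | _ | hn)
    · exact (Submodule.mem_comap.mpr (by rw [T.diff_one _ h]; exact zero_mem _))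
    · exact (Submodule.mem_comap.mpr (by rw [hs _ h]; exact zero_mem _))
    · exact Submodule.subset_span (.high hn _)
  exact this hx

theorem diff_eq_zero_of_lowSub (T : DGOperad.{u} k Bool) {s : T.X 1 (fun _ => false) true 0}
    (hs : ∀ (p : ℤ) (h : p + 1 = 0), T.diff h s = 0) {n : ℕ} (hn : n < 2) {c : Fin n → Bool}
    {o : Bool} {p p' : ℤ} (h : p' + 1 = p) {x : T.X n c o p}
    (hx : x ∈ (T.toGradedOperad.lowSub s).carrier n c o p) : T.diff h x = 0 := by
  have : Submodule.span k {x | T.toGradedOperad.LowGen s n c o p x} ≤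
      LinearMap.ker (T.diff h) := by
    refine Submodule.span_le.mpr ?_
    rintro x (_ | _ | hn)
    · exact T.diff_one _ h
    · exact hs _ h
    · omega
  exact this hx

/-- A morphism from a cofibrant resolution of `homOperad` lifts along a morphism that lifts boundaries,
with any prescribed value on the arrow. The lift is the composite of a projection with a lift of `α` to
the part of the fibre product that consists of the units, the arrow, and the operations with at least
two inputs. -/
theorem IsCofibrantResolution.exists_lift [CharZero k] {P : GradedOperad.{u} k Unit}
    (hP : P.IsConnected) {R : DGOperad.{u} k Bool} {α : Hom R (ofGraded P.homOperad)}
    (hα : IsCofibrantResolution α) {s : R.X 1 (fun _ => false) true 0}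
    (hs : ∀ (p : ℤ) (h : p + 1 = 0), R.diff h s = 0) (hsα : α.app s = P.arrow)
    {S T : DGOperad.{u} k Bool} {ε : Hom S T} (hε : ε.LiftsBoundaries) (Φ : Hom R T)
    {z : S.X 1 (fun _ => false) true 0} (hz : ∀ (p : ℤ) (h : p + 1 = 0), S.diff h z = 0)
    (hzs : ε.app z = Φ.app s) : ∃ Ψ : Hom R S, Ψ.app s = z := by
  -- The arrow paired with its prescribed value. By `hzs` it lies in the fibre product, and it will
  -- be the only arrow, up to scalars, of the suboperad `K`.
  let t : (R.prod S).X 1 (fun _ => false) true 0 := (s, z)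
  have ht : ∀ (p : ℤ) (h : p + 1 = 0), (R.prod S).diff h t = 0 := fun p h =>
    Prod.ext (hs p h) (hz p h)
  let fib : (R.prod S).toGradedOperad.Suboperad :=
    (Φ.toHom.comp (fst R S).toHom).eqLocus (ε.toHom.comp (snd R S).toHom)
  let L := (R.prod S).toGradedOperad.lowSub t
  let K := fib.inter L
  have hK : (R.prod S).IsStable K := by
    intro n c o p p' h x hx
    refine ⟨?_, (R.prod S).isStable_lowSub ht h x hx.2⟩
    have hx1 : Φ.app x.1 = ε.app x.2 := hx.1
    change Φ.app (R.diff h x.1) = ε.app (S.diff h x.2)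
    rw [Φ.app_diff, ε.app_diff, hx1]
  let Q := (R.prod S).sub K hK
  let π : Hom Q (ofGraded P.homOperad) := (α.comp (fst R S)).comp ((R.prod S).subIncl K hK)
  -- The units and the arrow are both sent to the unit of `P`, which is nonzero. Since low-arity
  -- components of `L` have at most one generator, injectivity follows.
  have hgen : ∀ (n : ℕ) (c : Fin n → Bool) (o : Bool) (p : ℤ) (x : (R.prod S).X n c o p), n < 2 →
      (R.prod S).toGradedOperad.LowGen t n c o p x → α.app x.1 ≠ 0 := by
    rintro n c o p x hn (_ | _ | hn')
    · refine fun h => hP.2.2.2 ?_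
      exact congrArg Subtype.val ((α.app_one _).symm.trans h)
    · refine fun h => hP.2.2.2 ?_
      exact congrArg Subtype.val (hsα.symm.trans h)
    · omega
  have hinj : ∀ (n : ℕ) (c : Fin n → Bool) (o : Bool) (p : ℤ) (x : (R.prod S).X n c o p), n < 2 →
      x ∈ L.carrier n c o p → α.app x.1 = 0 → x = 0 := by
    intro n c o p x hn hx h0
    rcases Submodule.mem_span_of_subsingleton
      (GradedOperad.LowGen.subsingleton hn c o p) hx with h | ⟨y, hy, a, rfl⟩
    · exact h
    · have h1 : a • α.app y.1 = 0 := by rw [← map_smul]; exact h0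
      rcases smul_eq_zero.mp h1 with h | h
      · rw [h, zero_smul]
      · exact absurd h (hgen n c o p y hn hy)
  have hmem : ∀ (n : ℕ) (c : Fin n → Bool) (o : Bool) (p : ℤ) (x : (R.prod S).X n c o p), n < 2 →
      (R.prod S).toGradedOperad.LowGen t n c o p x → x ∈ K.carrier n c o p := by
    intro n c o p x hn hx
    refine ⟨?_, Submodule.subset_span hx⟩
    cases hx with
    | one => exact fib.one_mem o
    | arrow => exact hzs.symm
    | high => omega
  -- Connectedness enters here: in low arities the target is zero or spanned by the image of a unit
  -- or of the arrow.
  have hsurj : ∀ (n : ℕ) (c : Fin n → Bool) (o : Bool) (p : ℤ) (w : P.homSub n c o p), n < 2 →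
      ∃ x ∈ K.carrier n c o p, α.app x.1 = w := by
    intro n c o p w hn
    have h0 : w = 0 → ∃ x ∈ K.carrier n c o p, α.app x.1 = w := fun h =>
      ⟨0, zero_mem _, by rw [h]; exact map_zero _⟩
    obtain rfl | rfl : n = 0 ∨ n = 1 := by omega
    · exact h0 (Subtype.ext (hP.1 _ _ _ w.1))
    · by_cases hp : p = 0
      · subst hp
        rcases w.2 with hc | hw
        · obtain ⟨a, ha⟩ := hP.2.2.1 w.1
          suffices h : ∃ x, (R.prod S).toGradedOperad.LowGen t 1 c o 0 x ∧
              Subtype.val (p := (· ∈ P.homSub 1 c o 0)) (α.app x.1) = P.one () by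
            obtain ⟨x, hx, hx'⟩ := h
            refine ⟨a • x, Submodule.smul_mem _ a (hmem _ _ _ _ x hn hx), ?_⟩
            refine (map_smul α.app a x.1).trans (Subtype.ext ?_)
            rw [ha, ← hx']
            rfl
          by_cases hco : c 0 = o
          · obtain rfl : c = fun _ => o := funext fun j => by rw [Subsingleton.elim j 0, hco]
            exact ⟨_, .one o, congrArg Subtype.val (α.app_one o)⟩
          · have hlt : ∀ b o : Bool, b ≠ o → b ≤ o → b = false ∧ o = true := by decide
            obtain ⟨h1, rfl⟩ := hlt _ _ hco (hc 0)
            obtain rfl : c = fun _ => false := funext fun j => by rw [Subsingleton.elim j 0, h1]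
            exact ⟨t, .arrow, congrArg Subtype.val hsα⟩
        · exact h0 (Subtype.ext hw)
      · exact h0 (Subtype.ext (hP.2.1 _ _ _ w.1 hp))
  have hπ : π.LiftsBoundaries := by
    intro n c o p p' h x w hx hw
    have hx' : α.app x.1.1 = 0 := hw.symm
    by_cases hn : n < 2
    · obtain ⟨y, hy, hyw⟩ := hsurj n c o p w hn
      refine ⟨⟨y, hy⟩, Subtype.ext ?_, hyw⟩
      refine ((R.prod S).diff_eq_zero_of_lowSub ht hn h hy.2).trans ?_
      exact (hinj n c o p' x.1 hn x.2.2 hx').symm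
    · have hd : ∀ (p'' : ℤ) (h' : p'' + 1 = p'), (R.prod S).diff h' x.1 = 0 := fun p'' h' =>
        congrArg Subtype.val (hx p'' h')
      obtain ⟨p'', h'⟩ : ∃ p'', p'' + 1 = p' := ⟨p' - 1, by omega⟩
      -- Injectivity in homology provides some `r` with the right boundary. The error `w - α r` is
      -- then corrected by a cycle `v`; as the target has zero differential, agreement in homology
      -- is equality there.
      obtain ⟨r, hr⟩ := (hα.2 n c o p' p p'' h h').1 x.1.1 (congrArg Prod.fst (hd p'' h'))
        ⟨0, (map_zero _).trans hx'.symm⟩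
      obtain ⟨v, hv, v', hv'⟩ := (hα.2 n c o p (p + 1) p' rfl h).2 (w - α.app r) rfl
      have hv'' : w - α.app r - α.app v = 0 := hv'.symm
      have hαr : α.app (r + v) = w := by
        rw [map_add]
        have := sub_eq_zero.mp hv''
        rw [← this]
        abel
      have hdr : R.diff h (r + v) = x.1.1 := by rw [map_add, hr, hv, add_zero]
      have hfib : Φ.app x.1.1 = ε.app x.1.2 := x.2.1
      -- The second component has to bound `x.1.2` and lie over `Φ (r + v)`, which is the lifting
      -- problem that `ε` solves. In arity at least two `K` is the whole fibre product, so the pair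
      -- belongs to it.
      obtain ⟨y, hy, hy'⟩ := hε n c o p p' h x.1.2 (Φ.app (r + v))
        (fun p'' h' => congrArg Prod.snd (hd p'' h')) (by rw [← Φ.app_diff, hdr, hfib])
      exact ⟨⟨(r + v, y), hy'.symm, Submodule.subset_span (.high (by omega) _)⟩,
        Subtype.ext (Prod.ext hdr hy), hαr⟩
  obtain ⟨Λ, hΛ⟩ := hα.1.exists_lift hπ α
  refine ⟨((snd R S).comp ((R.prod S).subIncl K hK)).comp Λ, ?_⟩
  -- Both elements lie over `α s`, and the projection is injective in arity one: the lift has no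
  -- choice on the arrow.
  have hΛs : (Λ.app s).1 - t = 0 := by
    refine hinj 1 _ _ 0 _ (by omega) (sub_mem (Λ.app s).2.2 (Submodule.subset_span .arrow)) ?_
    have h1 : α.app (Λ.app s).1.1 = α.app s := hΛ _ _ _ _ s
    refine (map_sub α.app (Λ.app s).1.1 s).trans ?_
    rw [h1, sub_self]
  exact congrArg Prod.snd (sub_eq_zero.mp hΛs)

end DGOperad

theorem OperadAlgebra.exists_actsAs_of_homotopy {k : Type u} [Field k] [CharZero k]
    {P : GradedOperad.{u} k Unit} (hP : P.IsConnected) {R : DGOperad.{u} k Bool}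
    {α : DGOperad.Hom R (DGOperad.ofGraded P.homOperad)} (hα : DGOperad.IsCofibrantResolution α)
    {s : R.X 1 (fun _ => false) true 0} (hs : ∀ (p : ℤ) (h : p + 1 = 0), R.diff h s = 0)
    (hsα : α.app s = P.arrow) {U : Bool → ChainComplex (ModuleCat.{u} k) ℤ}
    {F : OperadAlgebra R U} {f g : U false ⟶ U true} (hf : F.ActsAs s f) (h : Homotopy f g) :
    ∃ G : OperadAlgebra R U, G.ActsAs s g := by
  obtain ⟨z, hz, hz₀, hz₁⟩ := exists_path_of_homotopy h
  obtain ⟨Ψ, hΨ⟩ := hα.exists_lift hP hs hsα (endDG U).pathEval_liftsBoundaries F.toEnd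
    (fun p hp => by
      obtain rfl : p = -1 := by omega
      exact hz)
    (hz₀.trans hf.toEnd_app.symm)
  exact ⟨ofEnd (((endDG U).pathEval 1).comp Ψ),
    actsAs_ofEnd ((congrArg ((endDG U).pathEval 1).app hΨ).trans hz₁)⟩

theorem mainTheorem4 {k : Type u} [Field k] [CharZero k]
    (P : GradedOperad.{u} k Unit) (hP : P.IsConnected)
    (R : DGOperad.{u} k Bool) (α : DGOperad.Hom R (DGOperad.ofGraded P.homOperad))
    (hα : DGOperad.IsCofibrantResolution α)
    (s : R.X 1 (fun _ => false) true 0) (hs : ∀ (p : ℤ) (h : p + 1 = 0), R.diff h s = 0)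
    (hsα : α.app s = P.arrow)
    (U : Bool → ChainComplex (ModuleCat.{u} k) ℤ) :
    (∀ (F : OperadAlgebra R U) (f g : U false ⟶ U true),
      F.ActsAs s f → Nonempty (Homotopy f g) → ∃ G : OperadAlgebra R U, G.ActsAs s g) ∧
    (∀ (R₀ : DGOperad.{u} k Unit) (α₀ : DGOperad.Hom R₀ (DGOperad.ofGraded P))
      (_ : DGOperad.IsCofibrantResolution α₀)
      (i₀ : DGOperad.Hom R₀ (R.pull fun _ => false))
      (i₁ : DGOperad.Hom R₀ (R.pull fun _ => true))
      (_ : ∀ (n : ℕ) (c : Fin n → Unit) (o : Unit) (p : ℤ) (x : R₀.X n c o p),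
        α.app (i₀.app x) = (DGOperad.homIncl P false).app (α₀.app x) ∧
        α.app (i₁.app x) = (DGOperad.homIncl P true).app (α₀.app x))
      (_ : DGOperad.IsEndpointCofibration i₀ i₁ s)
      (V : OperadAlgebra R₀ fun _ => U false) (W : OperadAlgebra R₀ fun _ => U true)
      (F : OperadAlgebra R U) (f g : U false ⟶ U true),
      F.RestrictsTo i₀ V → F.RestrictsTo i₁ W → F.ActsAs s f → Nonempty (Homotopy f g) →
      ∃ G : OperadAlgebra R U, G.RestrictsTo i₀ V ∧ G.RestrictsTo i₁ W ∧ G.ActsAs s g) :=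
  ⟨fun _ _ _ hf ⟨h⟩ => OperadAlgebra.exists_actsAs_of_homotopy hP hα hs hsα hf h,
    fun _ _ _ _ _ _ hi _ _ _ _ _ hV hW hf ⟨h⟩ =>
      OperadAlgebra.exists_actsAs_of_homotopy_rel hs hi hV hW hf h⟩
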